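/- Let $\nu>0$ with $\nu\notin\{\tfrac12,1,\tfrac32,2,\dots\}$, and let $0<a\le b<2\pi$. Let $K_\nu$ be the modified Bessel function of the second kind, $\zeta$ the Riemann zeta function, and for $m,n\ge 0$ put \[A_{m,n}=\frac{\Gamma(m+n+1)\Gamma(m+n+\frac32)}{m!\,n!\,\Gamma(m+\frac32)\Gamma(n+1+\nu)}\,\zeta(2m+2n+2),\] \[B_{m,n}=\frac{\Gamma(\frac m2+n+\frac12-\nu)\,\Gamma(\frac m2+n+1-\nu)}{\Gamma(\frac m2+\frac12)\Gamma(\frac m2+1)\,n!\,\Gamma(n+1-\nu)}\,\zeta(m+2n+1-2\nu)\,\sin\pi(\tfrac m2-\nu).\] Then the sum $S_{K,\nu}(a,b)=\sum_{n=1}^\infty e^{-an}(\frac12 bn)^{-\nu}K_\nu(bn)$ converges and has the convergent expansion \[S_{K,\nu}(a,b)=\frac{\sqrt\pi}{2b}\Gamma(\tfrac12-\nu)\Bigl(1-\frac{a^2}{b^2}\Bigr)^{\nu-\frac12}+\frac{\pi\csc\pi\nu}{4\,\Gamma(1+\nu)}-\frac{a}{b^2}\Gamma(1-\nu)\,{}_2F_1\Bigl(1,1-\nu;\frac32;\frac{a^2}{b^2}\Bigr)-\frac{1}{2\sin\pi\nu}R,\]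 \[R=\sum_{m,n\ge0}(-1)^{m+n}\Bigl\{A_{m,n}\Bigl(\frac a{2\pi}\Bigr)^{2m+1}\Bigl(\frac b{2\pi}\Bigr)^{2n}+B_{m,n}\Bigl(\frac a{2\pi}\Bigr)^{m}\Bigl(\frac b{2\pi}\Bigr)^{2n-2\nu}\Bigr\}.\] Here the double series is an iterated sum, which converges to the same value $R$ in both orders of summation; if $a+b<2\pi$ it also converges absolutely as a double series. When $a=b$ and $\nu<\frac12$ the first and the third term are singular, and their sum is understood as its (finite) limit as $a\to b^-$. Moreover, for every $k\ge0$ the series \[C_k=\sum_{n=0}^\infty(-1)^nA_{k,n}\Bigl(\frac b{2\pi}\Bigr)^{2n},\qquad C'_k=\sum_{n=0}^\infty(-1)^nB_{k,n}\Bigl(\frac b{2\pi}\Bigr)^{2n-2\nu}\] converge, and with $D_{2k}=C'_{2k}$ and $D_{2k+1}=C'_{2k+1}+(-1)^{k-1}C_k$ the last term of the expansion equals the convergent series \[-\frac1{2\sin\pi\nu}R=-\frac{1}{2\sin\pi\nu}\sum_{k=0}^\infty(-1)^kD_k\Bigl(\frac a{2\pi}\Bigr)^k,\] which is also its asymptotic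 expansion as $a\to0^+$ with $b$ fixed: truncating the sum over $k$ to $k<N$ changes the value of the expansion by $O(a^N)$, for every $N\ge 0$. -/

import Mathlib

open Filter Topology Asymptotics

noncomputable section

namespace BesselSum

/-- The modified Bessel function of the first kind
`I_ν(x) = ∑ₖ (x/2)^(ν+2k) / (k! Γ(ν+k+1))`, for real order and `x > 0`. -/
def besselI (ν x : ℝ) : ℝ :=
  ∑' k : ℕ, (x / 2) ^ (ν + 2 * (k : ℝ)) / ((k.factorial : ℝ) * Real.Gamma (ν + k + 1))

/-- The modified Bessel function `K_ν(x) = π (I_{-ν}(x) - I_ν(x)) / (2 sin πν)`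
for real non-integer order `ν` and `x > 0`. -/
def besselK (ν x : ℝ) : ℝ :=
  Real.pi * (besselI (-ν) x - besselI ν x) / (2 * Real.sin (Real.pi * ν))

/-- The summand `e^{-an} (bn/2)^{-ν} K_ν(bn)`. -/
def summandK (ν a b : ℝ) (n : ℕ) : ℝ :=
  Real.exp (-a * n) * (b * n / 2) ^ (-ν) * besselK ν (b * n)

/-- `S_{K,ν}(a,b) = ∑_{n ≥ 1} e^{-an} (bn/2)^{-ν} K_ν(bn)`. -/
def sumK (ν a b : ℝ) : ℝ := ∑' n : ℕ, summandK ν a b (n + 1)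

/-- The Riemann zeta function at a real argument, as a real number. -/
def realZeta (s : ℝ) : ℝ := (riemannZeta (s : ℂ)).re

/-- The coefficients `A_{m,n}`. -/
def coeffA (ν : ℝ) (m n : ℕ) : ℝ :=
  Real.Gamma (m + n + 1) * Real.Gamma (m + n + 3 / 2) /
    ((m.factorial : ℝ) * (n.factorial : ℝ) * Real.Gamma (m + 3 / 2) * Real.Gamma (n + 1 + ν)) *
    realZeta (2 * m + 2 * n + 2)

/-- The coefficients `B_{m,n}`; dividing by `csc` is written as multiplying by `sin`. -/
def coeffB (ν : ℝ) (m n : ℕ) : ℝ :=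
  Real.Gamma (m / 2 + n + 1 / 2 - ν) * Real.Gamma (m / 2 + n + 1 - ν) /
    (Real.Gamma (m / 2 + 1 / 2) * Real.Gamma (m / 2 + 1) * (n.factorial : ℝ) *
      Real.Gamma (n + 1 - ν)) *
    (realZeta (m + 2 * n + 1 - 2 * ν) * Real.sin (Real.pi * (m / 2 - ν)))

/-- The term of index `(m, n)` of the double series. -/
def doubleTerm (ν a b : ℝ) (m n : ℕ) : ℝ :=
  (-1) ^ (m + n) *
    (coeffA ν m n * (a / (2 * Real.pi)) ^ (2 * m + 1) * (b / (2 * Real.pi)) ^ (2 * n) +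
      coeffB ν m n * (a / (2 * Real.pi)) ^ m * (b / (2 * Real.pi)) ^ (2 * (n : ℝ) - 2 * ν))

/-- The `n`-th term of the series for `C_k`. -/
def termC (ν b : ℝ) (k n : ℕ) : ℝ :=
  (-1) ^ n * coeffA ν k n * (b / (2 * Real.pi)) ^ (2 * n)

/-- The `n`-th term of the series for `C'_k`. -/
def termC' (ν b : ℝ) (k n : ℕ) : ℝ :=
  (-1) ^ n * coeffB ν k n * (b / (2 * Real.pi)) ^ (2 * (n : ℝ) - 2 * ν)

/-- `C_k = ∑ₙ (-1)ⁿ A_{k,n} (b/2π)^{2n}`. -/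
def coeffC (ν b : ℝ) (k : ℕ) : ℝ := ∑' n : ℕ, termC ν b k n

/-- `C'_k = ∑ₙ (-1)ⁿ B_{k,n} (b/2π)^{2n-2ν}`. -/
def coeffC' (ν b : ℝ) (k : ℕ) : ℝ := ∑' n : ℕ, termC' ν b k n

/-- `D_{2j} = C'_{2j}` and `D_{2j+1} = C'_{2j+1} + (-1)^{j-1} C_j`
(the sign is written `(-1)^{j+1}`, so that the exponent is a natural number). -/
def coeffD (ν b : ℝ) (k : ℕ) : ℝ :=
  if Even k then coeffC' ν b k
  else coeffC' ν b k + (-1) ^ (k / 2 + 1) * coeffC ν b (k / 2)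

/-- The sum of the first and the third term of the expansion,
`(√π / 2b) Γ(½-ν) (1-a²/b²)^{ν-½} - (a/b²) Γ(1-ν) ₂F₁(1, 1-ν; 3/2; a²/b²)`. -/
def leadingPair (ν a b : ℝ) : ℝ :=
  Real.sqrt Real.pi / (2 * b) * Real.Gamma (1 / 2 - ν) * (1 - a ^ 2 / b ^ 2) ^ (ν - 1 / 2) -
    a / b ^ 2 * Real.Gamma (1 - ν) *
      ordinaryHypergeometric (1 : ℝ) (1 - ν) (3 / 2) (a ^ 2 / b ^ 2)

end BesselSum

end

open BesselSum

noncomputable section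

namespace BesselSum

open MeasureTheory Set

/-! Put F(x) = (x/2)^(-ν) K_ν(x) (`besselF`). For a < b the exponential e^{-aN} may be expanded
inside the sum, because F(bN) decays almost like e^{-bN}. So S is a power series in a whose
coefficients are the moments ∑ N^m F(bN) (`hasSum_sumK_moments`), and everything rests on evaluating
these moments.

For real s > 2ν the function x^s F(bx), extended by zero, is continuous, and Poisson summation
applies (`tsum_besselKernel`). The zero frequency gives the Mellin transform of F. The frequencies
2πik with k ≠ 0 lie outside the disc |w| ≤ b, since b < 2π, and there the Laplace transform equals
the termwise transform of the power series of I_{-ν} and I_ν. Adding the frequencies k and -k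
produces zeta values, which the functional equation turns into ζ(-s-2n) and ζ(2ν-s-2n). Both sides
are analytic in s, so the formula extends to s = 0, 1, 2, ... (`besselDirichlet_eq`,
`tsum_pow_mul_besselF`).

Summed over m, the Mellin parts give the binomial and hypergeometric terms (`hasSum_mellinTerm`).
The trivial zeros of ζ kill the I_ν part of the even moments except for ζ(0), which gives the
cosecant term. What remains is the series with coefficients D_k (`hasSum_coeffD_of_lt`).

The two orders of summation are handled separately. Since Γ(w)ζ(w) is the integral of
x^(w-1)/(e^x-1), each term of the double series is an integral of a product of a Bessel term, a sine
term and 1/(e^x-1). The terms grow like e^{bx/2π} and e^{ax/2π}, but the full sums are a J-type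
Bessel function, of polynomial growth, and a bounded sine. An iterated sum thus never meets both
exponentials at once, and a, b < 2π suffices; joint summation needs a + b < 2π
(`exists_hasIteratedSum_integral`).

This also gives convergence of the D-series at a = b. As S and the D-series are continuous up to
that endpoint, the first plus third term has a limit there, and the expansion persists
(`exists_leadingPair_limit`). -/

/-! ### Power series of the Bessel functions of imaginary argument. -/

/-- The Taylor coefficients of `(x/2)^(-μ) I_μ(x)` in powers of `x ^ 2`. -/
def besselCoeff (μ : ℝ) (n : ℕ) : ℝ := 1 / (4 ^ n * (n.factorial : ℝ) * Real.Gamma (n + 1 + μ))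

theorem besselCoeff_succ {μ : ℝ} (hμ : ∀ n : ℕ, (n : ℝ) + 1 + μ ≠ 0) (n : ℕ) :
    besselCoeff μ (n + 1) = besselCoeff μ n / (4 * (n + 1) * (n + 1 + μ)) := by
  have h : ((n + 1 : ℕ) : ℝ) + 1 + μ = (n + 1 + μ) + 1 := by push_cast; ring
  rw [besselCoeff, besselCoeff, h, Real.Gamma_add_one (hμ n), Nat.factorial_succ]
  push_cast
  rw [div_div]
  congr 1
  ring

theorem besselCoeff_ne_zero {μ : ℝ} (hμ : ∀ n : ℕ, (n : ℝ) + 1 + μ ≠ 0) (n : ℕ) :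
    besselCoeff μ n ≠ 0 := by
  have h : Real.Gamma (n + 1 + μ) ≠ 0 := by
    refine Real.Gamma_ne_zero fun m hm => hμ (n + m) ?_
    push_cast
    linarith
  unfold besselCoeff
  positivity

theorem tendsto_quadratic_ratio (σ μ : ℝ) :
    Tendsto (fun n : ℕ => ((σ + 2 * n) * (σ + 2 * n + 1)) / (4 * ((n : ℝ) + 1) * (n + 1 + μ)))
      atTop (𝓝 1) := by
  have h0 : Tendsto (fun n : ℕ => ((n : ℝ))⁻¹) atTop (𝓝 0) := tendsto_inv_atTop_nhds_zero_nat
  have h1 : Tendsto (fun n : ℕ => ((σ * ((n : ℝ))⁻¹ + 2) * ((σ + 1) * ((n : ℝ))⁻¹ + 2)) /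
      (4 * (1 + ((n : ℝ))⁻¹) * (1 + (1 + μ) * ((n : ℝ))⁻¹))) atTop
      (𝓝 (((σ * 0 + 2) * ((σ + 1) * 0 + 2)) / (4 * (1 + 0) * (1 + (1 + μ) * 0)))) := by
    refine Tendsto.div ?_ ?_ (by norm_num)
    · exact ((h0.const_mul σ).add_const 2).mul ((h0.const_mul (σ + 1)).add_const 2)
    · exact ((h0.const_add 1).const_mul 4).mul ((h0.const_mul (1 + μ)).const_add 1)
  have e : ((σ * 0 + 2) * ((σ + 1) * 0 + 2)) / (4 * (1 + 0) * (1 + (1 + μ) * 0)) = (1 : ℝ) := by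
    norm_num
  rw [e] at h1
  refine h1.congr' ?_
  filter_upwards [eventually_gt_atTop 0] with n hn
  have hn' : (n : ℝ) ≠ 0 := by positivity
  have e1 : σ * ((n : ℝ))⁻¹ + 2 = (σ + 2 * n) * (n : ℝ)⁻¹ := by field_simp
  have e2 : (σ + 1) * ((n : ℝ))⁻¹ + 2 = (σ + 2 * n + 1) * (n : ℝ)⁻¹ := by field_simp; ring
  have e3 : 1 + ((n : ℝ))⁻¹ = (n + 1) * (n : ℝ)⁻¹ := by field_simp
  have e4 : 1 + (1 + μ) * ((n : ℝ))⁻¹ = (n + 1 + μ) * (n : ℝ)⁻¹ := by field_simp; ring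
  rw [e1, e2, e3, e4]
  have hi : (n : ℝ)⁻¹ * (n : ℝ)⁻¹ ≠ 0 := by positivity
  calc _ = ((σ + 2 * n) * (σ + 2 * n + 1) * ((n : ℝ)⁻¹ * (n : ℝ)⁻¹)) /
        (4 * ((n : ℝ) + 1) * (n + 1 + μ) * ((n : ℝ)⁻¹ * (n : ℝ)⁻¹)) := by ring
    _ = _ := mul_div_mul_right _ _ hi

/-- Consecutive ratios tend to r², by `tendsto_quadratic_ratio`. This unit radius of convergence is
the source of the condition b < |w| for the Laplace transforms and of b < 2π for the zeta series. -/
theorem summable_besselCoeff_mul_Gamma {μ σ r : ℝ} (hμ : ∀ n : ℕ, (n : ℝ) + 1 + μ ≠ 0)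
    (hσ : 0 < σ) (hr0 : 0 < r) (hr : r < 1) :
    Summable fun n : ℕ => |besselCoeff μ n| * Real.Gamma (σ + 2 * n) * r ^ (2 * n) := by
  have hG : ∀ n : ℕ, 0 < Real.Gamma (σ + 2 * n) := fun n => Real.Gamma_pos_of_pos (by positivity)
  have hc : ∀ n : ℕ, 0 < |besselCoeff μ n| := fun n => abs_pos.2 (besselCoeff_ne_zero hμ n)
  refine summable_of_ratio_test_tendsto_lt_one (l := r ^ 2) (by nlinarith) ?_ ?_
  · exact Eventually.of_forall fun n => by
      have := hG n
      have := hc n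
      positivity
  · have h := ((tendsto_quadratic_ratio σ μ).abs).const_mul (r ^ 2)
    rw [abs_one, mul_one] at h
    refine h.congr fun n => ?_
    have hg : Real.Gamma (σ + 2 * ((n + 1 : ℕ) : ℝ)) =
        (σ + 2 * n + 1) * ((σ + 2 * n) * Real.Gamma (σ + 2 * n)) := by
      rw [← Real.Gamma_add_one (by positivity), ← Real.Gamma_add_one (by positivity)]
      congr 1
      push_cast
      ring
    have h1 := (hG n).ne'
    have h2 := (hc n).ne'
    have h3 : |(n : ℝ) + 1 + μ| ≠ 0 := abs_ne_zero.2 (hμ n)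
    have h4 : |σ + 2 * (n : ℝ)| = σ + 2 * n := abs_of_pos (by positivity)
    have h5 : |σ + 2 * (n : ℝ) + 1| = σ + 2 * n + 1 := abs_of_pos (by positivity)
    have h6 : |(n : ℝ) + 1| = n + 1 := abs_of_pos (by positivity)
    rw [hg, besselCoeff_succ hμ]
    simp only [norm_mul, norm_pow, Real.norm_eq_abs, abs_abs, abs_div, abs_mul, h4, h5, h6,
      abs_of_pos (hG n), abs_of_pos hr0]
    have h7 : |(4 : ℝ)| = 4 := by norm_num
    rw [h7]
    field_simp
    ring

/-- A single term of the convergent series with σ = 1 and r = 1/c is at most its sum. The bound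
compares with the coefficients of cosh(cx), for any c > 1. -/
theorem exists_abs_besselCoeff_le {μ c : ℝ} (hμ : ∀ n : ℕ, (n : ℝ) + 1 + μ ≠ 0) (hc : 1 < c) :
    ∃ C : ℝ, 0 < C ∧ ∀ n : ℕ, |besselCoeff μ n| ≤ C * (c ^ (2 * n) / ((2 * n).factorial : ℝ)) := by
  have hs := summable_besselCoeff_mul_Gamma (σ := 1) (r := c⁻¹) hμ one_pos (by positivity)
    (inv_lt_one_of_one_lt₀ hc)
  have hnn : ∀ n : ℕ, 0 ≤ |besselCoeff μ n| * Real.Gamma (1 + 2 * n) * c⁻¹ ^ (2 * n) := fun n => by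
    have : 0 < Real.Gamma (1 + 2 * (n : ℝ)) := Real.Gamma_pos_of_pos (by positivity)
    positivity
  refine ⟨(∑' n : ℕ, |besselCoeff μ n| * Real.Gamma (1 + 2 * n) * c⁻¹ ^ (2 * n)) + 1, ?_, ?_⟩
  · have : 0 ≤ ∑' n : ℕ, |besselCoeff μ n| * Real.Gamma (1 + 2 * n) * c⁻¹ ^ (2 * n) :=
      tsum_nonneg hnn
    linarith
  · intro n
    have h1 := hs.le_tsum n (fun j _ => hnn j)
    have h2 : Real.Gamma (1 + 2 * (n : ℝ)) = ((2 * n).factorial : ℝ) := by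
      rw [← Real.Gamma_nat_eq_factorial]
      push_cast
      ring_nf
    have hf : (0 : ℝ) < ((2 * n).factorial : ℝ) := by positivity
    have hcp : (0 : ℝ) < c ^ (2 * n) := by positivity
    rw [h2] at h1
    have h3 : |besselCoeff μ n| =
        (|besselCoeff μ n| * ((2 * n).factorial : ℝ) * c⁻¹ ^ (2 * n)) *
          (c ^ (2 * n) / ((2 * n).factorial : ℝ)) := by
      rw [inv_pow]
      field_simp
    rw [h3]
    gcongr
    linarith

/-- `∑ₙ x^(2n) / (4ⁿ n! Γ(n+1+μ)) = (x/2)^(-μ) I_μ(x)`. -/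
def besselE (μ x : ℝ) : ℝ := ∑' n : ℕ, besselCoeff μ n * x ^ (2 * n)

/-- The factor (cx)^(2k) in the bound for the tail is what later permits division by x^(2k) near x =
0. -/
theorem exists_summable_abs_besselCoeff_le {μ c : ℝ} (hμ : ∀ n : ℕ, (n : ℝ) + 1 + μ ≠ 0)
    (hc : 1 < c) :
    ∃ C : ℝ, 0 < C ∧ ∀ x : ℝ, 0 ≤ x → (Summable fun n : ℕ => |besselCoeff μ n| * x ^ (2 * n)) ∧
      ∀ k : ℕ, ∑' n : ℕ, |besselCoeff μ (n + k)| * x ^ (2 * (n + k)) ≤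
        C * (c * x) ^ (2 * k) * Real.exp (c * x) := by
  obtain ⟨C, hC, hb⟩ := exists_abs_besselCoeff_le hμ hc
  have hle : ∀ x : ℝ, 0 ≤ x → ∀ n k : ℕ, |besselCoeff μ (n + k)| * x ^ (2 * (n + k)) ≤
      C * (c * x) ^ (2 * k) * ((c * x) ^ (2 * n) / ((2 * n).factorial : ℝ)) := by
    intro x hx n k
    calc |besselCoeff μ (n + k)| * x ^ (2 * (n + k))
        ≤ C * (c ^ (2 * (n + k)) / ((2 * (n + k)).factorial : ℝ)) * x ^ (2 * (n + k)) := by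
          gcongr
          exact hb _
      _ ≤ C * (c ^ (2 * (n + k)) / ((2 * n).factorial : ℝ)) * x ^ (2 * (n + k)) := by
          gcongr
          omega
      _ = _ := by
          rw [mul_add, pow_add, pow_add, mul_pow, mul_pow]
          ring
  have hexp : ∀ y : ℝ, 0 ≤ y → (Summable fun n : ℕ => y ^ (2 * n) / ((2 * n).factorial : ℝ)) ∧
      ∑' n : ℕ, y ^ (2 * n) / ((2 * n).factorial : ℝ) ≤ Real.exp y := by
    intro y hy
    have h := Real.hasSum_cosh y
    refine ⟨h.summable, h.tsum_eq.trans_le ?_⟩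
    rw [Real.cosh_eq]
    have : Real.exp (-y) ≤ Real.exp y := Real.exp_le_exp.2 (by linarith)
    linarith
  refine ⟨C, hC, fun x hx => ⟨?_, fun k => ?_⟩⟩
  · refine Summable.of_nonneg_of_le (fun n => by positivity) (fun n => ?_)
      ((hexp (c * x) (by positivity)).1.mul_left (C * (c * x) ^ (2 * 0)))
    exact hle x hx n 0
  · have h1 := (hexp (c * x) (by positivity)).1.mul_left (C * (c * x) ^ (2 * k))
    calc _ ≤ ∑' n : ℕ, C * (c * x) ^ (2 * k) * ((c * x) ^ (2 * n) / ((2 * n).factorial : ℝ)) :=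
          Summable.tsum_le_tsum (fun n => hle x hx n k)
            (Summable.of_nonneg_of_le (fun n => by positivity) (fun n => hle x hx n k) h1) h1
      _ ≤ _ := by
          rw [tsum_mul_left]
          gcongr
          exact (hexp (c * x) (by positivity)).2

theorem summable_besselE {μ : ℝ} (hμ : ∀ n : ℕ, (n : ℝ) + 1 + μ ≠ 0) (x : ℝ) :
    Summable fun n : ℕ => besselCoeff μ n * x ^ (2 * n) := by
  obtain ⟨C, -, h⟩ := exists_summable_abs_besselCoeff_le hμ one_lt_two
  refine Summable.of_norm ?_
  refine ((h |x| (abs_nonneg x)).1).congr fun n => ?_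
  rw [norm_mul, norm_pow, Real.norm_eq_abs, Real.norm_eq_abs]

theorem rpow_mul_besselI (μ : ℝ) {x : ℝ} (hx : 0 < x) (τ : ℝ) :
    (x / 2) ^ τ * besselI μ x = (x / 2) ^ (τ + μ) * besselE μ x := by
  have hx2 : 0 < x / 2 := by positivity
  rw [besselI, besselE, ← tsum_mul_left, ← tsum_mul_left]
  refine tsum_congr fun n => ?_
  have h1 : (x / 2) ^ (μ + 2 * (n : ℝ)) = (x / 2) ^ μ * (x / 2) ^ (2 * n) := by
    rw [Real.rpow_add hx2, ← Real.rpow_natCast (x / 2) (2 * n)]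
    push_cast
    rfl
  have h2 : μ + (n : ℝ) + 1 = n + 1 + μ := by ring
  rw [h1, Real.rpow_add hx2, besselCoeff, h2, div_pow, pow_mul 2 2 n]
  norm_num
  ring

/-- The function `(x/2)^(-ν) K_ν(x)` in terms of `besselE`. -/
def besselF (ν x : ℝ) : ℝ := Real.pi / (2 * Real.sin (Real.pi * ν)) *
  ((x / 2) ^ (-(2 * ν)) * besselE (-ν) x - besselE ν x)

theorem rpow_mul_besselK (ν : ℝ) {x : ℝ} (hx : 0 < x) :
    (x / 2) ^ (-ν) * besselK ν x = besselF ν x := by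
  have h1 := rpow_mul_besselI (-ν) hx (-ν)
  have h2 := rpow_mul_besselI ν hx (-ν)
  rw [neg_add_cancel, Real.rpow_zero, one_mul] at h2
  have h3 : -ν + -ν = -(2 * ν) := by ring
  rw [h3] at h1
  calc (x / 2) ^ (-ν) * besselK ν x = Real.pi / (2 * Real.sin (Real.pi * ν)) *
      ((x / 2) ^ (-ν) * besselI (-ν) x - (x / 2) ^ (-ν) * besselI ν x) := by
        rw [besselK]; ring
    _ = _ := by rw [h1, h2, besselF]

theorem summandK_eq (ν a : ℝ) {b : ℝ} (hb : 0 < b) {n : ℕ} (hn : 0 < n) :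
    summandK ν a b n = Real.exp (-a * n) * besselF ν (b * n) := by
  rw [summandK, mul_assoc, rpow_mul_besselK]
  positivity

theorem hasSum_of_eq {α ι : Type*} [AddCommMonoid α] [TopologicalSpace α] {f g : ι → α} {a b : α}
    (h : HasSum g b) (hf : ∀ i, f i = g i) (hab : a = b) : HasSum f a := by
  rw [hab, funext hf]
  exact h

theorem hasSum_real_exp (x : ℝ) : HasSum (fun n : ℕ => x ^ n / (n.factorial : ℝ)) (Real.exp x) := by
  rw [Real.exp_eq_exp_ℝ]
  exact NormedSpace.expSeries_div_hasSum_exp x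

/-! ### The incomplete gamma function and its power series. -/

/-- The incomplete gamma function `∫_1^∞ e^{-yt} t^(μ-1) dt`. -/
def incGamma (μ y : ℝ) : ℝ := ∫ t in Ioi (1 : ℝ), Real.exp (-(y * t)) * t ^ (μ - 1)

theorem integrableOn_exp_mul_rpow_Ioi_one (μ : ℝ) {y : ℝ} (hy : 0 < y) :
    IntegrableOn (fun t : ℝ => Real.exp (-(y * t)) * t ^ (μ - 1)) (Ioi 1) := by
  have h := integrableOn_rpow_mul_exp_neg_mul_rpow (p := 1) (s := max (μ - 1) 0) (b := y)
    (by have := le_max_right (μ - 1) 0; linarith) one_pos hy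
  have h' : IntegrableOn (fun t : ℝ => t ^ max (μ - 1) 0 * Real.exp (-y * t ^ (1 : ℝ))) (Ioi 1) :=
    h.mono_set (Ioi_subset_Ioi zero_le_one)
  refine Integrable.mono' h' ?_ ?_
  · refine (ContinuousOn.mul (by fun_prop) ?_).aestronglyMeasurable measurableSet_Ioi
    exact continuousOn_id.rpow_const fun t ht => Or.inl (zero_lt_one.trans ht).ne'
  · refine (ae_restrict_iff' measurableSet_Ioi).2 (Eventually.of_forall fun t ht => ?_)
    have ht1 : (1 : ℝ) < t := ht
    have ht0 : (0 : ℝ) < t := by linarith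
    rw [Real.norm_eq_abs, abs_of_nonneg (by positivity), Real.rpow_one, mul_comm, neg_mul]
    gcongr
    · exact ht1.le
    · exact le_max_left _ _

/-- Integration by parts, differentiating t^μ. -/
theorem incGamma_add_one (μ : ℝ) {y : ℝ} (hy : 0 < y) :
    y * incGamma (μ + 1) y = Real.exp (-y) + μ * incGamma μ y := by
  have h := integral_Ioi_mul_deriv_eq_deriv_mul (a := 1) (a' := -(Real.exp (-y))) (b' := 0)
    (u := fun t : ℝ => t ^ μ) (u' := fun t : ℝ => μ * t ^ (μ - 1))
    (v := fun t : ℝ => -Real.exp (-(y * t))) (v' := fun t : ℝ => y * Real.exp (-(y * t)))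
    (fun t ht => Real.hasDerivAt_rpow_const (Or.inl (zero_lt_one.trans ht).ne'))
    (fun t _ => by
      have h1 : HasDerivAt (fun t : ℝ => -(y * t)) (-y) t := by
        simpa using! ((hasDerivAt_id t).const_mul y).neg
      exact h1.exp.neg.congr_deriv (by ring))
    ?_ ?_ ?_ ?_
  · have e1 : ∫ t in Ioi (1 : ℝ), t ^ μ * (y * Real.exp (-(y * t))) = y * incGamma (μ + 1) y := by
      rw [incGamma, ← integral_const_mul]
      refine integral_congr_ae (Eventually.of_forall fun t => ?_)
      simp only [add_sub_cancel_right]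
      ring
    have e2 : ∫ t in Ioi (1 : ℝ), μ * t ^ (μ - 1) * -Real.exp (-(y * t)) = -(μ * incGamma μ y) := by
      rw [incGamma, ← integral_const_mul, ← integral_neg]
      refine integral_congr_ae (Eventually.of_forall fun t => ?_)
      simp only
      ring
    rw [e1, e2] at h
    linarith
  · refine ((integrableOn_exp_mul_rpow_Ioi_one (μ + 1) hy).const_mul y).congr
      (Eventually.of_forall fun t => ?_)
    simp only [add_sub_cancel_right, Pi.mul_apply]
    ring
  · refine ((integrableOn_exp_mul_rpow_Ioi_one μ hy).const_mul (-μ)).congr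
      (Eventually.of_forall fun t => ?_)
    simp only [Pi.mul_apply]
    ring
  · have : ContinuousAt (fun t : ℝ => t ^ μ * -Real.exp (-(y * t))) 1 := by
      refine ContinuousAt.mul (Real.continuousAt_rpow_const _ _ (Or.inl one_ne_zero)) ?_
      fun_prop
    have h2 := this.tendsto.mono_left (nhdsWithin_le_nhds (s := Ioi 1))
    rw [Real.one_rpow, mul_one, one_mul] at h2
    exact h2
  · have h3 := (tendsto_rpow_mul_exp_neg_mul_atTop_nhds_zero μ y hy).neg
    rw [neg_zero] at h3
    refine h3.congr fun t => ?_
    simp only [Pi.mul_apply, neg_mul]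
    ring

theorem integral_exp_mul_rpow_Ioc_zero_one {μ y : ℝ} (hμ : 0 < μ) (hy : 0 < y) :
    HasSum (fun i : ℕ => (-y) ^ i / ((i.factorial : ℝ) * (μ + i)))
      (∫ t in Ioc (0 : ℝ) 1, Real.exp (-(y * t)) * t ^ (μ - 1)) := by
  have hint : ∀ s : ℝ, 0 < s → ∫ t in Ioc (0 : ℝ) 1, t ^ (s - 1) = 1 / s := by
    intro s hs
    rw [← intervalIntegral.integral_of_le zero_le_one, integral_rpow (Or.inl (by linarith))]
    rw [sub_add_cancel, Real.one_rpow, Real.zero_rpow hs.ne', sub_zero]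
  have hI : IntegrableOn (fun t : ℝ => t ^ (μ - 1)) (Ioc 0 1) := by
    rw [← intervalIntegrable_iff_integrableOn_Ioc_of_le zero_le_one]
    exact intervalIntegral.intervalIntegrable_rpow' (by linarith)
  have hm : AEStronglyMeasurable (fun t : ℝ => t ^ (μ - 1)) (volume.restrict (Ioc 0 1)) := hI.1
  have h := hasSum_integral_of_dominated_convergence (μ := volume.restrict (Ioc (0 : ℝ) 1))
    (F := fun (i : ℕ) (t : ℝ) => (-y) ^ i / (i.factorial : ℝ) * (t ^ i * t ^ (μ - 1)))
    (f := fun t => Real.exp (-(y * t)) * t ^ (μ - 1))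
    (fun i t => y ^ i / (i.factorial : ℝ) * t ^ (μ - 1)) ?_ ?_ ?_ ?_ ?_
  · refine hasSum_of_eq h (fun i => ?_) rfl
    rw [integral_const_mul]
    have e : ∫ t in Ioc (0 : ℝ) 1, t ^ i * t ^ (μ - 1) = 1 / (μ + i) := by
      rw [← hint (μ + i) (by positivity)]
      refine setIntegral_congr_fun measurableSet_Ioc fun t ht => ?_
      rw [← Real.rpow_natCast, ← Real.rpow_add ht.1]
      ring_nf
    rw [e]
    field_simp
  · intro i
    exact ((by fun_prop : Continuous fun t : ℝ => t ^ i).aestronglyMeasurable.mul hm).const_mul _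
  · intro i
    refine (ae_restrict_iff' measurableSet_Ioc).2 (Eventually.of_forall fun t ht => ?_)
    have ht0 : 0 < t := ht.1
    rw [norm_mul, norm_mul, norm_div, norm_pow, norm_pow, norm_neg, Real.norm_of_nonneg hy.le,
      Real.norm_of_nonneg ht0.le, Real.norm_of_nonneg (Real.rpow_nonneg ht0.le _),
      Real.norm_of_nonneg (Nat.cast_nonneg _)]
    have h1 : t ^ i ≤ 1 := pow_le_one₀ ht0.le ht.2
    have h2 : 0 ≤ t ^ (μ - 1) := Real.rpow_nonneg ht0.le _
    gcongr
    nlinarith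
  · exact Eventually.of_forall fun t => (Real.summable_pow_div_factorial y).mul_right _
  · have e : (fun t : ℝ => ∑' i : ℕ, y ^ i / (i.factorial : ℝ) * t ^ (μ - 1)) =
        fun t => (∑' i : ℕ, y ^ i / (i.factorial : ℝ)) * t ^ (μ - 1) := by
      ext t
      rw [tsum_mul_right]
    rw [e]
    exact hI.const_mul _
  · refine Eventually.of_forall fun t => ?_
    have h1 := (hasSum_real_exp (-(y * t))).mul_right (t ^ (μ - 1))
    refine h1.congr_fun ?_
    intro i
    rw [← neg_mul, mul_pow]
    ring

theorem hasSum_incGamma_of_pos {μ y : ℝ} (hμ : 0 < μ) (hy : 0 < y) :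
    HasSum (fun i : ℕ => (-y) ^ i / ((i.factorial : ℝ) * (μ + i)))
      (y ^ (-μ) * Real.Gamma μ - incGamma μ y) := by
  have h := integral_exp_mul_rpow_Ioc_zero_one hμ hy
  have h1 := Real.integral_rpow_mul_exp_neg_mul_Ioi hμ hy
  have h2 : IntegrableOn (fun t : ℝ => Real.exp (-(y * t)) * t ^ (μ - 1)) (Ioi 0) := by
    have := integrableOn_rpow_mul_exp_neg_mul_rpow (p := 1) (s := μ - 1) (b := y) (by linarith)
      one_pos hy
    refine this.congr (Eventually.of_forall fun t => ?_)
    simp only [Real.rpow_one, neg_mul]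
    ring
  have h3 := setIntegral_union (Ioc_disjoint_Ioi_same (a := (0 : ℝ)) (b := 1)) measurableSet_Ioi
    (h2.mono_set Ioc_subset_Ioi_self) (h2.mono_set (Ioi_subset_Ioi zero_le_one))
  rw [Ioc_union_Ioi_eq_Ioi zero_le_one] at h3
  have h4 : ∫ t in Ioi (0 : ℝ), Real.exp (-(y * t)) * t ^ (μ - 1) = y ^ (-μ) * Real.Gamma μ := by
    rw [Real.rpow_neg hy.le, ← one_div, ← Real.one_rpow μ, ← Real.div_rpow zero_le_one hy.le,
      Real.one_rpow, ← h1]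
    refine integral_congr_ae (Eventually.of_forall fun t => ?_)
    simp only
    ring
  refine hasSum_of_eq h (fun _ => rfl) ?_
  rw [← h4, h3, incGamma]
  ring

/-- For μ > 0 the sum is the integral over (0,1], which is the complete gamma integral minus the
tail. For other μ the recurrences of Γ and of `incGamma` carry the formula from μ + 1 down to μ. -/
theorem hasSum_incGamma {μ y : ℝ} (hμ : ∀ n : ℕ, μ + n ≠ 0) (hy : 0 < y) :
    HasSum (fun i : ℕ => (-y) ^ i / ((i.factorial : ℝ) * (μ + i)))
      (y ^ (-μ) * Real.Gamma μ - incGamma μ y) := by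
  obtain ⟨k, hk⟩ := exists_nat_gt (-μ)
  induction k generalizing μ with
  | zero => exact hasSum_incGamma_of_pos (by simpa using hk) hy
  | succ k ih =>
    have h := ih (μ := μ + 1) (fun n => by have := hμ (n + 1); push_cast at this ⊢; grind)
      (by push_cast at hk; linarith)
    have hμ0 : μ ≠ 0 := by simpa using hμ 0
    have hrec := incGamma_add_one μ hy
    have hexp := hasSum_real_exp (-y)
    -- the shifted series
    have h1 : HasSum (fun i : ℕ => (i : ℝ) * (-y) ^ i / ((i.factorial : ℝ) * (μ + i)))
        (-y * (y ^ (-(μ + 1)) * Real.Gamma (μ + 1) - incGamma (μ + 1) y)) := by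
      rw [← hasSum_nat_add_iff' 1]
      simp only [Finset.sum_range_one, Nat.cast_zero, zero_mul, zero_div, sub_zero]
      refine (h.mul_left (-y)).congr_fun ?_
      intro i
      have := hμ (i + 1)
      rw [Nat.factorial_succ]
      push_cast at this ⊢
      have h' : μ + 1 + (i : ℝ) ≠ 0 := by grind
      field_simp
      ring
    -- Partial fractions: 1/(μ+i) = (1/μ)(1 - i/(μ+i)).
    have h2 := (hexp.sub h1).mul_left (1 / μ)
    refine hasSum_of_eq h2 (fun i => ?_) ?_
    · have := hμ i
      field_simp
      ring
    · rw [Real.Gamma_add_one hμ0]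
      have e : y ^ (-μ) = y * y ^ (-(μ + 1)) := by
        rw [← Real.rpow_one_add' hy.le (by simpa using hμ0)]
        congr 1
        ring
      rw [e]
      field_simp
      linarith

/-- On t > 1 the exponential series of e^{-c/t} is dominated by that of e^c, so it may be integrated
termwise. -/
theorem hasSum_integral_Ioi_one (μ : ℝ) {y c : ℝ} (hy : 0 < y) (hc : 0 ≤ c) :
    HasSum (fun j : ℕ => (-c) ^ j / (j.factorial : ℝ) * incGamma (μ - j) y)
      (∫ t in Ioi (1 : ℝ), Real.exp (-(y * t)) * t ^ (μ - 1) * Real.exp (-(c / t))) := by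
  have hI := integrableOn_exp_mul_rpow_Ioi_one μ hy
  have hm : ∀ s : ℝ, AEStronglyMeasurable (fun t : ℝ => Real.exp (-(y * t)) * t ^ (s - 1))
      (volume.restrict (Ioi 1)) := fun s => (integrableOn_exp_mul_rpow_Ioi_one s hy).1
  have h := hasSum_integral_of_dominated_convergence (μ := volume.restrict (Ioi (1 : ℝ)))
    (F := fun (j : ℕ) (t : ℝ) => (-c) ^ j / (j.factorial : ℝ) *
      (Real.exp (-(y * t)) * t ^ (μ - j - 1)))
    (f := fun t => Real.exp (-(y * t)) * t ^ (μ - 1) * Real.exp (-(c / t)))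
    (fun j t => c ^ j / (j.factorial : ℝ) * (Real.exp (-(y * t)) * t ^ (μ - 1))) ?_ ?_ ?_ ?_ ?_
  · exact hasSum_of_eq h (fun j => by rw [integral_const_mul, incGamma]) rfl
  · intro j
    exact (hm (μ - j)).const_mul _
  · intro j
    refine (ae_restrict_iff' measurableSet_Ioi).2 (Eventually.of_forall fun t ht => ?_)
    have ht1 : (1 : ℝ) < t := ht
    have ht0 : (0 : ℝ) < t := by linarith
    rw [norm_mul, norm_div, norm_pow, norm_neg, Real.norm_of_nonneg hc,
      Real.norm_of_nonneg (Nat.cast_nonneg _), Real.norm_of_nonneg (by positivity)]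
    gcongr
    · exact ht1.le
    · have : (0 : ℝ) ≤ j := Nat.cast_nonneg j
      linarith
  · exact Eventually.of_forall fun t => (Real.summable_pow_div_factorial c).mul_right _
  · have e : (fun t : ℝ => ∑' j : ℕ, c ^ j / (j.factorial : ℝ) *
        (Real.exp (-(y * t)) * t ^ (μ - 1))) =
        fun t => (∑' j : ℕ, c ^ j / (j.factorial : ℝ)) * (Real.exp (-(y * t)) * t ^ (μ - 1)) := by
      ext t
      rw [tsum_mul_right]
    rw [e]
    exact hI.const_mul _
  · refine (ae_restrict_iff' measurableSet_Ioi).2 (Eventually.of_forall fun t ht => ?_)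
    have ht0 : (0 : ℝ) < t := zero_lt_one.trans ht
    refine hasSum_of_eq ((hasSum_real_exp (-(c / t))).mul_left
      (Real.exp (-(y * t)) * t ^ (μ - 1))) (fun j => ?_) rfl
    have e : t ^ (μ - j - 1) = t ^ (μ - 1) / t ^ j := by
      rw [← Real.rpow_natCast, ← Real.rpow_sub ht0]
      ring_nf
    rw [e, ← neg_div, div_pow]
    field_simp

/-! ### The integral representation of `besselF`. -/

theorem integral_Ioc_zero_one_eq (h : ℝ → ℝ) :
    ∫ t in Ioc (0 : ℝ) 1, h t = ∫ t in Ioi (1 : ℝ), t ^ (-2 : ℝ) * h t⁻¹ := by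
  have h1 := integral_comp_rpow_Ioi (indicator (Ioo 0 1) h) (p := -1) (by norm_num)
  rw [integral_Ioc_eq_integral_Ioo]
  have h2 : ∫ y in Ioi (0 : ℝ), indicator (Ioo 0 1) h y = ∫ t in Ioo (0 : ℝ) 1, h t := by
    rw [setIntegral_indicator measurableSet_Ioo]
    congr 2
    ext t
    simp only [mem_inter_iff, mem_Ioi, mem_Ioo]
    tauto
  rw [← h2, ← h1]
  have h3 : ∀ x ∈ Ioi (0 : ℝ), (|(-1 : ℝ)| * x ^ ((-1 : ℝ) - 1)) • indicator (Ioo 0 1) h (x ^ (-1 : ℝ)) =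
      indicator (Ioi 1) (fun t => t ^ (-2 : ℝ) * h t⁻¹) x := by
    intro x hx
    have hx0 : (0 : ℝ) < x := hx
    have e1 : (-1 : ℝ) - 1 = -2 := by norm_num
    rw [Real.rpow_neg_one, abs_neg, abs_one, one_mul, e1, smul_eq_mul]
    by_cases hx1 : 1 < x
    · rw [indicator_of_mem (show x⁻¹ ∈ Ioo (0 : ℝ) 1 from ⟨inv_pos.2 hx0, inv_lt_one_of_one_lt₀ hx1⟩),
        indicator_of_mem (show x ∈ Ioi (1 : ℝ) from hx1)]
    · rw [indicator_of_notMem (s := Ioi (1 : ℝ)) hx1, indicator_of_notMem, mul_zero]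
      intro hm
      exact hx1 ((inv_lt_one₀ hx0).1 hm.2)
  rw [setIntegral_congr_fun measurableSet_Ioi h3, setIntegral_indicator measurableSet_Ioi]
  congr 2
  ext t
  simp only [mem_inter_iff, mem_Ioi]
  constructor
  · exact fun h => h.2
  · exact fun h => ⟨by linarith, h⟩

theorem exists_pos_le_abs_sub_int {ν : ℝ} (hν : ∀ j : ℤ, ν ≠ j) :
    ∃ δ : ℝ, 0 < δ ∧ ∀ j : ℤ, δ ≤ |ν - j| :=
  ⟨|ν - round ν|, abs_pos.2 (sub_ne_zero.2 (hν _)), fun j => round_le ν j⟩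

/-- The integrand of `∫_0^∞ e^{-yt-1/t} t^(ν-1) dt`. -/
def macdonaldIntegrand (ν y t : ℝ) : ℝ := Real.exp (-(y * t)) * t ^ (ν - 1) * Real.exp (-(1 / t))

theorem integrableOn_exp_mul_rpow_Ioi_zero {ν y : ℝ} (hν : 0 < ν) (hy : 0 < y) :
    IntegrableOn (fun t : ℝ => Real.exp (-(y * t)) * t ^ (ν - 1)) (Ioi 0) := by
  have := integrableOn_rpow_mul_exp_neg_mul_rpow (p := 1) (s := ν - 1) (b := y) (by linarith)
    one_pos hy
  refine this.congr (Eventually.of_forall fun t => ?_)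
  simp only [Real.rpow_one, neg_mul]
  ring

theorem measurable_macdonaldIntegrand (ν y : ℝ) : Measurable (macdonaldIntegrand ν y) := by
  unfold macdonaldIntegrand
  fun_prop

theorem integrableOn_macdonaldIntegrand {ν y : ℝ} (hν : 0 < ν) (hy : 0 < y) :
    IntegrableOn (macdonaldIntegrand ν y) (Ioi 0) := by
  refine Integrable.mono' (integrableOn_exp_mul_rpow_Ioi_zero hν hy)
    (measurable_macdonaldIntegrand ν y).aestronglyMeasurable ?_
  refine (ae_restrict_iff' measurableSet_Ioi).2 (Eventually.of_forall fun t ht => ?_)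
  have ht0 : (0 : ℝ) < t := ht
  rw [macdonaldIntegrand, Real.norm_of_nonneg (by positivity)]
  refine mul_le_of_le_one_right (by positivity) (Real.exp_le_one_iff.2 ?_)
  have : 0 < 1 / t := by positivity
  linarith

/-- Split the integral at t = 1 and invert t on (0,1]. Expanding the bounded exponential in each
half gives incomplete gamma functions, and replacing these by Γ minus their power series leaves one
double series `F` in both halves, with opposite signs and exchanged indices. Its sum is X, which
cancels in I₁ + I₂. The distance δ from ν to the integers bounds the denominators, so `F` is
absolutely summable. -/
theorem hasSum_macdonald {ν y : ℝ} (hν : 0 < ν) (hint : ∀ j : ℤ, ν ≠ j) (hy : 0 < y) :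
    ∃ X I₁ I₂ : ℝ,
      HasSum (fun n : ℕ => (-y) ^ n / (n.factorial : ℝ) * Real.Gamma (-ν - n)) (I₁ + X) ∧
      HasSum (fun n : ℕ => (-1) ^ n / (n.factorial : ℝ) * (y ^ (-(ν - n)) * Real.Gamma (ν - n)))
        (I₂ - X) ∧
      ∫ t in Ioi (0 : ℝ), macdonaldIntegrand ν y t = I₁ + I₂ := by
  obtain ⟨δ, hδ, hδle⟩ := exists_pos_le_abs_sub_int hint
  set F : ℕ × ℕ → ℝ := fun p =>
    (-y) ^ p.1 / (p.1.factorial : ℝ) * ((-1) ^ p.2 / ((p.2.factorial : ℝ) * (-ν - p.1 + p.2)))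
    with hF
  have hFs : Summable F := by
    have h1 := (Real.summable_pow_div_factorial y).mul_of_nonneg
      (Real.summable_pow_div_factorial 1) (fun n => by positivity) (fun n => by positivity)
    refine Summable.of_norm_bounded (h1.mul_left δ⁻¹) fun p => ?_
    have h2 : δ ≤ |-ν - (p.1 : ℝ) + p.2| := by
      have := hδle ((p.2 : ℤ) - p.1)
      rw [← abs_neg] at this
      convert this using 2
      push_cast
      ring
    rw [hF]
    simp only [norm_mul, norm_div, norm_pow, norm_neg, norm_one, one_pow, Real.norm_eq_abs,
      abs_of_pos hy, Nat.abs_cast]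
    have h3 : 1 / ((p.2.factorial : ℝ) * |-ν - (p.1 : ℝ) + p.2|) ≤
        δ⁻¹ * (1 / (p.2.factorial : ℝ)) := by
      rw [← one_div, one_div_mul_one_div, mul_comm δ]
      gcongr
    calc _ ≤ y ^ p.1 / (p.1.factorial : ℝ) * (δ⁻¹ * (1 / (p.2.factorial : ℝ))) := by gcongr
      _ = _ := by ring
  have hne1 : ∀ n m : ℕ, -ν - (n : ℝ) + m ≠ 0 := fun n m h => hint ((m : ℤ) - n) (by
    push_cast; linarith)
  have hne2 : ∀ n m : ℕ, ν - (n : ℝ) + m ≠ 0 := fun n m h => hint ((n : ℤ) - m) (by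
    push_cast; linarith)
  have hX1 : HasSum (fun n : ℕ => (-y) ^ n / (n.factorial : ℝ) *
      (Real.Gamma (-ν - n) - incGamma (-ν - n) 1)) (∑' p, F p) := by
    refine hFs.hasSum.prod_fiberwise fun n => ?_
    have h := (hasSum_incGamma (hne1 n) one_pos).mul_left ((-y) ^ n / (n.factorial : ℝ))
    rw [Real.one_rpow, one_mul] at h
    exact h
  have hX2 : HasSum (fun n : ℕ => -((-1) ^ n / (n.factorial : ℝ) *
      (y ^ (-(ν - n)) * Real.Gamma (ν - n) - incGamma (ν - n) y))) (∑' p, F p) := by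
    have h0 : HasSum (F ∘ Prod.swap) (∑' p, F p) :=
      (Equiv.prodComm ℕ ℕ).hasSum_iff.2 hFs.hasSum
    refine h0.prod_fiberwise fun n => ?_
    have h := ((hasSum_incGamma (hne2 n) hy).mul_left ((-1) ^ n / (n.factorial : ℝ))).neg
    refine hasSum_of_eq h (fun i => ?_) rfl
    have h1 := hne1 i n
    have h2 := hne2 n i
    simp only [Function.comp, Prod.swap, hF]
    have h3 : ν - (n : ℝ) + i = -(-ν - i + n) := by ring
    rw [h3]
    field_simp
  have hI1 := hasSum_integral_Ioi_one (-ν) one_pos hy.le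
  have hI2 := hasSum_integral_Ioi_one ν hy zero_le_one
  refine ⟨_, _, _, hasSum_of_eq (hI1.add hX1) (fun n => by ring) rfl,
    hasSum_of_eq (hI2.sub hX2) (fun n => by ring) rfl, ?_⟩
  have hint0 := integrableOn_macdonaldIntegrand hν hy
  have h3 := setIntegral_union (Ioc_disjoint_Ioi_same (a := (0 : ℝ)) (b := 1)) measurableSet_Ioi
    (hint0.mono_set Ioc_subset_Ioi_self) (hint0.mono_set (Ioi_subset_Ioi zero_le_one))
  rw [Ioc_union_Ioi_eq_Ioi zero_le_one, integral_Ioc_zero_one_eq] at h3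
  rw [h3]
  congr 1
  refine setIntegral_congr_fun measurableSet_Ioi fun t ht => ?_
  have ht0 : (0 : ℝ) < t := zero_lt_one.trans ht
  simp only [macdonaldIntegrand]
  rw [Real.inv_rpow ht0.le, ← Real.rpow_neg ht0.le, one_div, inv_inv, one_mul, div_eq_mul_inv]
  have e : t ^ (-ν - 1) = t ^ (-2 : ℝ) * t ^ (-(ν - 1)) := by
    rw [← Real.rpow_add ht0]
    ring_nf
  rw [e]
  ring

theorem sin_pi_mul_ne_zero {ν : ℝ} (hint : ∀ j : ℤ, ν ≠ j) : Real.sin (Real.pi * ν) ≠ 0 := by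
  rw [Real.sin_ne_zero_iff]
  intro n hn
  refine hint n (mul_left_cancel₀ Real.pi_ne_zero ?_)
  linarith

theorem Gamma_sub_nat {ν : ℝ} (hint : ∀ j : ℤ, ν ≠ j) (n : ℕ) :
    (-1) ^ n * Real.Gamma (ν - n) =
      Real.pi / Real.sin (Real.pi * ν) * (1 / Real.Gamma (n + 1 + -ν)) := by
  have h := Real.Gamma_mul_Gamma_one_sub (ν - n)
  have e1 : 1 - (ν - (n : ℝ)) = n + 1 + -ν := by ring
  have e2 : Real.sin (Real.pi * (ν - n)) = (-1) ^ n * Real.sin (Real.pi * ν) := by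
    rw [mul_sub, mul_comm Real.pi (n : ℝ), Real.sin_sub_nat_mul_pi]
  rw [e1, e2] at h
  have hG : Real.Gamma (n + 1 + -ν) ≠ 0 := Real.Gamma_ne_zero fun m hm => hint (n + 1 + m) (by
    push_cast; linarith)
  have hs := sin_pi_mul_ne_zero hint
  have h1 : ((-1 : ℝ) ^ n) ≠ 0 := by positivity
  rw [eq_div_iff (mul_ne_zero h1 hs)] at h
  rw [div_mul_div_comm, mul_one, eq_div_iff (mul_ne_zero hs hG)]
  exact (by ring : _ = Real.Gamma (ν - n) * Real.Gamma (n + 1 + -ν) *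
    ((-1) ^ n * Real.sin (Real.pi * ν))).trans h

/-- The reflection formula identifies the two gamma series of `hasSum_macdonald` with the I_ν and
I_{-ν} parts of `besselF`. -/
theorem besselF_eq_integral {ν x : ℝ} (hν : 0 < ν) (hint : ∀ j : ℤ, ν ≠ j) (hx : 0 < x) :
    besselF ν x = 1 / 2 * ∫ t in Ioi (0 : ℝ), macdonaldIntegrand ν (x ^ 2 / 4) t := by
  have hy : 0 < x ^ 2 / 4 := by positivity
  have hs := sin_pi_mul_ne_zero hint
  obtain ⟨X, I₁, I₂, h1, h2, h3⟩ := hasSum_macdonald hν hint hy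
  have h1' : I₁ + X = -(Real.pi / Real.sin (Real.pi * ν) * besselE ν x) := by
    rw [← h1.tsum_eq, besselE, ← tsum_mul_left, ← tsum_neg]
    refine tsum_congr fun n => ?_
    have hg := Gamma_sub_nat (ν := -ν) (fun j hj => hint (-j) (by push_cast; linarith)) n
    rw [mul_neg, Real.sin_neg, neg_neg] at hg
    rw [neg_pow, div_pow]
    calc _ = (x ^ 2) ^ n / 4 ^ n / (n.factorial : ℝ) * ((-1) ^ n * Real.Gamma (-ν - n)) := by ring
      _ = _ := by
        rw [hg, besselCoeff, pow_mul]
        field_simp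
  have h2' : I₂ - X = Real.pi / Real.sin (Real.pi * ν) * ((x / 2) ^ (-(2 * ν)) * besselE (-ν) x) := by
    rw [← h2.tsum_eq, besselE, ← tsum_mul_left, ← tsum_mul_left]
    refine tsum_congr fun n => ?_
    have hg := Gamma_sub_nat hint n
    have e : (x ^ 2 / 4) ^ (-(ν - n)) = (x / 2) ^ (-(2 * ν)) * (x ^ 2 / 4) ^ n := by
      rw [neg_sub, Real.rpow_sub hy, Real.rpow_natCast, Real.rpow_neg (by positivity),
        Real.rpow_mul (by positivity)]
      have : (x / 2) ^ (2 : ℝ) = x ^ 2 / 4 := by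
        rw [Real.rpow_two, div_pow]; norm_num
      rw [this]
      ring
    calc _ = (x / 2) ^ (-(2 * ν)) * (x ^ 2 / 4) ^ n / (n.factorial : ℝ) *
          ((-1) ^ n * Real.Gamma (ν - n)) := by rw [e]; ring
      _ = _ := by
        rw [hg, besselCoeff, pow_mul, div_pow]
        field_simp
  have h4 : I₁ + I₂ = (I₁ + X) + (I₂ - X) := by ring
  rw [h3, h4, h1', h2', besselF]
  field_simp
  ring

/-! ### Positivity, decay and Mellin transform of `besselF`. -/

theorem besselF_nonneg {ν x : ℝ} (hν : 0 < ν) (hint : ∀ j : ℤ, ν ≠ j) (hx : 0 < x) :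
    0 ≤ besselF ν x := by
  rw [besselF_eq_integral hν hint hx]
  refine mul_nonneg (by norm_num) (setIntegral_nonneg measurableSet_Ioi fun t ht => ?_)
  have ht0 : (0 : ℝ) < t := ht
  unfold macdonaldIntegrand
  positivity

/-- Completing the square gives x²t/4 + 1/t ≥ x. The fraction 1 - ε of this inequality yields the
decay in x, and the remaining εx²t/4 keeps the t-integral a gamma integral. -/
theorem besselF_le {ν x ε : ℝ} (hν : 0 < ν) (hint : ∀ j : ℤ, ν ≠ j) (hx : 0 < x) (hε : 0 < ε)
    (hε1 : ε < 1) :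
    besselF ν x ≤ (1 / 2 * (ε / 4) ^ (-ν) * Real.Gamma ν) * x ^ (-(2 * ν)) *
      Real.exp (-((1 - ε) * x)) := by
  have hy : 0 < ε * x ^ 2 / 4 := by positivity
  have h1 := Real.integral_rpow_mul_exp_neg_mul_Ioi hν hy
  have h2 : ∫ t in Ioi (0 : ℝ), macdonaldIntegrand ν (x ^ 2 / 4) t ≤
      ∫ t in Ioi (0 : ℝ), Real.exp (-((1 - ε) * x)) *
        (Real.exp (-(ε * x ^ 2 / 4 * t)) * t ^ (ν - 1)) := by
    refine setIntegral_mono_on (integrableOn_macdonaldIntegrand hν (by positivity))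
      ((integrableOn_exp_mul_rpow_Ioi_zero hν hy).const_mul _) measurableSet_Ioi fun t ht => ?_
    have ht0 : (0 : ℝ) < t := ht
    have key : x ≤ x ^ 2 / 4 * t + 1 / t := by
      have : x ^ 2 / 4 * t + 1 / t - x = (x * t / 2 - 1) ^ 2 / t := by
        field_simp
        ring
      have h' : 0 ≤ (x * t / 2 - 1) ^ 2 / t := by positivity
      linarith
    have key2 : 0 < 1 / t := by positivity
    rw [macdonaldIntegrand]
    have : Real.exp (-(x ^ 2 / 4 * t)) * Real.exp (-(1 / t)) ≤
        Real.exp (-((1 - ε) * x)) * Real.exp (-(ε * x ^ 2 / 4 * t)) := by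
      rw [← Real.exp_add, ← Real.exp_add, Real.exp_le_exp]
      nlinarith
    calc _ = Real.exp (-(x ^ 2 / 4 * t)) * Real.exp (-(1 / t)) * t ^ (ν - 1) := by ring
      _ ≤ Real.exp (-((1 - ε) * x)) * Real.exp (-(ε * x ^ 2 / 4 * t)) * t ^ (ν - 1) := by gcongr
      _ = _ := by ring
  rw [besselF_eq_integral hν hint hx]
  rw [integral_const_mul] at h2
  have h3 : ∫ t in Ioi (0 : ℝ), Real.exp (-(ε * x ^ 2 / 4 * t)) * t ^ (ν - 1) =
      (ε / 4) ^ (-ν) * x ^ (-(2 * ν)) * Real.Gamma ν := by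
    have e : (1 / (ε * x ^ 2 / 4)) ^ ν = (ε / 4) ^ (-ν) * x ^ (-(2 * ν)) := by
      rw [one_div, Real.inv_rpow hy.le, ← Real.rpow_neg hy.le, mul_div_right_comm,
        Real.mul_rpow (by positivity) (by positivity), ← Real.rpow_two, ← Real.rpow_mul hx.le]
      ring_nf
    rw [← e, ← h1]
    refine integral_congr_ae (Eventually.of_forall fun t => ?_)
    simp only
    ring
  rw [h3] at h2
  calc _ ≤ 1 / 2 * (Real.exp (-((1 - ε) * x)) *
      ((ε / 4) ^ (-ν) * x ^ (-(2 * ν)) * Real.Gamma ν)) := by gcongr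
    _ = _ := by ring

theorem continuous_besselE {μ : ℝ} (hμ : ∀ n : ℕ, (n : ℝ) + 1 + μ ≠ 0) :
    Continuous (besselE μ) := by
  obtain ⟨C, -, h⟩ := exists_summable_abs_besselCoeff_le hμ one_lt_two
  refine continuous_iff_continuousAt.2 fun x => ?_
  have hR : (0 : ℝ) ≤ |x| + 1 := by positivity
  have h1 : ContinuousOn (besselE μ) (Icc (-(|x| + 1)) (|x| + 1)) := by
    refine continuousOn_tsum (fun n => by fun_prop) (h _ hR).1 fun n y hy => ?_
    rw [norm_mul, norm_pow, Real.norm_eq_abs, Real.norm_eq_abs]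
    gcongr
    exact abs_le.2 hy
  refine h1.continuousAt (Icc_mem_nhds ?_ ?_)
  · have := neg_abs_le x; linarith
  · have := le_abs_self x; linarith

theorem add_neg_ne_zero {ν : ℝ} (hint : ∀ j : ℤ, ν ≠ j) (n : ℕ) : (n : ℝ) + 1 + -ν ≠ 0 :=
  fun h => hint (n + 1) (by push_cast; linarith)

theorem add_ne_zero_of_int {ν : ℝ} (hint : ∀ j : ℤ, ν ≠ j) (n : ℕ) : (n : ℝ) + 1 + ν ≠ 0 :=
  fun h => hint (-(n + 1)) (by push_cast; linarith)

theorem integral_rpow_mul_exp_neg_inv {c : ℝ} (hc : 0 < c) :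
    IntegrableOn (fun t : ℝ => t ^ (-c - 1) * Real.exp (-(1 / t))) (Ioi 0) ∧
    ∫ t in Ioi (0 : ℝ), t ^ (-c - 1) * Real.exp (-(1 / t)) = Real.Gamma c := by
  have hg : IntegrableOn (fun u : ℝ => Real.exp (-u) * u ^ (c - 1)) (Ioi 0) :=
    Real.GammaIntegral_convergent hc
  have h1 := (integrableOn_Ioi_comp_rpow_iff (fun u : ℝ => Real.exp (-u) * u ^ (c - 1))
    (p := -1) (by norm_num)).2 hg
  have h2 := integral_comp_rpow_Ioi (fun u : ℝ => Real.exp (-u) * u ^ (c - 1))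
    (p := -1) (by norm_num)
  have h3 : ∀ x ∈ Ioi (0 : ℝ), (|(-1 : ℝ)| * x ^ ((-1 : ℝ) - 1)) •
      (Real.exp (-(x ^ (-1 : ℝ))) * (x ^ (-1 : ℝ)) ^ (c - 1)) =
      x ^ (-c - 1) * Real.exp (-(1 / x)) := by
    intro x hx
    have hx0 : (0 : ℝ) < x := hx
    have e : x ^ (-c - 1) = x ^ ((-1 : ℝ) - 1) * (x ^ (-1 : ℝ)) ^ (c - 1) := by
      rw [← Real.rpow_mul hx0.le, ← Real.rpow_add hx0]
      ring_nf
    rw [e, Real.rpow_neg_one, abs_neg, abs_one, one_mul, smul_eq_mul, one_div]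
    ring
  constructor
  · exact h1.congr_fun h3 measurableSet_Ioi
  · rw [← setIntegral_congr_fun measurableSet_Ioi h3, h2, Real.Gamma_eq_integral hc]

/-- Insert the integral representation and integrate over x first, which is Gaussian; the integral
over t is then a gamma integral. The integrand is nonnegative, so the order can be exchanged. -/
theorem integral_rpow_mul_besselF {ν s : ℝ} (hν : 0 < ν) (hint : ∀ j : ℤ, ν ≠ j)
    (hs : 2 * ν - 1 < s) :
    ∫ x in Ioi (0 : ℝ), x ^ s * besselF ν x =
      2 ^ (s - 1) * Real.Gamma ((s + 1) / 2) * Real.Gamma ((s + 1) / 2 - ν) := by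
  have hc : 0 < (s + 1) / 2 - ν := by linarith
  obtain ⟨hI, hv⟩ := integral_rpow_mul_exp_neg_inv hc
  set F : ℝ × ℝ → ℝ := fun p => p.1 ^ s * macdonaldIntegrand ν (p.1 ^ 2 / 4) p.2 with hF
  have hFm : Measurable F := by
    rw [hF]
    unfold macdonaldIntegrand
    fun_prop
  have hg : ∀ t ∈ Ioi (0 : ℝ), IntegrableOn (fun x => F (x, t)) (Ioi 0) ∧
      ∫ x in Ioi (0 : ℝ), F (x, t) = (2 ^ s * Real.Gamma ((s + 1) / 2)) *
        (t ^ (-((s + 1) / 2 - ν) - 1) * Real.exp (-(1 / t))) := by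
    intro t ht
    have ht0 : (0 : ℝ) < t := ht
    have e : ∀ x ∈ Ioi (0 : ℝ), x ^ s * Real.exp (-(t / 4) * x ^ (2 : ℝ)) *
        (t ^ (ν - 1) * Real.exp (-(1 / t))) = F (x, t) := by
      intro x hx
      have e2 : x ^ 2 / 4 * t = t / 4 * x ^ (2 : ℝ) := by rw [Real.rpow_two]; ring
      rw [hF]
      simp only [macdonaldIntegrand, e2, neg_mul]
      ring
    constructor
    · have h0 : IntegrableOn (fun x : ℝ => x ^ s * Real.exp (-(t / 4) * x ^ (2 : ℝ)) *
          (t ^ (ν - 1) * Real.exp (-(1 / t)))) (Ioi 0) :=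
        (integrableOn_rpow_mul_exp_neg_mul_rpow (by linarith) two_pos
          (by positivity : 0 < t / 4)).mul_const (t ^ (ν - 1) * Real.exp (-(1 / t)))
      exact h0.congr_fun e measurableSet_Ioi
    · rw [← setIntegral_congr_fun measurableSet_Ioi e, integral_mul_const,
        integral_rpow_mul_exp_neg_mul_rpow two_pos (by linarith) (by positivity)]
      have e1 : (t / 4) ^ (-(s + 1) / 2) = 2 ^ (s + 1) * t ^ (-((s + 1) / 2)) := by
        rw [Real.div_rpow ht0.le (by norm_num), neg_div, Real.rpow_neg (by norm_num : (0:ℝ) ≤ 4),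
          div_inv_eq_mul, mul_comm]
        congr 1
        have : (4 : ℝ) = 2 ^ (2 : ℝ) := by norm_num
        rw [this, ← Real.rpow_mul (by norm_num)]
        congr 1
        ring
      have e3 : t ^ (-((s + 1) / 2 - ν) - 1) = t ^ (-((s + 1) / 2)) * t ^ (ν - 1) := by
        rw [← Real.rpow_add ht0]
        ring_nf
      rw [e1, e3, Real.rpow_add_one (by norm_num)]
      ring
  have hnn : ∀ t ∈ Ioi (0 : ℝ), ∀ x ∈ Ioi (0 : ℝ), 0 ≤ F (x, t) := by
    intro t ht x hx
    have ht0 : (0 : ℝ) < t := ht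
    have hx0 : (0 : ℝ) < x := hx
    rw [hF]
    simp only [macdonaldIntegrand]
    positivity
  have hint2 : Integrable F ((volume.restrict (Ioi 0)).prod (volume.restrict (Ioi 0))) := by
    rw [integrable_prod_iff' hFm.aestronglyMeasurable]
    constructor
    · exact (ae_restrict_iff' measurableSet_Ioi).2 (Eventually.of_forall fun t ht => (hg t ht).1)
    · have h1 : IntegrableOn (fun t : ℝ => (2 ^ s * Real.Gamma ((s + 1) / 2)) *
        (t ^ (-((s + 1) / 2 - ν) - 1) * Real.exp (-(1 / t)))) (Ioi 0) := hI.const_mul _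
      refine h1.congr_fun (fun t ht => ?_) measurableSet_Ioi
      simp only
      rw [← (hg t ht).2]
      refine setIntegral_congr_fun measurableSet_Ioi fun x hx => ?_
      rw [Real.norm_of_nonneg (hnn t ht x hx)]
  have hsw := integral_integral_swap (f := fun x t => F (x, t)) hint2
  have h1 : ∫ x in Ioi (0 : ℝ), x ^ s * besselF ν x =
      1 / 2 * ∫ x in Ioi (0 : ℝ), ∫ t in Ioi (0 : ℝ), F (x, t) := by
    rw [← integral_const_mul]
    refine setIntegral_congr_fun measurableSet_Ioi fun x hx => ?_
    simp only [hF]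
    rw [besselF_eq_integral hν hint hx, integral_const_mul]
    ring
  rw [h1, hsw, setIntegral_congr_fun measurableSet_Ioi fun t ht => (hg t ht).2,
    integral_const_mul, hv, Real.rpow_sub_one (by norm_num)]
  ring

/-! ### The Laplace transform of the kernel and its continuation. -/

/-- The kernel `x ^ s (bx/2)^(-ν) K_ν(bx)`, continuous up to `x = 0` when `2ν < s`. -/
def besselKernel (ν b s x : ℝ) : ℝ := Real.pi / (2 * Real.sin (Real.pi * ν)) *
  ((b / 2) ^ (-(2 * ν)) * (x ^ (s - 2 * ν) * besselE (-ν) (b * x)) - x ^ s * besselE ν (b * x))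

theorem besselKernel_eq {ν b x : ℝ} (s : ℝ) (hb : 0 < b) (hx : 0 < x) :
    besselKernel ν b s x = x ^ s * besselF ν (b * x) := by
  have e : (b * x / 2) ^ (-(2 * ν)) = (b / 2) ^ (-(2 * ν)) * x ^ (-(2 * ν)) := by
    rw [mul_div_right_comm, Real.mul_rpow (by positivity) hx.le]
  have e2 : x ^ (s - 2 * ν) = x ^ s * x ^ (-(2 * ν)) := by
    rw [← Real.rpow_add hx, sub_eq_add_neg]
  rw [besselKernel, besselF, e, e2]
  ring

theorem continuous_besselKernel {ν b s : ℝ} (hν : 0 < ν) (hint : ∀ j : ℤ, ν ≠ j)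
    (hs : 2 * ν < s) : Continuous (besselKernel ν b s) := by
  have h1 := continuous_besselE (add_neg_ne_zero hint)
  have h2 := continuous_besselE (add_ne_zero_of_int hint)
  have h3 : Continuous fun x : ℝ => x ^ (s - 2 * ν) := Real.continuous_rpow_const (by linarith)
  have h4 : Continuous fun x : ℝ => x ^ s := Real.continuous_rpow_const (by linarith)
  unfold besselKernel
  fun_prop

theorem besselKernel_zero {ν b s : ℝ} (hν : 0 < ν) (hs : 2 * ν < s) :
    besselKernel ν b s 0 = 0 := by
  rw [besselKernel, Real.zero_rpow (by linarith), Real.zero_rpow (by linarith)]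
  ring

theorem exists_abs_besselKernel_le {ν b : ℝ} (hν : 0 < ν) (hint : ∀ j : ℤ, ν ≠ j) (hb : 0 < b) :
    ∃ C : ℝ, 0 < C ∧ ∀ s x : ℝ, 0 < x →
      |besselKernel ν b s x| ≤ C * (x ^ (s - 2 * ν) * Real.exp (-(3 / 4 * b * x))) := by
  have hG := Real.Gamma_pos_of_pos hν
  refine ⟨1 / 2 * ((1 / 4) / 4) ^ (-ν) * Real.Gamma ν * b ^ (-(2 * ν)), by positivity,
    fun s x hx => ?_⟩
  rw [besselKernel_eq s hb hx, abs_of_nonneg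
    (mul_nonneg (by positivity) (besselF_nonneg hν hint (by positivity)))]
  have h := besselF_le hν hint (mul_pos hb hx) (ε := 1 / 4) (by norm_num) (by norm_num)
  calc _ ≤ x ^ s * (1 / 2 * (1 / 4 / 4) ^ (-ν) * Real.Gamma ν * (b * x) ^ (-(2 * ν)) *
        Real.exp (-((1 - 1 / 4) * (b * x)))) := by gcongr
    _ = _ := by
      rw [Real.mul_rpow hb.le hx.le]
      have e2 : x ^ (s - 2 * ν) = x ^ s * x ^ (-(2 * ν)) := by
        rw [← Real.rpow_add hx, sub_eq_add_neg]
      have e3 : -((1 - 1 / 4) * (b * x)) = -(3 / 4 * b * x) := by ring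
      rw [e2, e3]
      ring

/-- The Laplace transform of `besselKernel`. -/
def laplaceKernel (ν b s : ℝ) (w : ℂ) : ℂ :=
  ∫ x in Ioi (0 : ℝ), (besselKernel ν b s x : ℂ) * Complex.exp (-(w * x))

/-- The termwise Laplace transform of `x ^ (σ - 1) * besselE μ (b * x)`. -/
def laplaceSeries (μ σ b : ℝ) (w : ℂ) : ℂ :=
  ∑' n : ℕ, ((besselCoeff μ n * b ^ (2 * n) * Real.Gamma (σ + 2 * n) : ℝ) : ℂ) *
    w ^ ((-(σ + 2 * n) : ℝ) : ℂ)

theorem norm_laplaceSeries_term (μ : ℝ) {σ b r : ℝ} (hσ : 0 < σ) (hb : 0 < b) (hr : 0 < r) {w : ℂ}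
    (hw : r ≤ ‖w‖) (n : ℕ) :
    ‖((besselCoeff μ n * b ^ (2 * n) * Real.Gamma (σ + 2 * n) : ℝ) : ℂ) *
      w ^ ((-(σ + 2 * n) : ℝ) : ℂ)‖ ≤
      ‖w‖ ^ (-σ) * (|besselCoeff μ n| * Real.Gamma (σ + 2 * n) * (b / r) ^ (2 * n)) := by
  have hw0 : 0 < ‖w‖ := hr.trans_le hw
  have hG : 0 < Real.Gamma (σ + 2 * n) := Real.Gamma_pos_of_pos (by positivity)
  rw [norm_mul, Complex.norm_real, Complex.norm_cpow_real, Real.norm_eq_abs, abs_mul, abs_mul,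
    abs_of_pos hG, abs_of_pos (pow_pos hb _), neg_add, Real.rpow_add hw0, div_pow]
  have e : ‖w‖ ^ (-(2 * (n : ℝ))) = (‖w‖ ^ (2 * n))⁻¹ := by
    rw [Real.rpow_neg hw0.le, ← Real.rpow_natCast]
    push_cast
    rfl
  rw [e]
  have h2 : (‖w‖ ^ (2 * n))⁻¹ ≤ (r ^ (2 * n))⁻¹ := by gcongr
  calc _ = ‖w‖ ^ (-σ) * (|besselCoeff μ n| * Real.Gamma (σ + 2 * n) * b ^ (2 * n)) *
        (‖w‖ ^ (2 * n))⁻¹ := by ring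
    _ ≤ ‖w‖ ^ (-σ) * (|besselCoeff μ n| * Real.Gamma (σ + 2 * n) * b ^ (2 * n)) *
        (r ^ (2 * n))⁻¹ := by gcongr
    _ = _ := by ring

theorem summable_laplaceSeries {μ σ b : ℝ} (hμ : ∀ n : ℕ, (n : ℝ) + 1 + μ ≠ 0) (hσ : 0 < σ)
    (hb : 0 < b) {w : ℂ} (hw : b < ‖w‖) :
    Summable fun n : ℕ => ((besselCoeff μ n * b ^ (2 * n) * Real.Gamma (σ + 2 * n) : ℝ) : ℂ) *
      w ^ ((-(σ + 2 * n) : ℝ) : ℂ) := by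
  have hw0 : 0 < ‖w‖ := hb.trans hw
  exact Summable.of_norm_bounded ((summable_besselCoeff_mul_Gamma hμ hσ (r := b / ‖w‖)
    (by positivity) ((div_lt_one hw0).2 hw)).mul_left _)
    fun n => norm_laplaceSeries_term μ hσ hb hw0 le_rfl n

theorem differentiableOn_laplaceSeries {μ σ b : ℝ} (hμ : ∀ n : ℕ, (n : ℝ) + 1 + μ ≠ 0) (hσ : 0 < σ)
    (hb : 0 < b) :
    DifferentiableOn ℂ (laplaceSeries μ σ b) {w : ℂ | b < ‖w‖ ∧ w ∈ Complex.slitPlane} := by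
  intro w hw
  obtain ⟨r, hr1, hr2⟩ := exists_between hw.1
  have hr0 : 0 < r := hb.trans hr1
  set U : Set ℂ := {w : ℂ | r < ‖w‖ ∧ w ∈ Complex.slitPlane} with hU
  have hUo : IsOpen U := (isOpen_lt continuous_const continuous_norm).inter
    Complex.isOpen_slitPlane
  have hd : DifferentiableOn ℂ (laplaceSeries μ σ b) U := by
    refine Complex.differentiableOn_tsum_of_summable_norm
      (u := fun n => r ^ (-σ) * (|besselCoeff μ n| * Real.Gamma (σ + 2 * n) * (b / r) ^ (2 * n)))
      ((summable_besselCoeff_mul_Gamma hμ hσ (by positivity) ((div_lt_one hr0).2 hr1)).mul_left _)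
      (fun n => ?_) hUo fun n z hz => ?_
    · exact (differentiableOn_id.cpow_const fun z hz => hz.2).const_mul _
    · refine (norm_laplaceSeries_term μ hσ hb hr0 hz.1.le n).trans ?_
      have hG : 0 < Real.Gamma (σ + 2 * n) := Real.Gamma_pos_of_pos (by positivity)
      have h3 : ‖z‖ ^ (-σ) ≤ r ^ (-σ) :=
        Real.rpow_le_rpow_of_nonpos hr0 hz.1.le (by linarith)
      gcongr
  exact (hd.differentiableAt (hUo.mem_nhds ⟨hr2, hw.2⟩)).differentiableWithinAt

/-- The closed form of the Laplace transform of `besselKernel`. -/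
def laplaceClosed (ν b s : ℝ) (w : ℂ) : ℂ :=
  ((Real.pi / (2 * Real.sin (Real.pi * ν)) : ℝ) : ℂ) *
    ((((b / 2) ^ (-(2 * ν)) : ℝ) : ℂ) * laplaceSeries (-ν) (s + 1 - 2 * ν) b w -
      laplaceSeries ν (s + 1) b w)

theorem laplace_term {σ w : ℝ} (hσ : 0 < σ) (hw : 0 < w) (n : ℕ) :
    IntegrableOn (fun x : ℝ => x ^ (σ - 1) * x ^ (2 * n) * Real.exp (-(w * x))) (Ioi 0) ∧
    ∫ x in Ioi (0 : ℝ), x ^ (σ - 1) * x ^ (2 * n) * Real.exp (-(w * x)) =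
      Real.Gamma (σ + 2 * n) * w ^ (-(σ + 2 * n)) := by
  have hσn : 0 < σ + 2 * n := by positivity
  have e : ∀ x ∈ Ioi (0 : ℝ), Real.exp (-(w * x)) * x ^ (σ + 2 * n - 1) =
      x ^ (σ - 1) * x ^ (2 * n) * Real.exp (-(w * x)) := by
    intro x hx
    rw [← Real.rpow_natCast, ← Real.rpow_add hx]
    push_cast
    ring_nf
  constructor
  · exact (integrableOn_exp_mul_rpow_Ioi_zero hσn hw).congr_fun e measurableSet_Ioi
  · have e2 : w ^ (-(σ + 2 * n)) = (1 / w) ^ (σ + 2 * n) := by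
      rw [Real.rpow_neg hw.le, one_div, Real.inv_rpow hw.le]
    rw [← setIntegral_congr_fun measurableSet_Ioi e, e2, mul_comm (Real.Gamma _),
      ← Real.integral_rpow_mul_exp_neg_mul_Ioi hσn hw]
    exact integral_congr_ae (Eventually.of_forall fun t => mul_comm _ _)

/-- Termwise integration. For real w > b the integrals of the absolute values of the terms are
summable, by the unit radius of convergence at b/w. -/
theorem laplaceKernel_ofReal {ν b s w : ℝ} (hν : 0 < ν) (hint : ∀ j : ℤ, ν ≠ j) (hb : 0 < b)
    (hs : 2 * ν < s) (hw : b < w) :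
    laplaceKernel ν b s (w : ℂ) = laplaceClosed ν b s (w : ℂ) := by
  have hw0 : 0 < w := hb.trans hw
  have hμ1 := add_neg_ne_zero hint
  have hμ2 := add_ne_zero_of_int hint
  set κ := Real.pi / (2 * Real.sin (Real.pi * ν)) with hκ
  set β := (b / 2) ^ (-(2 * ν)) with hβ
  set T : ℝ → ℕ → ℝ → ℝ := fun σ n x => x ^ (σ - 1) * x ^ (2 * n) * Real.exp (-(w * x)) with hT
  set c : ℝ → ℕ → ℝ := fun μ n => besselCoeff μ n * b ^ (2 * n) with hc
  have hσ1 : 0 < s + 1 - 2 * ν := by linarith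
  have hσ2 : 0 < s + 1 := by linarith
  have hTn : ∀ σ n, ∀ x ∈ Ioi (0 : ℝ), 0 ≤ T σ n x := by
    intro σ n x hx
    have hx0 : (0 : ℝ) < x := hx
    simp only [hT]
    positivity
  set F : ℕ → ℝ → ℝ := fun n x =>
    κ * (β * (c (-ν) n * T (s + 1 - 2 * ν) n x) - c ν n * T (s + 1) n x) with hF
  have hFi : ∀ n, IntegrableOn (F n) (Ioi 0) := fun n =>
    ((((laplace_term hσ1 hw0 n).1.const_mul _).const_mul _).sub
      ((laplace_term hσ2 hw0 n).1.const_mul _)).const_mul _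
  have hsum : ∀ μ σ : ℝ, (∀ n : ℕ, (n : ℝ) + 1 + μ ≠ 0) → 0 < σ →
      Summable fun n : ℕ => |c μ n| * ∫ x in Ioi (0 : ℝ), T σ n x := by
    intro μ σ hμ hσ
    refine ((summable_besselCoeff_mul_Gamma hμ hσ (r := b / w) (by positivity)
      ((div_lt_one hw0).2 hw)).mul_left (w ^ (-σ))).congr fun n => ?_
    rw [(laplace_term hσ hw0 n).2, hc]
    simp only
    have e : w ^ (-(2 * (n : ℝ))) = (w ^ (2 * n))⁻¹ := by
      rw [Real.rpow_neg hw0.le, ← Real.rpow_natCast]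
      push_cast
      rfl
    rw [abs_mul, abs_of_pos (pow_pos hb _), neg_add, Real.rpow_add hw0, e, div_pow]
    ring
  have hnorm : Summable fun n => ∫ x in Ioi (0 : ℝ), ‖F n x‖ := by
    have h1 := (((hsum (-ν) _ hμ1 hσ1).mul_left |β|).add (hsum ν _ hμ2 hσ2)).mul_left |κ|
    refine Summable.of_nonneg_of_le (fun n => integral_nonneg fun x => norm_nonneg _)
      (fun n => ?_) h1
    rw [← integral_const_mul, ← integral_const_mul, ← integral_const_mul,
      ← integral_add (((laplace_term hσ1 hw0 n).1.const_mul _).const_mul _)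
      ((laplace_term hσ2 hw0 n).1.const_mul _), ← integral_const_mul]
    refine setIntegral_mono_on (hFi n).norm
      (((((laplace_term hσ1 hw0 n).1.const_mul _).const_mul _).add
      ((laplace_term hσ2 hw0 n).1.const_mul _)).const_mul _) measurableSet_Ioi fun x hx => ?_
    show ‖κ * (β * (c (-ν) n * T (s + 1 - 2 * ν) n x) - c ν n * T (s + 1) n x)‖ ≤
      |κ| * (|β| * (|c (-ν) n| * T (s + 1 - 2 * ν) n x) + |c ν n| * T (s + 1) n x)
    rw [norm_mul, Real.norm_eq_abs, Real.norm_eq_abs]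
    refine mul_le_mul_of_nonneg_left ((abs_sub _ _).trans ?_) (abs_nonneg _)
    rw [abs_mul, abs_mul, abs_mul (c ν n), abs_of_nonneg (hTn (s + 1 - 2 * ν) n x hx),
      abs_of_nonneg (hTn (s + 1) n x hx)]
  have hS := hasSum_integral_of_summable_integral_norm hFi hnorm
  have hlhs : ∫ x in Ioi (0 : ℝ), ∑' n, F n x =
      ∫ x in Ioi (0 : ℝ), besselKernel ν b s x * Real.exp (-(w * x)) := by
    refine setIntegral_congr_fun measurableSet_Ioi fun x hx => ?_
    have hs1 := summable_besselE hμ1 (b * x)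
    have hs2 := summable_besselE hμ2 (b * x)
    have h1 := ((hs1.hasSum.mul_left (β * (x ^ (s - 2 * ν) * Real.exp (-(w * x))))).sub
      (hs2.hasSum.mul_left (x ^ s * Real.exp (-(w * x))))).mul_left κ
    have h2 : HasSum (fun n => F n x) _ := hasSum_of_eq h1 (fun n => by
      have e1 : s + 1 - 2 * ν - 1 = s - 2 * ν := by ring
      have e2 : s + 1 - 1 = s := by ring
      simp only [hF, hT, hc, e1, e2, mul_pow]
      ring) rfl
    rw [h2.tsum_eq, besselKernel, besselE, besselE]
    ring
  rw [hlhs] at hS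
  have hC := Complex.hasSum_ofReal.2 hS
  have hL : laplaceKernel ν b s (w : ℂ) =
      ((∫ x in Ioi (0 : ℝ), besselKernel ν b s x * Real.exp (-(w * x)) : ℝ) : ℂ) := by
    rw [laplaceKernel, ← integral_complex_ofReal]
    refine integral_congr_ae (Eventually.of_forall fun x => ?_)
    push_cast
    rfl
  have hwn : b < ‖(w : ℂ)‖ := by rwa [Complex.norm_real, Real.norm_of_nonneg hw0.le]
  have hR := ((((summable_laplaceSeries hμ1 hσ1 hb hwn).hasSum.mul_left (β : ℂ)).sub
    (summable_laplaceSeries hμ2 hσ2 hb hwn).hasSum).mul_left (κ : ℂ))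
  rw [hL, ← hC.tsum_eq, laplaceClosed, laplaceSeries, laplaceSeries, ← hR.tsum_eq]
  refine tsum_congr fun n => ?_
  have e : ∫ x in Ioi (0 : ℝ), F n x = κ * (β * (c (-ν) n *
      (Real.Gamma (s + 1 - 2 * ν + 2 * n) * w ^ (-(s + 1 - 2 * ν + 2 * n)))) -
      c ν n * (Real.Gamma (s + 1 + 2 * n) * w ^ (-(s + 1 + 2 * n)))) := by
    rw [← (laplace_term hσ1 hw0 n).2, ← (laplace_term hσ2 hw0 n).2, hF]
    simp only
    rw [integral_const_mul, integral_sub (((laplace_term hσ1 hw0 n).1.const_mul _).const_mul _)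
      ((laplace_term hσ2 hw0 n).1.const_mul _), integral_const_mul, integral_const_mul,
      integral_const_mul]
  rw [e, ← Complex.ofReal_cpow hw0.le, ← Complex.ofReal_cpow hw0.le, hc]
  push_cast
  ring

/-- The kernel decays like e^{-3bx/4}, so allowing Re w > -b/2 still leaves e^{-bx/4}. The point is
that the imaginary axis lies inside the half-plane. -/
theorem differentiableOn_laplaceKernel {ν b s : ℝ} (hν : 0 < ν) (hint : ∀ j : ℤ, ν ≠ j)
    (hb : 0 < b) (hs : 2 * ν < s) :
    DifferentiableOn ℂ (laplaceKernel ν b s) {w : ℂ | -(b / 2) < w.re} := by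
  obtain ⟨C, hC, hle⟩ := exists_abs_besselKernel_le hν hint hb
  have hcont := continuous_besselKernel (b := b) hν hint hs
  have hopen : IsOpen {w : ℂ | -(b / 2) < w.re} := isOpen_lt continuous_const Complex.continuous_re
  have hbd : ∀ w : ℂ, -(b / 2) < w.re → ∀ x : ℝ, 0 < x →
      ‖(besselKernel ν b s x : ℂ) * Complex.exp (-(w * x))‖ ≤
        C * (x ^ (s - 2 * ν) * Real.exp (-(b / 4 * x))) := by
    intro w hw x hx
    rw [norm_mul, Complex.norm_real, Real.norm_eq_abs, Complex.norm_exp]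
    have h1 : (-(w * x)).re ≤ b / 2 * x := by
      simp only [Complex.neg_re, Complex.mul_re, Complex.ofReal_re, Complex.ofReal_im, mul_zero,
        sub_zero]
      nlinarith
    calc _ ≤ C * (x ^ (s - 2 * ν) * Real.exp (-(3 / 4 * b * x))) * Real.exp (b / 2 * x) := by
          gcongr
          exact hle s x hx
      _ = C * (x ^ (s - 2 * ν) * (Real.exp (-(3 / 4 * b * x)) * Real.exp (b / 2 * x))) := by ring
      _ = _ := by
          rw [← Real.exp_add]
          ring_nf
  have hI : ∀ p : ℝ, -1 < p →
      IntegrableOn (fun x : ℝ => C * (x ^ p * Real.exp (-(b / 4 * x)))) (Ioi 0) := by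
    intro p hp
    have := integrableOn_exp_mul_rpow_Ioi_zero (ν := p + 1) (y := b / 4) (by linarith)
      (by positivity)
    refine (this.const_mul C).congr (Eventually.of_forall fun x => ?_)
    simp only [add_sub_cancel_right]
    ring
  intro w hw
  have hm : ∀ z : ℂ, AEStronglyMeasurable
      (fun x : ℝ => (besselKernel ν b s x : ℂ) * Complex.exp (-(z * x)))
      (volume.restrict (Ioi 0)) := fun z =>
    Continuous.aestronglyMeasurable (by fun_prop)
  have h := hasDerivAt_integral_of_dominated_loc_of_deriv_le (𝕜 := ℂ)
    (μ := volume.restrict (Ioi (0 : ℝ)))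
    (F := fun (z : ℂ) (x : ℝ) => (besselKernel ν b s x : ℂ) * Complex.exp (-(z * x)))
    (F' := fun (z : ℂ) (x : ℝ) => (besselKernel ν b s x : ℂ) * Complex.exp (-(z * x)) * -(x : ℂ))
    (x₀ := w) (s := {w : ℂ | -(b / 2) < w.re})
    (bound := fun x => C * (x ^ (s - 2 * ν + 1) * Real.exp (-(b / 4 * x))))
    (hopen.mem_nhds hw) (Eventually.of_forall hm) ?_ ?_ ?_ (hI _ (by linarith)) ?_
  · exact h.2.differentiableAt.differentiableWithinAt
  · refine Integrable.mono' (hI (s - 2 * ν) (by linarith)) (hm w) ?_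
    exact (ae_restrict_iff' measurableSet_Ioi).2 (Eventually.of_forall fun x hx => hbd w hw x hx)
  · exact Continuous.aestronglyMeasurable (by fun_prop)
  · refine (ae_restrict_iff' measurableSet_Ioi).2 (Eventually.of_forall fun x hx z hz => ?_)
    have hx0 : (0 : ℝ) < x := hx
    rw [norm_mul, norm_neg, Complex.norm_real, Real.norm_of_nonneg hx0.le]
    calc _ ≤ C * (x ^ (s - 2 * ν) * Real.exp (-(b / 4 * x))) * x := by
          gcongr
          exact hbd z hz x hx0
      _ = _ := by
          rw [Real.rpow_add_one hx0.ne']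
          ring
  · refine Eventually.of_forall fun x z _ => ?_
    have h1 : HasDerivAt (fun z : ℂ => -(z * (x : ℂ))) (-(x : ℂ)) z := by
      simpa using! ((hasDerivAt_id z).mul_const (x : ℂ)).neg
    exact (h1.cexp.const_mul _).congr_deriv (by ring)

theorem differentiableOn_laplaceClosed {ν b s : ℝ} (hν : 0 < ν) (hint : ∀ j : ℤ, ν ≠ j)
    (hb : 0 < b) (hs : 2 * ν < s) :
    DifferentiableOn ℂ (laplaceClosed ν b s) {w : ℂ | b < ‖w‖ ∧ w ∈ Complex.slitPlane} := by
  have h1 := differentiableOn_laplaceSeries (add_neg_ne_zero hint)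
    (show 0 < s + 1 - 2 * ν by linarith) hb
  have h2 := differentiableOn_laplaceSeries (add_ne_zero_of_int hint)
    (show 0 < s + 1 by linarith) hb
  exact ((h1.const_mul _).sub h2).const_mul _

theorem laplaceKernel_eqOn_re {ν b s : ℝ} (hν : 0 < ν) (hint : ∀ j : ℤ, ν ≠ j) (hb : 0 < b)
    (hs : 2 * ν < s) :
    EqOn (laplaceKernel ν b s) (laplaceClosed ν b s) {w : ℂ | b < w.re} := by
  have hopen : IsOpen {w : ℂ | b < w.re} := isOpen_lt continuous_const Complex.continuous_re
  have h1 : AnalyticOnNhd ℂ (laplaceKernel ν b s) {w : ℂ | b < w.re} :=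
    ((differentiableOn_laplaceKernel hν hint hb hs).mono fun w (hw : b < w.re) =>
      show -(b / 2) < w.re by linarith).analyticOnNhd hopen
  have h2 : AnalyticOnNhd ℂ (laplaceClosed ν b s) {w : ℂ | b < w.re} :=
    ((differentiableOn_laplaceClosed hν hint hb hs).mono fun w (hw : b < w.re) =>
      ⟨hw.trans_le ((le_abs_self _).trans (Complex.abs_re_le_norm w)),
        Or.inl (hb.trans hw)⟩).analyticOnNhd hopen
  refine h1.eqOn_of_preconnected_of_frequently_eq h2 (convex_halfSpace_re_gt b).isPreconnected
    (z₀ := ((b + 1 : ℝ) : ℂ)) (by simp) ?_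
  -- Equality is known only on the real ray, but its points accumulate at b + 1, which is enough for
  -- the identity theorem.
  have htend : Tendsto (fun t : ℝ => ((b + 1 + t : ℝ) : ℂ)) (𝓝[>] 0)
      (𝓝[≠] (((b + 1 : ℝ) : ℂ))) := by
    refine tendsto_nhdsWithin_iff.2 ⟨?_, ?_⟩
    · have : Continuous fun t : ℝ => ((b + 1 + t : ℝ) : ℂ) := by fun_prop
      have h := this.tendsto 0
      rw [add_zero] at h
      exact h.mono_left nhdsWithin_le_nhds
    · filter_upwards [self_mem_nhdsWithin] with t ht
      simp only [mem_compl_iff, mem_singleton_iff, Complex.ofReal_inj]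
      have : (0 : ℝ) < t := ht
      linarith
  refine htend.frequently (Eventually.frequently ?_)
  filter_upwards [self_mem_nhdsWithin] with t ht
  have : (0 : ℝ) < t := ht
  exact laplaceKernel_ofReal hν hint hb hs (by linarith)

/-- The closed form is not available in the disc |w| ≤ b, so the identity is carried around it. For
each sign σ the region is convex and meets the half-plane Re w > b. Together the two regions contain
all points 2πik with k ≠ 0 when b < 2π. -/
theorem laplaceKernel_eqOn_im {ν b s σ : ℝ} (hν : 0 < ν) (hint : ∀ j : ℤ, ν ≠ j) (hb : 0 < b)
    (hs : 2 * ν < s) (hσ : |σ| = 1) :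
    EqOn (laplaceKernel ν b s) (laplaceClosed ν b s)
      {w : ℂ | -(b / 2) < w.re ∧ b < σ * w.im} := by
  have hopen : IsOpen {w : ℂ | -(b / 2) < w.re ∧ b < σ * w.im} :=
    (isOpen_lt continuous_const Complex.continuous_re).inter
      (isOpen_lt continuous_const (continuous_const.mul Complex.continuous_im))
  have hconv : Convex ℝ {w : ℂ | -(b / 2) < w.re ∧ b < σ * w.im} := by
    intro x hx y hy p q hp hq hpq
    have e1 : (p • x + q • y).re = p * x.re + q * y.re := by simp
    have e2 : (p • x + q • y).im = p * x.im + q * y.im := by simp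
    simp only [mem_ofPred_eq] at hx hy ⊢
    rw [e1, e2]
    obtain rfl : q = 1 - p := by linarith
    constructor
    · rcases hp.eq_or_lt with h | h
      · subst h; simpa using hy.1
      · nlinarith [mul_lt_mul_of_pos_left hx.1 h, mul_le_mul_of_nonneg_left hy.1.le hq]
    · rcases hp.eq_or_lt with h | h
      · subst h; simpa using hy.2
      · nlinarith [mul_lt_mul_of_pos_left hx.2 h, mul_le_mul_of_nonneg_left hy.2.le hq]
  have h1 : AnalyticOnNhd ℂ (laplaceKernel ν b s) {w : ℂ | -(b / 2) < w.re ∧ b < σ * w.im} :=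
    ((differentiableOn_laplaceKernel hν hint hb hs).mono fun w hw => hw.1).analyticOnNhd hopen
  have h2 : AnalyticOnNhd ℂ (laplaceClosed ν b s) {w : ℂ | -(b / 2) < w.re ∧ b < σ * w.im} := by
    refine ((differentiableOn_laplaceClosed hν hint hb hs).mono fun w hw => ⟨?_, ?_⟩).analyticOnNhd
      hopen
    · have h3 : σ * w.im ≤ |w.im| := by
        calc σ * w.im ≤ |σ * w.im| := le_abs_self _
          _ = |w.im| := by rw [abs_mul, hσ, one_mul]
      exact (hw.2.trans_le h3).trans_le (Complex.abs_im_le_norm w)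
    · refine Or.inr fun h0 => ?_
      have := hw.2
      rw [h0, mul_zero] at this
      linarith
  have hσ2 : σ * σ = 1 := by rw [← abs_mul_abs_self, hσ, one_mul]
  have hz1 : b < (⟨b + 1, σ * (b + 1)⟩ : ℂ).re := by simp
  refine h1.eqOn_of_preconnected_of_eventuallyEq h2 hconv.isPreconnected
    (z₀ := ⟨b + 1, σ * (b + 1)⟩) ?_ ?_
  · refine ⟨?_, ?_⟩
    · show -(b / 2) < b + 1
      linarith
    · show b < σ * (σ * (b + 1))
      rw [← mul_assoc, hσ2]
      linarith
  · exact (laplaceKernel_eqOn_re hν hint hb hs).eventuallyEq_of_mem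
      ((isOpen_lt continuous_const Complex.continuous_re).mem_nhds hz1)

/-! ### Poisson summation. -/

/-- `besselKernel` extended by zero to the negative reals. -/
def besselKernelExt (ν b s x : ℝ) : ℂ := (besselKernel ν b s (max x 0) : ℂ)

theorem besselKernelExt_of_nonpos {ν b s x : ℝ} (hν : 0 < ν) (hs : 2 * ν < s) (hx : x ≤ 0) :
    besselKernelExt ν b s x = 0 := by
  rw [besselKernelExt, max_eq_right hx, besselKernel_zero hν hs, Complex.ofReal_zero]

theorem fourier_besselKernelExt {ν b s : ℝ} (hν : 0 < ν) (hs : 2 * ν < s) (ξ : ℝ) :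
    FourierTransform.fourier (besselKernelExt ν b s) ξ =
      laplaceKernel ν b s (((2 * Real.pi * ξ : ℝ) : ℂ) * Complex.I) := by
  rw [Real.fourier_real_eq_integral_exp_smul, laplaceKernel]
  rw [← setIntegral_eq_integral_of_forall_compl_eq_zero (s := Ioi 0)]
  · refine setIntegral_congr_fun measurableSet_Ioi fun x hx => ?_
    have hx0 : (0 : ℝ) < x := hx
    simp only [besselKernelExt, max_eq_left hx0.le, smul_eq_mul]
    rw [mul_comm]
    congr 2
    push_cast
    ring
  · intro x hx
    rw [besselKernelExt_of_nonpos hν hs (not_lt.1 hx), smul_zero]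

theorem isBigO_besselKernelExt {ν b s : ℝ} (hν : 0 < ν) (hint : ∀ j : ℤ, ν ≠ j) (hb : 0 < b)
    (hs : 2 * ν < s) :
    besselKernelExt ν b s =O[cocompact ℝ] fun x : ℝ => |x| ^ (-(2 : ℝ)) := by
  rw [cocompact_eq_atBot_atTop, isBigO_sup]
  constructor
  · refine (isBigO_zero (fun x : ℝ => |x| ^ (-(2 : ℝ))) atBot).congr' ?_ EventuallyEq.rfl
    filter_upwards [eventually_le_atBot (0 : ℝ)] with x hx
    rw [besselKernelExt_of_nonpos hν hs hx]
  · obtain ⟨C, hC, hle⟩ := exists_abs_besselKernel_le hν hint hb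
    have h1 := (isLittleO_exp_neg_mul_rpow_atTop (a := 3 / 4 * b) (by positivity)
      (-2 - (s - 2 * ν))).isBigO
    have h2 : (fun x : ℝ => C * (x ^ (s - 2 * ν) * Real.exp (-(3 / 4 * b) * x))) =O[atTop]
        fun x : ℝ => x ^ (s - 2 * ν) * x ^ (-2 - (s - 2 * ν)) :=
      ((isBigO_refl _ _).mul h1).const_mul_left C
    refine (IsBigO.of_bound 1 ?_).trans (h2.congr' EventuallyEq.rfl ?_)
    · filter_upwards [eventually_gt_atTop (0 : ℝ)] with x hx
      rw [besselKernelExt, max_eq_left hx.le, Complex.norm_real, Real.norm_eq_abs, one_mul]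
      refine (hle s x hx).trans ((le_abs_self _).trans_eq ?_)
      rw [Real.norm_eq_abs, neg_mul]
    · filter_upwards [eventually_gt_atTop (0 : ℝ)] with x hx
      rw [← Real.rpow_add hx, abs_of_pos hx]
      ring_nf

/-- `∑ₙ bⁿ`-weighted zeta values: the zeta-regularised form of `∑_N N ^ z * besselE μ (b * N)`. -/
def zetaSeries (μ b : ℝ) (z : ℂ) : ℂ :=
  ∑' n : ℕ, ((besselCoeff μ n * b ^ (2 * n) : ℝ) : ℂ) * riemannZeta (-z - 2 * n)

/-- Pairing opposite frequencies produces the cosine of the functional equation of ζ. -/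
theorem I_mul_cpow_add {t τ : ℝ} (ht : 0 < t) :
    ((t : ℂ) * Complex.I) ^ ((-τ : ℝ) : ℂ) + ((-t : ℝ) * Complex.I) ^ ((-τ : ℝ) : ℂ) =
      (t : ℂ) ^ (-(τ : ℂ)) * (2 * Complex.cos (Real.pi * τ / 2)) := by
  have ht' : (t : ℂ) ≠ 0 := by exact_mod_cast ht.ne'
  have e : (((-t : ℝ) : ℂ) * Complex.I) = (t : ℂ) * (-Complex.I) := by push_cast; ring
  rw [e, Complex.cpow_def_of_ne_zero (mul_ne_zero ht' Complex.I_ne_zero),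
    Complex.cpow_def_of_ne_zero (mul_ne_zero ht' (neg_ne_zero.2 Complex.I_ne_zero)),
    Complex.cpow_def_of_ne_zero ht', Complex.log_ofReal_mul ht Complex.I_ne_zero,
    Complex.log_ofReal_mul ht (neg_ne_zero.2 Complex.I_ne_zero), Complex.log_I, Complex.log_neg_I,
    Complex.two_cos, mul_add, ← Complex.exp_add, ← Complex.exp_add, Complex.ofReal_log ht.le,
    add_comm]
  congr 2 <;> push_cast <;> ring

/-- The double series over the frequency and the power converges absolutely, because every frequency
has modulus at least 2π > b and σ > 1. Summing over the frequency first gives ζ(σ+2n) times exactly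
the factors of the functional equation, hence ζ(1-σ-2n). -/
theorem hasSum_laplaceSeries_I {μ σ b : ℝ} (hμ : ∀ n : ℕ, (n : ℝ) + 1 + μ ≠ 0) (hσ : 1 < σ)
    (hb : 0 < b) (hb2 : b < 2 * Real.pi) :
    (Summable fun k : ℕ =>
      laplaceSeries μ σ b (((2 * Real.pi * (k + 1) : ℝ) : ℂ) * Complex.I)) ∧
    (Summable fun k : ℕ =>
      laplaceSeries μ σ b (((-(2 * Real.pi * (k + 1)) : ℝ) : ℂ) * Complex.I)) ∧
    HasSum (fun k : ℕ => laplaceSeries μ σ b (((2 * Real.pi * (k + 1) : ℝ) : ℂ) * Complex.I) +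
      laplaceSeries μ σ b (((-(2 * Real.pi * (k + 1)) : ℝ) : ℂ) * Complex.I))
      (zetaSeries μ b ((σ : ℂ) - 1)) := by
  have hσ0 : 0 < σ := by linarith
  have hpi := Real.pi_pos
  set r := b / (2 * Real.pi) with hr
  have hr0 : 0 < r := by positivity
  have hr1 : r < 1 := (div_lt_one (by positivity)).2 hb2
  have hk0 : ∀ k : ℕ, 2 * Real.pi ≤ 2 * Real.pi * ((k : ℝ) + 1) := fun k => by
    have : (0 : ℝ) ≤ k := Nat.cast_nonneg k
    nlinarith
  have hks : Summable fun k : ℕ => (2 * Real.pi * ((k : ℝ) + 1)) ^ (-σ) := by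
    have h := ((Real.summable_one_div_nat_add_rpow 1 σ).2 hσ).mul_left ((2 * Real.pi) ^ (-σ))
    refine h.congr fun k => ?_
    have hk : (0 : ℝ) < (k : ℝ) + 1 := by positivity
    rw [Real.mul_rpow (by positivity) hk.le, abs_of_pos hk, Real.rpow_neg hk.le, one_div]
  have hns := summable_besselCoeff_mul_Gamma hμ hσ0 hr0 hr1
  set w : ℝ → ℕ → ℂ := fun ε k => ((ε * (2 * Real.pi * (k + 1)) : ℝ) : ℂ) * Complex.I with hw
  set T : ℝ → ℕ × ℕ → ℂ := fun ε p =>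
    ((besselCoeff μ p.2 * b ^ (2 * p.2) * Real.Gamma (σ + 2 * p.2) : ℝ) : ℂ) *
      (w ε p.1) ^ ((-(σ + 2 * p.2) : ℝ) : ℂ) with hT
  have hwn : ∀ ε : ℝ, |ε| = 1 → ∀ k, ‖w ε k‖ = 2 * Real.pi * (k + 1) := by
    intro ε hε k
    rw [hw]
    simp only [norm_mul, Complex.norm_I, mul_one, Complex.norm_real, Real.norm_eq_abs, hε,
      one_mul]
    rw [← abs_mul, ← abs_mul]
    exact abs_of_pos (by positivity)
  have hTs : ∀ ε : ℝ, |ε| = 1 → Summable (T ε) := by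
    intro ε hε
    refine Summable.of_norm_bounded (hks.mul_of_nonneg hns (fun k => by positivity) (fun n => ?_))
      fun p => ?_
    · have hG : 0 < Real.Gamma (σ + 2 * n) := Real.Gamma_pos_of_pos (by positivity)
      show 0 ≤ |besselCoeff μ n| * Real.Gamma (σ + 2 * n) * r ^ (2 * n)
      positivity
    · have h := norm_laplaceSeries_term μ hσ0 hb (r := 2 * Real.pi) (by positivity)
        (w := w ε p.1) (by rw [hwn ε hε]; exact hk0 _) p.2
      rw [hwn ε hε] at h
      exact h
  have h1 := hTs 1 abs_one
  have h2 := hTs (-1) (by rw [abs_neg, abs_one])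
  have e1 : ∀ k : ℕ, laplaceSeries μ σ b (((2 * Real.pi * (k + 1) : ℝ) : ℂ) * Complex.I) =
      ∑' n, T 1 (k, n) := fun k => by
    simp only [laplaceSeries, hT, hw, one_mul]
  have e2 : ∀ k : ℕ, laplaceSeries μ σ b (((-(2 * Real.pi * (k + 1)) : ℝ) : ℂ) * Complex.I) =
      ∑' n, T (-1) (k, n) := fun k => by
    simp only [laplaceSeries, hT, hw, neg_one_mul]
  refine ⟨h1.prod.congr fun k => (e1 k).symm, h2.prod.congr fun k => (e2 k).symm, ?_⟩
  have h12 := h1.add h2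
  have hval : ∑' p, (T 1 p + T (-1) p) = zetaSeries μ b ((σ : ℂ) - 1) := by
    have hsw : Summable ((fun p => T 1 p + T (-1) p) ∘ Prod.swap) :=
      (Equiv.prodComm ℕ ℕ).summable_iff.2 h12
    rw [← (Equiv.prodComm ℕ ℕ).tsum_eq, zetaSeries]
    refine hsw.tsum_prod.trans (tsum_congr fun n => ?_)
    have hσn : 1 < σ + 2 * n := by
      have : (0 : ℝ) ≤ n := Nat.cast_nonneg n
      linarith
    have hfe := riemannZeta_one_sub (s := ((σ + 2 * n : ℝ) : ℂ)) (fun m hm => by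
      have := congrArg Complex.re hm
      simp only [Complex.ofReal_re, Complex.neg_re, Complex.natCast_re] at this
      have : (0 : ℝ) ≤ m := Nat.cast_nonneg m
      linarith) (fun h1 => by
      have := congrArg Complex.re h1
      simp only [Complex.ofReal_re, Complex.one_re] at this
      linarith)
    have hz := zeta_eq_tsum_one_div_nat_add_one_cpow (s := ((σ + 2 * n : ℝ) : ℂ))
      (by rw [Complex.ofReal_re]; exact hσn)
    have e3 : -((σ : ℂ) - 1) - 2 * n = 1 - ((σ + 2 * n : ℝ) : ℂ) := by push_cast; ring
    rw [e3, hfe, hz, ← tsum_mul_left, ← tsum_mul_left]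
    refine tsum_congr fun k => ?_
    have hk : (0 : ℝ) < 2 * Real.pi * (k + 1) := by positivity
    have hI := I_mul_cpow_add (τ := σ + 2 * n) hk
    have e4 : ((2 * Real.pi * ((k : ℝ) + 1) : ℝ) : ℂ) ^ (-((σ + 2 * n : ℝ) : ℂ)) =
        (2 * (Real.pi : ℂ)) ^ (-((σ + 2 * n : ℝ) : ℂ)) *
          (1 / ((k : ℂ) + 1) ^ ((σ + 2 * n : ℝ) : ℂ)) := by
      rw [Complex.ofReal_mul, Complex.mul_cpow_ofReal_nonneg (by positivity) (by positivity),
        Complex.cpow_neg ((((k : ℝ) + 1 : ℝ) : ℂ)), one_div]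
      push_cast
      rfl
    simp only [Function.comp, Prod.swap, hT, hw, one_mul, neg_one_mul]
    rw [← mul_add, hI, e4, Complex.Gamma_ofReal, Complex.ofReal_mul]
    ring
  rw [← hval]
  refine h12.hasSum.prod_fiberwise fun k => ?_
  rw [e1, e2]
  exact (h1.prod_factor k).hasSum.add (h2.prod_factor k).hasSum

theorem laplaceKernel_zero {ν b s : ℝ} (hν : 0 < ν) (hint : ∀ j : ℤ, ν ≠ j) (hb : 0 < b)
    (hs : 2 * ν < s) :
    laplaceKernel ν b s 0 = ((b ^ (-s - 1) *
      (2 ^ (s - 1) * Real.Gamma ((s + 1) / 2) * Real.Gamma ((s + 1) / 2 - ν)) : ℝ) : ℂ) := by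
  rw [← integral_rpow_mul_besselF hν hint (by linarith : 2 * ν - 1 < s), laplaceKernel]
  have h := integral_comp_mul_left_Ioi (fun x : ℝ => x ^ s * besselF ν x) 0 hb
  rw [mul_zero, smul_eq_mul] at h
  have e : b ^ (-s - 1) = b ^ (-s) * b⁻¹ := by
    rw [Real.rpow_sub_one hb.ne', div_eq_mul_inv]
  rw [e, mul_assoc, ← h, ← integral_const_mul, ← integral_complex_ofReal]
  refine setIntegral_congr_fun measurableSet_Ioi fun x hx => ?_
  have hx0 : (0 : ℝ) < x := hx
  have e2 : b ^ (-s) * b ^ s = 1 := by rw [← Real.rpow_add hb, neg_add_cancel, Real.rpow_zero]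
  simp only [zero_mul, neg_zero, Complex.exp_zero, mul_one]
  rw [besselKernel_eq s hb hx0, Real.mul_rpow hb.le hx0.le]
  congr 1
  calc x ^ s * besselF ν (b * x) = (b ^ (-s) * b ^ s) * x ^ s * besselF ν (b * x) := by
        rw [e2, one_mul]
    _ = _ := by ring

/-- Poisson summation at the origin: the zero frequency is the Mellin transform, and the others
assemble into the zeta series. The result is what one gets by formally replacing each divergent sum
of powers of N with the zeta value. -/
theorem tsum_besselKernel {ν b s : ℝ} (hν : 0 < ν) (hint : ∀ j : ℤ, ν ≠ j) (hb : 0 < b)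
    (hb2 : b < 2 * Real.pi) (hs : 2 * ν < s) :
    ∑' N : ℕ, (besselKernel ν b s (N + 1) : ℂ) = ((b ^ (-s - 1) *
      (2 ^ (s - 1) * Real.Gamma ((s + 1) / 2) * Real.Gamma ((s + 1) / 2 - ν)) : ℝ) : ℂ) +
      ((Real.pi / (2 * Real.sin (Real.pi * ν)) : ℝ) : ℂ) *
        ((((b / 2) ^ (-(2 * ν)) : ℝ) : ℂ) * zetaSeries (-ν) b ((s : ℂ) - 2 * ν) -
          zetaSeries ν b s) := by
  have hpi := Real.pi_pos
  obtain ⟨p1, n1, s1⟩ := hasSum_laplaceSeries_I (add_neg_ne_zero hint)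
    (show 1 < s + 1 - 2 * ν by linarith) hb hb2
  obtain ⟨p2, n2, s2⟩ := hasSum_laplaceSeries_I (add_ne_zero_of_int hint)
    (show 1 < s + 1 by linarith) hb hb2
  set κ : ℂ := ((Real.pi / (2 * Real.sin (Real.pi * ν)) : ℝ) : ℂ) with hκ
  set β : ℂ := (((b / 2) ^ (-(2 * ν)) : ℝ) : ℂ) with hβ
  have hk0 : ∀ k : ℕ, 2 * Real.pi ≤ 2 * Real.pi * ((k : ℝ) + 1) := fun k => by
    have : (0 : ℝ) ≤ k := Nat.cast_nonneg k
    nlinarith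
  set f : ℤ → ℂ := fun k => FourierTransform.fourier (besselKernelExt ν b s) (k : ℝ) with hf
  have fp : ∀ k : ℕ, f (k + 1) =
      laplaceClosed ν b s (((2 * Real.pi * (k + 1) : ℝ) : ℂ) * Complex.I) := by
    intro k
    rw [hf]
    simp only
    rw [fourier_besselKernelExt hν hs]
    push_cast
    refine laplaceKernel_eqOn_im hν hint hb hs (σ := 1) abs_one ⟨?_, ?_⟩
    · simp
      linarith
    · have := hk0 k
      simp
      linarith
  have fn : ∀ k : ℕ, f (-((k : ℤ) + 1)) =
      laplaceClosed ν b s (((-(2 * Real.pi * (k + 1)) : ℝ) : ℂ) * Complex.I) := by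
    intro k
    have e : 2 * Real.pi * ((-((k : ℤ) + 1) : ℤ) : ℝ) = -(2 * Real.pi * (k + 1)) := by
      push_cast; ring
    rw [hf]
    simp only
    rw [fourier_besselKernelExt hν hs, e]
    refine laplaceKernel_eqOn_im hν hint hb hs (σ := -1) (by norm_num) ⟨?_, ?_⟩
    · simp
      linarith
    · have := hk0 k
      simp
      linarith
  have hfp : HasSum (fun k : ℕ => f (k + 1)) (∑' k : ℕ, f (k + 1)) :=
    ((((p1.mul_left β).sub p2).mul_left κ).congr fun k => (fp k).symm).hasSum
  have hfn : HasSum (fun k : ℕ => f (-((k : ℤ) + 1))) (∑' k : ℕ, f (-((k : ℤ) + 1))) :=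
    ((((n1.mul_left β).sub n2).mul_left κ).congr fun k => (fn k).symm).hasSum
  have hfs := hfp.of_add_one_of_neg_add_one hfn
  have hcont : Continuous (besselKernelExt ν b s) := by
    have := continuous_besselKernel (b := b) hν hint hs
    unfold besselKernelExt
    fun_prop
  have hP := Real.tsum_eq_tsum_fourier_of_rpow_decay_of_summable hcont one_lt_two
    (isBigO_besselKernelExt hν hint hb hs) hfs.summable 0
  have hL : ∑' n : ℤ, besselKernelExt ν b s (0 + (n : ℝ)) =
      ∑' N : ℕ, (besselKernel ν b s (N + 1) : ℂ) := by
    have hinj : Function.Injective fun N : ℕ => (N : ℤ) + 1 := fun x y h => by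
      simpa using h
    rw [← hinj.tsum_eq]
    · refine tsum_congr fun N => ?_
      have hN : (0 : ℝ) ≤ (N : ℝ) + 1 := by positivity
      push_cast
      rw [zero_add, besselKernelExt, max_eq_left hN]
    · intro n hn
      rw [Function.mem_support] at hn
      have h0 : 0 < n := by
        by_contra h
        refine hn (besselKernelExt_of_nonpos hν hs ?_)
        rw [zero_add]
        exact_mod_cast not_lt.1 h
      exact ⟨(n - 1).toNat, by simp only; omega⟩
  have hR : ∑' n : ℤ, FourierTransform.fourier (besselKernelExt ν b s) (n : ℝ) *
      fourier n ((0 : ℝ) : UnitAddCircle) = ∑' n, f n := by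
    refine tsum_congr fun n => ?_
    have : fourier n ((0 : ℝ) : UnitAddCircle) = 1 := by
      rw [AddCircle.coe_zero]
      exact fourier_eval_zero n
    rw [this, mul_one]
  have hsum := (hfp.add hfn).unique (hasSum_of_eq (((s1.mul_left β).sub s2).mul_left κ)
    (fun k => by rw [fp, fn, laplaceClosed, laplaceClosed]; ring) rfl)
  have h0 : f 0 = laplaceKernel ν b s 0 := by
    rw [hf]
    simp only
    rw [fourier_besselKernelExt hν hs]
    simp
  have e1 : ((s + 1 - 2 * ν : ℝ) : ℂ) - 1 = (s : ℂ) - 2 * ν := by push_cast; ring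
  have e2 : ((s + 1 : ℝ) : ℂ) - 1 = (s : ℂ) := by push_cast; ring
  rw [e1, e2] at hsum
  rw [hL, hR, hfs.tsum_eq] at hP
  rw [hP, ← laplaceKernel_zero hν hint hb hs, ← h0, ← hsum]
  ring

/-! ### Analytic continuation in the exponent. -/

theorem norm_Gamma_le {z : ℂ} (hz : 0 < z.re) : ‖Complex.Gamma z‖ ≤ Real.Gamma z.re := by
  rw [Complex.Gamma_eq_integral hz, Real.Gamma_eq_integral hz, Complex.GammaIntegral]
  refine (norm_integral_le_integral_norm _).trans_eq ?_
  refine setIntegral_congr_fun measurableSet_Ioi fun x hx => ?_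
  have hx0 : (0 : ℝ) < x := hx
  rw [norm_mul, Complex.norm_cpow_eq_rpow_re_of_pos hx0, Complex.norm_real,
    Real.norm_of_nonneg (Real.exp_pos _).le]
  simp

theorem norm_cos_le_exp (z : ℂ) : ‖Complex.cos z‖ ≤ Real.exp |z.im| := by
  have h : Complex.cos z = (Complex.exp (z * Complex.I) + Complex.exp (-z * Complex.I)) / 2 := by
    rw [← Complex.two_cos]; ring
  rw [h, norm_div, Complex.norm_ofNat, div_le_iff₀ two_pos]
  refine (norm_add_le _ _).trans ?_
  rw [Complex.norm_exp, Complex.norm_exp]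
  have h1 : Real.exp (z * Complex.I).re ≤ Real.exp |z.im| := by
    gcongr
    simp
    exact neg_le_abs _
  have h2 : Real.exp (-z * Complex.I).re ≤ Real.exp |z.im| := by
    gcongr
    simp
    exact le_abs_self _
  linarith

theorem exists_norm_riemannZeta_le : ∃ C : ℝ, 0 < C ∧ ∀ z : ℂ, 2 ≤ z.re → ‖riemannZeta z‖ ≤ C := by
  have hs := (Real.summable_one_div_nat_add_rpow 1 2).2 one_lt_two
  refine ⟨(∑' n : ℕ, 1 / |(n : ℝ) + 1| ^ (2 : ℝ)) + 1, ?_, fun z hz => ?_⟩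
  · have : 0 ≤ ∑' n : ℕ, 1 / |(n : ℝ) + 1| ^ (2 : ℝ) := tsum_nonneg fun n => by positivity
    linarith
  · rw [zeta_eq_tsum_one_div_nat_add_one_cpow (by linarith)]
    refine (tsum_of_norm_bounded hs.hasSum fun n => ?_).trans (by linarith)
    have hn : (1 : ℝ) ≤ (n : ℝ) + 1 := by
      have : (0 : ℝ) ≤ n := Nat.cast_nonneg n
      linarith
    have e : ((n : ℂ) + 1) = (((n : ℝ) + 1 : ℝ) : ℂ) := by push_cast; rfl
    rw [e, norm_div, norm_one, Complex.norm_cpow_eq_rpow_re_of_pos (by linarith),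
      abs_of_pos (by linarith)]
    gcongr

/-- The functional equation and boundedness of ζ on Re z ≥ 2. The crude growth in Im z is harmless,
as the bound is only used on unit balls. -/
theorem exists_norm_riemannZeta_one_sub_le : ∃ C : ℝ, 0 < C ∧ ∀ z : ℂ, 2 ≤ z.re →
    ‖riemannZeta (1 - z)‖ ≤
      C * ((2 * Real.pi) ^ (-z.re) * Real.Gamma z.re * Real.exp (2 * |z.im|)) := by
  obtain ⟨C, hC, h⟩ := exists_norm_riemannZeta_le
  refine ⟨2 * C, by positivity, fun z hz => ?_⟩
  have hpi := Real.pi_pos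
  have hG : 0 < Real.Gamma z.re := Real.Gamma_pos_of_pos (by linarith)
  have hfe := riemannZeta_one_sub (s := z) (fun m hm => by
      have := congrArg Complex.re hm
      simp only [Complex.neg_re, Complex.natCast_re] at this
      have : (0 : ℝ) ≤ m := Nat.cast_nonneg m
      linarith) (fun h1 => by
      have := congrArg Complex.re h1
      simp only [Complex.one_re] at this
      linarith)
  have e : (2 * (Real.pi : ℂ)) = ((2 * Real.pi : ℝ) : ℂ) := by push_cast; rfl
  have hcos : ‖Complex.cos (Real.pi * z / 2)‖ ≤ Real.exp (2 * |z.im|) := by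
    refine (norm_cos_le_exp _).trans (Real.exp_le_exp.2 ?_)
    have e2 : ((Real.pi : ℂ) * z / 2).im = Real.pi / 2 * z.im := by
      have : (Real.pi : ℂ) * z / 2 = ((Real.pi / 2 : ℝ) : ℂ) * z := by push_cast; ring
      rw [this, Complex.im_ofReal_mul]
    rw [e2, abs_mul, abs_of_pos (by positivity)]
    gcongr
    linarith [Real.pi_le_four]
  rw [hfe, norm_mul, norm_mul, norm_mul, norm_mul, Complex.norm_ofNat, e,
    Complex.norm_cpow_eq_rpow_re_of_pos (by positivity), Complex.neg_re]
  calc _ ≤ 2 * (2 * Real.pi) ^ (-z.re) * Real.Gamma z.re * Real.exp (2 * |z.im|) * C := by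
        gcongr
        · exact norm_Gamma_le (by linarith)
        · exact h z hz
    _ = _ := by ring

/-- Locally uniform majorants for the terms of `zetaSeries`. -/
theorem exists_zetaSeries_majorant {μ b : ℝ} (hμ : ∀ n : ℕ, (n : ℝ) + 1 + μ ≠ 0) (hb : 0 < b)
    (hb2 : b < 2 * Real.pi) (z₀ : ℂ) : ∃ (k : ℕ) (u : ℕ → ℝ), Summable u ∧
      ∀ n, ∀ z ∈ Metric.ball z₀ 1,
        ‖((besselCoeff μ (n + k) * b ^ (2 * (n + k)) : ℝ) : ℂ) *
          riemannZeta (-z - 2 * ((n + k : ℕ) : ℂ))‖ ≤ u n ∧ z + 2 * ((n + k : ℕ) : ℂ) + 1 ≠ 0 := by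
  obtain ⟨C, hC, h⟩ := exists_norm_riemannZeta_one_sub_le
  have hpi := Real.pi_pos
  have hpi3 := Real.pi_gt_three
  -- With this k, every index m ≥ k has Re(z + 2m + 1) ≥ 2 on the whole ball, which keeps clear of
  -- the pole of ζ as well.
  obtain ⟨k, hk⟩ := exists_nat_gt (|z₀.re| + 1)
  set R := |z₀.re| with hR
  have hR0 : 0 ≤ R := abs_nonneg _
  set r := b / (2 * Real.pi) with hr
  -- On the ball Re(z + 2m + 1) is at most R + 2 + 2m, so this σ dominates by monotonicity of Γ on
  -- [2, ∞).
  have hs := summable_besselCoeff_mul_Gamma hμ (σ := R + 2) (r := r) (by positivity)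
    (by positivity) ((div_lt_one (by positivity)).2 hb2)
  set K := C * (2 * Real.pi) ^ R * Real.exp (2 * (|z₀.im| + 1)) with hK
  have hs2 := (hs.mul_left K).comp_injective (add_left_injective k)
  refine ⟨k, _, hs2, fun n z hz => ?_⟩
  simp only [Function.comp]
  set m := n + k with hm
  have hmk : (k : ℝ) ≤ m := by rw [hm]; push_cast; linarith [(Nat.cast_nonneg n : (0 : ℝ) ≤ n)]
  rw [Metric.mem_ball, dist_eq_norm] at hz
  have h1 : |z.re - z₀.re| < 1 := (Complex.abs_re_le_norm (z - z₀)).trans_lt hz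
  have h2 : |z.im - z₀.im| < 1 := (Complex.abs_im_le_norm (z - z₀)).trans_lt hz
  have h3 := abs_lt.1 h1
  have h4 := abs_le.1 (le_refl R)
  have him : |z.im| ≤ |z₀.im| + 1 := by
    have := abs_add_le (z.im - z₀.im) z₀.im
    rw [sub_add_cancel] at this
    linarith
  have hre1 : z₀.re ≤ R := le_abs_self _
  have hre2 : -R ≤ z₀.re := neg_abs_le _
  have e : -z - 2 * (m : ℂ) = 1 - (z + 2 * m + 1) := by ring
  have ere : (z + 2 * m + 1).re = z.re + 2 * m + 1 := by simp
  have eim : (z + 2 * m + 1).im = z.im := by simp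
  refine ⟨?_, fun h0 => ?_⟩
  swap
  · rw [h0, Complex.zero_re] at ere
    linarith
  have h5 := h (z + 2 * m + 1) (by rw [ere]; linarith)
  rw [ere, eim] at h5
  have hG : Real.Gamma (z.re + 2 * m + 1) ≤ Real.Gamma (R + 2 + 2 * m) := by
    refine Real.Gamma_strictMonoOn_Ici.monotoneOn ?_ ?_ ?_
    · rw [mem_Ici]; linarith
    · rw [mem_Ici]; linarith
    · linarith
  have hp : (2 * Real.pi) ^ (-(z.re + 2 * m + 1)) ≤ (2 * Real.pi) ^ R * ((2 * Real.pi) ^ (2 * m))⁻¹ := by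
    have : ((2 * Real.pi) ^ (2 * m))⁻¹ = (2 * Real.pi) ^ (-(2 * m : ℝ)) := by
      rw [Real.rpow_neg (by positivity), ← Real.rpow_natCast]
      push_cast
      rfl
    rw [this, ← Real.rpow_add (by positivity)]
    refine Real.rpow_le_rpow_of_exponent_le (by linarith) (by linarith)
  have hGp : 0 < Real.Gamma (z.re + 2 * m + 1) := Real.Gamma_pos_of_pos (by linarith)
  rw [e, norm_mul, Complex.norm_real, Real.norm_eq_abs, abs_mul, abs_of_pos (pow_pos hb _)]
  calc _ ≤ |besselCoeff μ m| * b ^ (2 * m) * (C * ((2 * Real.pi) ^ R * ((2 * Real.pi) ^ (2 * m))⁻¹ *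
        Real.Gamma (R + 2 + 2 * m) * Real.exp (2 * (|z₀.im| + 1)))) := by
        refine mul_le_mul_of_nonneg_left (h5.trans ?_) (by positivity)
        gcongr
    _ = _ := by
        rw [hK, hr, div_pow]
        ring

theorem summable_zetaSeries {μ b : ℝ} (hμ : ∀ n : ℕ, (n : ℝ) + 1 + μ ≠ 0) (hb : 0 < b)
    (hb2 : b < 2 * Real.pi) (z : ℂ) :
    Summable fun n : ℕ => ((besselCoeff μ n * b ^ (2 * n) : ℝ) : ℂ) * riemannZeta (-z - 2 * n) := by
  obtain ⟨k, u, hu, h⟩ := exists_zetaSeries_majorant hμ hb hb2 z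
  rw [← summable_nat_add_iff k]
  exact Summable.of_norm_bounded hu fun n => (h n z (Metric.mem_ball_self one_pos)).1

theorem differentiableAt_zetaSeries {μ b : ℝ} (hμ : ∀ n : ℕ, (n : ℝ) + 1 + μ ≠ 0) (hb : 0 < b)
    (hb2 : b < 2 * Real.pi) {z₀ : ℂ} (hz : ∀ n : ℕ, z₀ + 2 * n + 1 ≠ 0) :
    DifferentiableAt ℂ (zetaSeries μ b) z₀ := by
  obtain ⟨k, u, hu, h⟩ := exists_zetaSeries_majorant hμ hb hb2 z₀
  have hfun : zetaSeries μ b = fun z => (∑ n ∈ Finset.range k,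
      ((besselCoeff μ n * b ^ (2 * n) : ℝ) : ℂ) * riemannZeta (-z - 2 * n)) +
      ∑' n : ℕ, ((besselCoeff μ (n + k) * b ^ (2 * (n + k)) : ℝ) : ℂ) *
          riemannZeta (-z - 2 * ((n + k : ℕ) : ℂ)) := by
    ext z
    exact ((summable_zetaSeries hμ hb hb2 z).sum_add_tsum_nat_add k).symm
  have hd : ∀ (c : ℂ) (m : ℕ) (z : ℂ), z + 2 * m + 1 ≠ 0 →
      DifferentiableAt ℂ (fun z => c * riemannZeta (-z - 2 * m)) z := by
    intro c m z hm
    refine DifferentiableAt.const_mul ?_ _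
    refine DifferentiableAt.comp z (differentiableAt_riemannZeta ?_) (by fun_prop)
    intro h1
    exact hm (by linear_combination -h1)
  rw [hfun]
  refine DifferentiableAt.add (DifferentiableAt.fun_sum fun n _ => hd _ n _ (hz n)) ?_
  have hU : DifferentiableOn ℂ (fun z => ∑' n : ℕ,
      ((besselCoeff μ (n + k) * b ^ (2 * (n + k)) : ℝ) : ℂ) *
        riemannZeta (-z - 2 * ((n + k : ℕ) : ℂ))) (Metric.ball z₀ 1) :=
    Complex.differentiableOn_tsum_of_summable_norm hu
      (fun n z hz => (hd _ (n + k) z (h n z hz).2).differentiableWithinAt) Metric.isOpen_ball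
      fun n z hz => (h n z hz).1
  exact hU.differentiableAt (Metric.isOpen_ball.mem_nhds (Metric.mem_ball_self one_pos))

theorem summable_besselKernel {ν b s : ℝ} (hν : 0 < ν) (hint : ∀ j : ℤ, ν ≠ j) (hb : 0 < b)
    (hs : 2 * ν < s) : Summable fun N : ℕ => |besselKernel ν b s (N + 1)| := by
  have h := (isBigO_besselKernelExt hν hint hb hs).comp_tendsto (k := fun N : ℕ => (N : ℝ) + 1)
    (l' := atTop) ?_
  · have h1 := (Real.summable_one_div_nat_add_rpow 1 2).2 one_lt_two
    have h2 : Summable fun N : ℕ => ((fun x : ℝ => |x| ^ (-(2 : ℝ))) ∘ fun N : ℕ => (N : ℝ) + 1) N := by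
      refine h1.congr fun N => ?_
      simp only [Function.comp]
      rw [Real.rpow_neg (abs_nonneg _), one_div]
    refine ((summable_of_isBigO_nat h2 h).norm).congr fun N => ?_
    have hN : (0 : ℝ) ≤ (N : ℝ) + 1 := by positivity
    simp only [Function.comp]
    rw [besselKernelExt, max_eq_left hN, Complex.norm_real, Real.norm_eq_abs]
  · rw [cocompact_eq_atBot_atTop]
    exact (tendsto_atTop_add_const_right _ _ tendsto_natCast_atTop_atTop).mono_right le_sup_right

/-- The entire function `∑ N ^ z (bN/2)^(-ν) K_ν(bN)`. -/
def besselDirichlet (ν b : ℝ) (z : ℂ) : ℂ :=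
  ∑' N : ℕ, (besselF ν (b * (N + 1)) : ℂ) * ((N + 1 : ℝ) : ℂ) ^ z

/-- On Re z < R the series is majorised by the same sum at the real exponent R, finite because
`besselF` decays exponentially. -/
theorem differentiable_besselDirichlet {ν b : ℝ} (hν : 0 < ν) (hint : ∀ j : ℤ, ν ≠ j)
    (hb : 0 < b) : Differentiable ℂ (besselDirichlet ν b) := by
  intro z₀
  set R := max (z₀.re + 1) (2 * ν + 1) with hR
  have hopen : IsOpen {z : ℂ | z.re < R} := isOpen_lt Complex.continuous_re continuous_const
  have h : DifferentiableOn ℂ (besselDirichlet ν b) {z : ℂ | z.re < R} := by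
    refine Complex.differentiableOn_tsum_of_summable_norm
      (summable_besselKernel hν hint hb (s := R) ?_) (fun N => ?_) hopen fun N z hz => ?_
    · have := le_max_right (z₀.re + 1) (2 * ν + 1)
      linarith
    · have : ((N + 1 : ℝ) : ℂ) ≠ 0 := by
        rw [Complex.ofReal_ne_zero]; positivity
      exact (DifferentiableOn.const_cpow differentiableOn_id (Or.inl this)).const_mul _
    · have hN : (1 : ℝ) ≤ (N : ℝ) + 1 := by
        have : (0 : ℝ) ≤ N := Nat.cast_nonneg N
        linarith
      have hN0 : (0 : ℝ) < (N : ℝ) + 1 := by positivity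
      rw [besselKernel_eq R hb hN0, norm_mul, Complex.norm_real, Real.norm_eq_abs,
        Complex.norm_cpow_eq_rpow_re_of_pos hN0, abs_mul, mul_comm,
        abs_of_pos (Real.rpow_pos_of_pos hN0 R)]
      have hz' : z.re < R := hz
      gcongr
  refine h.differentiableAt (hopen.mem_nhds ?_)
  have := le_max_left (z₀.re + 1) (2 * ν + 1)
  show z₀.re < R
  linarith

/-- The expansion of `besselDirichlet`: a Mellin transform plus zeta-regularised series. -/
def dirichletClosed (ν b : ℝ) (z : ℂ) : ℂ :=
  (b : ℂ) ^ (-z - 1) * ((2 : ℂ) ^ (z - 1) * Complex.Gamma ((z + 1) / 2) *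
    Complex.Gamma ((z + 1) / 2 - ν)) +
      ((Real.pi / (2 * Real.sin (Real.pi * ν)) : ℝ) : ℂ) *
        ((((b / 2) ^ (-(2 * ν)) : ℝ) : ℂ) * zetaSeries (-ν) b (z - 2 * ν) - zetaSeries ν b z)

theorem besselDirichlet_ofReal {ν b s : ℝ} (hν : 0 < ν) (hint : ∀ j : ℤ, ν ≠ j) (hb : 0 < b)
    (hb2 : b < 2 * Real.pi) (hs : 2 * ν < s) :
    besselDirichlet ν b (s : ℂ) = dirichletClosed ν b (s : ℂ) := by
  have h := tsum_besselKernel hν hint hb hb2 hs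
  have e : ∑' N : ℕ, (besselKernel ν b s (N + 1) : ℂ) = besselDirichlet ν b (s : ℂ) := by
    refine tsum_congr fun N => ?_
    have hN0 : (0 : ℝ) < (N : ℝ) + 1 := by positivity
    rw [besselKernel_eq s hb hN0, ← Complex.ofReal_cpow hN0.le, mul_comm]
    push_cast
    rfl
  rw [← e, h, dirichletClosed]
  congr 1
  have e1 : -(s : ℂ) - 1 = ((-s - 1 : ℝ) : ℂ) := by push_cast; rfl
  have e2 : (s : ℂ) - 1 = ((s - 1 : ℝ) : ℂ) := by push_cast; rfl
  have e3 : ((s : ℂ) + 1) / 2 = (((s + 1) / 2 : ℝ) : ℂ) := by push_cast; rfl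
  have e4 : (2 : ℂ) = ((2 : ℝ) : ℂ) := by norm_num
  rw [e3, ← Complex.ofReal_sub, Complex.Gamma_ofReal, Complex.Gamma_ofReal, e1, e2, e4,
    ← Complex.ofReal_cpow hb.le, ← Complex.ofReal_cpow two_pos.le]
  push_cast
  rfl

/-- Both sides are analytic off two sequences of points that contain all poles of the right side.
The complement of a countable set in the plane is connected, and the two sides agree for real
exponents above 2ν. -/
theorem besselDirichlet_eq {ν b : ℝ} (hν : 0 < ν) (hint : ∀ j : ℤ, ν ≠ j) (hb : 0 < b)
    (hb2 : b < 2 * Real.pi) {z : ℂ} (hz1 : ∀ n : ℕ, z ≠ -1 - n)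
    (hz2 : ∀ n : ℕ, z ≠ 2 * ν - 1 - n) :
    besselDirichlet ν b z = dirichletClosed ν b z := by
  -- Describing the excluded points as zeros of the entire function 1/Γ makes it immediate that
  -- their complement is open.
  set V : Set ℂ := {z | (Complex.Gamma (z + 1))⁻¹ ≠ 0 ∧ (Complex.Gamma (z + 1 - 2 * ν))⁻¹ ≠ 0}
    with hV
  have hmem : ∀ z, z ∈ V ↔ (∀ n : ℕ, z ≠ -1 - n) ∧ ∀ n : ℕ, z ≠ 2 * ν - 1 - n := by
    intro z
    rw [hV, mem_ofPred_eq]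
    simp only [ne_eq, inv_eq_zero, Complex.Gamma_eq_zero_iff, not_exists]
    refine and_congr (forall_congr' fun n => not_congr ?_) (forall_congr' fun n => not_congr ?_)
    · constructor <;> intro h <;> linear_combination h
    · constructor <;> intro h <;> linear_combination h
  have hopen : IsOpen V := by
    have hc := Complex.differentiable_one_div_Gamma.continuous
    refine IsOpen.inter ?_ ?_
    · exact isOpen_ne_fun (hc.comp (by fun_prop : Continuous fun z : ℂ => z + 1)) continuous_const
    · exact isOpen_ne_fun (hc.comp (by fun_prop : Continuous fun z : ℂ => z + 1 - 2 * ν))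
        continuous_const
  have hconn : IsPreconnected V := by
    have hcount : (Vᶜ).Countable := by
      refine ((countable_range fun n : ℕ => (-1 - n : ℂ)).union
        (countable_range fun n : ℕ => (2 * ν - 1 - n : ℂ))).mono fun z hz => ?_
      rw [mem_compl_iff, hmem, not_and_or] at hz
      push Not at hz
      rcases hz with ⟨n, hn⟩ | ⟨n, hn⟩
      · exact Or.inl ⟨n, hn.symm⟩
      · exact Or.inr ⟨n, hn.symm⟩
    have := (hcount.isConnected_compl_of_one_lt_rank (by simp)).2
    rwa [compl_compl] at this
  have hd1 : AnalyticOnNhd ℂ (besselDirichlet ν b) V :=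
    (differentiable_besselDirichlet hν hint hb).differentiableOn.analyticOnNhd hopen
  have hd2 : AnalyticOnNhd ℂ (dirichletClosed ν b) V := by
    refine DifferentiableOn.analyticOnNhd (fun z hz => DifferentiableAt.differentiableWithinAt ?_)
      hopen
    obtain ⟨h1, h2⟩ := (hmem z).1 hz
    have hb0 : (b : ℂ) ≠ 0 := by exact_mod_cast hb.ne'
    have g1 : DifferentiableAt ℂ (fun z : ℂ => (b : ℂ) ^ (-z - 1)) z :=
      DifferentiableAt.const_cpow (by fun_prop) (Or.inl hb0)
    have g2 : DifferentiableAt ℂ (fun z : ℂ => (2 : ℂ) ^ (z - 1)) z :=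
      DifferentiableAt.const_cpow (by fun_prop) (Or.inl two_ne_zero)
    have g3 : DifferentiableAt ℂ (fun z : ℂ => Complex.Gamma ((z + 1) / 2)) z := by
      refine DifferentiableAt.comp z (Complex.differentiableAt_Gamma _ fun m hm => ?_)
        (by fun_prop)
      exact h1 (2 * m) (by push_cast; linear_combination 2 * hm)
    have g4 : DifferentiableAt ℂ (fun z : ℂ => Complex.Gamma ((z + 1) / 2 - ν)) z := by
      refine DifferentiableAt.comp z (Complex.differentiableAt_Gamma _ fun m hm => ?_)
        (by fun_prop)
      exact h2 (2 * m) (by push_cast; linear_combination 2 * hm)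
    have g5 : DifferentiableAt ℂ (fun z : ℂ => zetaSeries (-ν) b (z - 2 * ν)) z := by
      refine DifferentiableAt.comp z (differentiableAt_zetaSeries (add_neg_ne_zero hint) hb hb2
        fun n hn => ?_) (by fun_prop)
      exact h2 (2 * n) (by push_cast; linear_combination hn)
    have g6 : DifferentiableAt ℂ (zetaSeries ν b) z := by
      refine differentiableAt_zetaSeries (add_ne_zero_of_int hint) hb hb2 fun n hn => ?_
      exact h1 (2 * n) (by push_cast; linear_combination hn)
    unfold dirichletClosed
    exact (g1.mul ((g2.mul g3).mul g4)).add (((g5.const_mul _).sub g6).const_mul _)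
  have hreal : ∀ s : ℝ, 2 * ν < s → (s : ℂ) ∈ V := by
    intro s hs
    refine (hmem _).2 ⟨fun n hn => ?_, fun n hn => ?_⟩
    · have := congrArg Complex.re hn
      simp at this
      linarith [(Nat.cast_nonneg n : (0 : ℝ) ≤ n)]
    · have := congrArg Complex.re hn
      simp at this
      linarith [(Nat.cast_nonneg n : (0 : ℝ) ≤ n)]
  refine hd1.eqOn_of_preconnected_of_frequently_eq hd2 hconn (hreal (2 * ν + 1) (by linarith)) ?_
    ((hmem z).2 ⟨hz1, hz2⟩)
  have htend : Tendsto (fun t : ℝ => ((2 * ν + 1 + t : ℝ) : ℂ)) (𝓝[>] 0)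
      (𝓝[≠] (((2 * ν + 1 : ℝ) : ℂ))) := by
    refine tendsto_nhdsWithin_iff.2 ⟨?_, ?_⟩
    · have : Continuous fun t : ℝ => ((2 * ν + 1 + t : ℝ) : ℂ) := by fun_prop
      have h := this.tendsto 0
      rw [add_zero] at h
      exact h.mono_left nhdsWithin_le_nhds
    · filter_upwards [self_mem_nhdsWithin] with t ht
      simp only [mem_compl_iff, mem_singleton_iff, Complex.ofReal_inj]
      have : (0 : ℝ) < t := ht
      linarith
  refine htend.frequently (Eventually.frequently ?_)
  filter_upwards [self_mem_nhdsWithin] with t ht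
  have : (0 : ℝ) < t := ht
  exact besselDirichlet_ofReal hν hint hb hb2 (by linarith)

/-! ### The coefficients A and B and the functional equation. -/

theorem Gamma_mul_Gamma_half (x : ℝ) : Real.Gamma (x / 2 + 1 / 2) * Real.Gamma (x / 2 + 1) =
    Real.Gamma (x + 1) * 2 ^ (-x) * √Real.pi := by
  have h := Real.Gamma_mul_Gamma_add_half (x / 2 + 1 / 2)
  have e1 : x / 2 + 1 / 2 + 1 / 2 = x / 2 + 1 := by ring
  have e2 : 2 * (x / 2 + 1 / 2) = x + 1 := by ring
  have e3 : 1 - (x + 1) = -x := by ring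
  rw [e1, e2, e3] at h
  exact h

/-- The duplication formula merges each pair of gamma factors differing by one half. What is left
has the form Γ(w)ζ(w), suited both to the functional equation and to the integral over `bose`. -/
theorem coeffB_eq {ν : ℝ} (m n : ℕ) : coeffB ν m n =
    4 ^ ν * besselCoeff (-ν) n * (Real.Gamma (m + 2 * n + 1 - 2 * ν) / (m.factorial : ℝ)) *
      (realZeta (m + 2 * n + 1 - 2 * ν) * Real.sin (Real.pi * (m / 2 - ν))) := by
  have h1 := Gamma_mul_Gamma_half (m + 2 * n - 2 * ν)
  have h2 := Gamma_mul_Gamma_half m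
  have e1 : ((m : ℝ) + 2 * n - 2 * ν) / 2 + 1 / 2 = m / 2 + n + 1 / 2 - ν := by ring
  have e2 : ((m : ℝ) + 2 * n - 2 * ν) / 2 + 1 = m / 2 + n + 1 - ν := by ring
  have e3 : (m : ℝ) + 2 * n - 2 * ν + 1 = m + 2 * n + 1 - 2 * ν := by ring
  have e4 : (n : ℝ) + 1 - ν = n + 1 + -ν := by ring
  rw [e1, e2, e3] at h1
  rw [Real.Gamma_nat_eq_factorial] at h2
  have e5 : (2 : ℝ) ^ (-((m : ℝ) + 2 * n - 2 * ν)) = 2 ^ (-(m : ℝ)) * (4 ^ ν / 4 ^ n) := by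
    have h4 : (4 : ℝ) = 2 ^ (2 : ℝ) := by norm_num
    rw [← Real.rpow_natCast 4 n, h4, ← Real.rpow_mul two_pos.le, ← Real.rpow_mul two_pos.le,
      ← Real.rpow_sub two_pos, ← Real.rpow_add two_pos]
    ring_nf
  have hp : (0 : ℝ) < 2 ^ (-(m : ℝ)) := by positivity
  have hpi : 0 < √Real.pi := Real.sqrt_pos.2 Real.pi_pos
  rw [coeffB, h1, h2, e5, e4, besselCoeff]
  congr 1
  field_simp

theorem coeffA_eq {ν : ℝ} (m n : ℕ) : coeffA ν m n =
    besselCoeff ν n * (Real.Gamma (2 * m + 2 * n + 2) / ((2 * m + 1).factorial : ℝ)) *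
      realZeta (2 * m + 2 * n + 2) := by
  have h1 := Gamma_mul_Gamma_half (2 * m + 2 * n + 1)
  have h2 := Gamma_mul_Gamma_half (2 * m + 1)
  have e1 : (2 * (m : ℝ) + 2 * n + 1) / 2 + 1 / 2 = m + n + 1 := by ring
  have e2 : (2 * (m : ℝ) + 2 * n + 1) / 2 + 1 = m + n + 3 / 2 := by ring
  have e3 : (2 * (m : ℝ) + 1) / 2 + 1 / 2 = m + 1 := by ring
  have e4 : (2 * (m : ℝ) + 1) / 2 + 1 = m + 3 / 2 := by ring
  have e5 : (2 * (m : ℝ) + 2 * n + 1) + 1 = 2 * m + 2 * n + 2 := by ring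
  have e6 : (2 * (m : ℝ) + 1) + 1 = (2 * m + 1 : ℕ) + 1 := by push_cast; ring
  rw [e1, e2, e5] at h1
  rw [e3, e4, e6, Real.Gamma_nat_eq_factorial, Real.Gamma_nat_eq_factorial] at h2
  have e7 : (2 : ℝ) ^ (-(2 * (m : ℝ) + 2 * n + 1)) = 2 ^ (-(2 * (m : ℝ) + 1)) / 4 ^ n := by
    have h4 : (4 : ℝ) = 2 ^ (2 : ℝ) := by norm_num
    rw [← Real.rpow_natCast 4 n, h4, ← Real.rpow_mul two_pos.le, ← Real.rpow_sub two_pos]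
    ring_nf
  have hp : (0 : ℝ) < 2 ^ (-(2 * (m : ℝ) + 1)) := by positivity
  have hpi : 0 < √Real.pi := Real.sqrt_pos.2 Real.pi_pos
  have e8 : (n : ℝ) + 1 + ν = n + 1 + ν := rfl
  rw [coeffA, h1, e7, besselCoeff]
  congr 1
  have hm : (m.factorial : ℝ) * (n.factorial : ℝ) * Real.Gamma (m + 3 / 2) * Real.Gamma (n + 1 + ν) =
      ((2 * m + 1).factorial * 2 ^ (-(2 * (m : ℝ) + 1)) * √Real.pi) *
        ((n.factorial : ℝ) * Real.Gamma (n + 1 + ν)) := by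
    rw [← h2]; ring
  rw [hm]
  field_simp

theorem realZeta_one_sub {z : ℝ} (hz : ∀ n : ℕ, z ≠ -n) (hz1 : z ≠ 1) :
    realZeta (1 - z) =
      2 * (2 * Real.pi) ^ (-z) * Real.Gamma z * Real.cos (Real.pi * z / 2) * realZeta z := by
  have h := riemannZeta_one_sub (s := (z : ℂ)) (fun n hn => hz n (by exact_mod_cast hn))
    (by exact_mod_cast hz1)
  have hpi := Real.pi_pos
  have e1 : (2 * (Real.pi : ℂ)) ^ (-(z : ℂ)) = (((2 * Real.pi) ^ (-z) : ℝ) : ℂ) := by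
    rw [Complex.ofReal_cpow (by positivity)]
    push_cast
    rfl
  have e2 : Complex.cos ((Real.pi : ℂ) * z / 2) = ((Real.cos (Real.pi * z / 2) : ℝ) : ℂ) := by
    push_cast
    rfl
  rw [e1, e2, Complex.Gamma_ofReal] at h
  have e3 : (2 : ℂ) * (((2 * Real.pi) ^ (-z) : ℝ) : ℂ) * ((Real.Gamma z : ℝ) : ℂ) *
      ((Real.cos (Real.pi * z / 2) : ℝ) : ℂ) =
      ((2 * (2 * Real.pi) ^ (-z) * Real.Gamma z * Real.cos (Real.pi * z / 2) : ℝ) : ℂ) := by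
    push_cast
    rfl
  rw [e3] at h
  have h' := congrArg Complex.re h
  rw [Complex.re_ofReal_mul] at h'
  rw [realZeta, realZeta, ← h']
  push_cast
  rfl

/-- The terms of the real form of `zetaSeries`. -/
def zetaTerm (μ b z : ℝ) (n : ℕ) : ℝ := besselCoeff μ n * b ^ (2 * n) * realZeta (-z - 2 * n)

theorem hasSum_zetaTerm {μ b : ℝ} (hμ : ∀ n : ℕ, (n : ℝ) + 1 + μ ≠ 0) (hb : 0 < b)
    (hb2 : b < 2 * Real.pi) (z : ℝ) : HasSum (zetaTerm μ b z) (zetaSeries μ b z).re := by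
  refine hasSum_of_eq (Complex.hasSum_re (summable_zetaSeries hμ hb hb2 z).hasSum) (fun n => ?_) rfl
  rw [Complex.re_ofReal_mul, zetaTerm, realZeta]
  push_cast
  rfl

/-- The functional equation absorbs the gamma and sine factors, so that C'_m is a multiple of the
zeta series at m - 2ν. As 2ν is not an integer, the zeta argument avoids the pole and the
exceptional points of the equation. -/
theorem termC'_eq {ν b : ℝ} (hν2 : ∀ j : ℤ, 2 * ν ≠ j) (hb : 0 < b) (m n : ℕ) :
    termC' ν b m n = (-(2 * Real.pi) ^ (m + 1) / (2 * (m.factorial : ℝ)) * (b / 2) ^ (-(2 * ν))) *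
      zetaTerm (-ν) b (m - 2 * ν) n := by
  have hpi := Real.pi_pos
  have hfe := realZeta_one_sub (z := m + 2 * n + 1 - 2 * ν)
    (fun k hk => hν2 (m + 2 * n + 1 + k) (by push_cast; linarith))
    (fun h => hν2 (m + 2 * n) (by push_cast; linarith))
  have e1 : -((m : ℝ) - 2 * ν) - 2 * n = 1 - (m + 2 * n + 1 - 2 * ν) := by ring
  have hcos : Real.cos (Real.pi * ((m : ℝ) + 2 * n + 1 - 2 * ν) / 2) =
      -((-1) ^ n * Real.sin (Real.pi * (m / 2 - ν))) := by
    have : Real.pi * ((m : ℝ) + 2 * n + 1 - 2 * ν) / 2 =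
        Real.pi * (m / 2 - ν) + n * Real.pi + Real.pi / 2 := by ring
    rw [this, Real.cos_add_pi_div_two, Real.sin_add_nat_mul_pi]
  have e2 : (b / (2 * Real.pi)) ^ (2 * (n : ℝ) - 2 * ν) * 4 ^ ν =
      (2 * Real.pi) ^ (m + 1) * (2 * Real.pi) ^ (-((m : ℝ) + 2 * n + 1 - 2 * ν)) *
        ((b / 2) ^ (-(2 * ν)) * b ^ (2 * n)) := by
    have h4 : (4 : ℝ) = 2 ^ (2 : ℝ) := by norm_num
    have h5 : b ^ (2 * n) = b ^ (2 * (n : ℝ)) := by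
      rw [← Real.rpow_natCast]; push_cast; rfl
    have h6 : (2 * Real.pi) ^ (m + 1) = (2 * Real.pi) ^ ((m : ℝ) + 1) := by
      rw [← Real.rpow_natCast]; push_cast; rfl
    rw [h4, ← Real.rpow_mul two_pos.le, h5, h6, ← Real.rpow_add (by positivity),
      Real.div_rpow hb.le (by positivity), Real.div_rpow hb.le two_pos.le, sub_eq_add_neg,
      Real.rpow_add hb, div_eq_mul_inv, ← Real.rpow_neg (by positivity), div_eq_mul_inv,
      ← Real.rpow_neg two_pos.le, neg_neg]
    have e7 : (m : ℝ) + 1 + -((m : ℝ) + 2 * n + 1 - 2 * ν) = -(2 * (n : ℝ) + -(2 * ν)) := by ring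
    rw [e7]
    ring
  have hsq : ((-1 : ℝ) ^ n) * (-1) ^ n = 1 := by rw [← mul_pow]; norm_num
  rw [termC', coeffB_eq, zetaTerm, e1, hfe, hcos]
  set Z := realZeta (m + 2 * n + 1 - 2 * ν)
  set S := Real.sin (Real.pi * (m / 2 - ν))
  set G := Real.Gamma (m + 2 * n + 1 - 2 * ν)
  calc _ = ((b / (2 * Real.pi)) ^ (2 * (n : ℝ) - 2 * ν) * 4 ^ ν) *
        ((-1) ^ n * besselCoeff (-ν) n * (G / (m.factorial : ℝ)) * (Z * S)) := by ring
    _ = _ := by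
      rw [e2]
      field_simp

theorem termC_eq {ν b : ℝ} (hb : 0 < b) (m n : ℕ) :
    termC ν b m n = ((-1) ^ (m + 1) * (2 * Real.pi) ^ (2 * m + 2) /
      (2 * ((2 * m + 1).factorial : ℝ))) * zetaTerm ν b ((2 * m + 1 : ℕ) : ℝ) n := by
  have hpi := Real.pi_pos
  have hm : (0 : ℝ) ≤ m := Nat.cast_nonneg m
  have hn : (0 : ℝ) ≤ n := Nat.cast_nonneg n
  have hfe := realZeta_one_sub (z := 2 * m + 2 * n + 2)
    (fun k hk => by linarith [(Nat.cast_nonneg k : (0 : ℝ) ≤ k)]) (by linarith)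
  have e1 : -((2 * m + 1 : ℕ) : ℝ) - 2 * n = 1 - (2 * m + 2 * n + 2) := by push_cast; ring
  have hcos : Real.cos (Real.pi * (2 * (m : ℝ) + 2 * n + 2) / 2) = (-1) ^ (m + n + 1) := by
    have : Real.pi * (2 * (m : ℝ) + 2 * n + 2) / 2 = ((m + n + 1 : ℕ) : ℝ) * Real.pi := by
      push_cast; ring
    rw [this, Real.cos_nat_mul_pi]
  have e2 : (b / (2 * Real.pi)) ^ (2 * n) =
      (2 * Real.pi) ^ (2 * m + 2) * (2 * Real.pi) ^ (-(2 * (m : ℝ) + 2 * n + 2)) * b ^ (2 * n) := by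
    have h6 : (2 * Real.pi) ^ (-(2 * (m : ℝ) + 2 * n + 2)) =
        ((2 * Real.pi) ^ (2 * m + 2) * (2 * Real.pi) ^ (2 * n))⁻¹ := by
      rw [← pow_add, Real.rpow_neg (by positivity), ← Real.rpow_natCast]
      push_cast
      ring_nf
    rw [h6, div_pow]
    field_simp
  have hsq : ((-1 : ℝ) ^ (m + 1)) * (-1) ^ (m + n + 1) = (-1) ^ n := by
    rw [← pow_add]
    have : m + 1 + (m + n + 1) = 2 * (m + 1) + n := by ring
    rw [this, pow_add, pow_mul]
    norm_num
  rw [termC, coeffA_eq, zetaTerm, e1, hfe, hcos, e2, ← hsq]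
  field_simp

/-! ### Moments of integer order and the sum of their Mellin parts. -/

/-- The terms of the expansion of `∑ N ^ m (bN/2)^(-ν) K_ν(bN)` that come from its Mellin
transform. -/
def mellinTerm (ν b : ℝ) (m : ℕ) : ℝ := (b ^ (m + 1))⁻¹ *
  (2 ^ ((m : ℝ) - 1) * Real.Gamma ((m + 1) / 2) * Real.Gamma ((m + 1) / 2 - ν))

/-- Poisson summation alone does not reach m ≤ 2ν, hence the continuation. A natural number m avoids
the second excluded sequence because 2ν is not an integer. -/
theorem tsum_pow_mul_besselF {ν b : ℝ} (hν : 0 < ν) (hν2 : ∀ j : ℤ, 2 * ν ≠ j) (hb : 0 < b)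
    (hb2 : b < 2 * Real.pi) (m : ℕ) :
    ∑' N : ℕ, ((N : ℝ) + 1) ^ m * besselF ν (b * (N + 1)) = mellinTerm ν b m +
      Real.pi / (2 * Real.sin (Real.pi * ν)) *
        ((b / 2) ^ (-(2 * ν)) * (zetaSeries (-ν) b ((m - 2 * ν : ℝ) : ℂ)).re -
          (zetaSeries ν b ((m : ℝ) : ℂ)).re) := by
  have hint : ∀ j : ℤ, ν ≠ j := fun j hj => hν2 (2 * j) (by push_cast; rw [hj])
  have h := besselDirichlet_eq hν hint hb hb2 (z := (m : ℂ)) (fun n hn => by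
      have := congrArg Complex.re hn
      simp at this
      linarith [(Nat.cast_nonneg n : (0 : ℝ) ≤ n), (Nat.cast_nonneg m : (0 : ℝ) ≤ m)])
    (fun n hn => by
      have := congrArg Complex.re hn
      simp at this
      exact hν2 (m + 1 + n) (by push_cast; linarith))
  have hL : besselDirichlet ν b (m : ℂ) =
      ((∑' N : ℕ, ((N : ℝ) + 1) ^ m * besselF ν (b * (N + 1)) : ℝ) : ℂ) := by
    rw [besselDirichlet, Complex.ofReal_tsum]
    refine tsum_congr fun N => ?_
    rw [Complex.cpow_natCast]
    push_cast
    ring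
  have hR : (b : ℂ) ^ (-(m : ℂ) - 1) * ((2 : ℂ) ^ ((m : ℂ) - 1) * Complex.Gamma (((m : ℂ) + 1) / 2) *
    Complex.Gamma (((m : ℂ) + 1) / 2 - ν)) = ((mellinTerm ν b m : ℝ) : ℂ) := by
    have e1 : -(m : ℂ) - 1 = ((-((m + 1 : ℕ) : ℝ) : ℝ) : ℂ) := by push_cast; ring
    have e2 : (m : ℂ) - 1 = ((m - 1 : ℝ) : ℂ) := by push_cast; rfl
    have e3 : ((m : ℂ) + 1) / 2 = (((m + 1) / 2 : ℝ) : ℂ) := by push_cast; rfl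
    have e4 : (2 : ℂ) = ((2 : ℝ) : ℂ) := by norm_num
    have e5 : b ^ (-((m + 1 : ℕ) : ℝ)) = (b ^ (m + 1))⁻¹ := by
      rw [Real.rpow_neg hb.le, Real.rpow_natCast]
    rw [e3, ← Complex.ofReal_sub, Complex.Gamma_ofReal, Complex.Gamma_ofReal, e1, e2, e4,
      ← Complex.ofReal_cpow hb.le, ← Complex.ofReal_cpow two_pos.le, e5, mellinTerm]
    push_cast
    rfl
  rw [hL, dirichletClosed, hR] at h
  have h' := congrArg Complex.re h
  rw [Complex.ofReal_re, Complex.add_re, Complex.ofReal_re, Complex.re_ofReal_mul, Complex.sub_re,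
    Complex.re_ofReal_mul] at h'
  rw [h']
  push_cast
  rfl

theorem Gamma_mul_ascPochhammer {s : ℝ} (hs : ∀ n : ℕ, s + n ≠ 0) (n : ℕ) :
    Real.Gamma s * (ascPochhammer ℝ n).eval s = Real.Gamma (s + n) := by
  induction n with
  | zero => simp
  | succ n ih =>
    rw [ascPochhammer_succ_eval, ← mul_assoc, ih]
    push_cast
    rw [← add_assoc, Real.Gamma_add_one (hs n), mul_comm]

theorem ascPochhammer_three_halves (n : ℕ) :
    (ascPochhammer ℝ n).eval (3 / 2) = ((2 * n + 1).factorial : ℝ) / (4 ^ n * (n.factorial : ℝ)) := by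
  induction n with
  | zero => simp
  | succ n ih =>
    have e : 2 * (n + 1) + 1 = (2 * n + 1) + 1 + 1 := by ring
    rw [ascPochhammer_succ_eval, ih, e, Nat.factorial_succ (2 * n + 1 + 1),
      Nat.factorial_succ (2 * n + 1), Nat.factorial_succ n]
    push_cast
    field_simp
    ring

theorem ring_choose_eq_ascPochhammer (s : ℝ) (n : ℕ) :
    Ring.choose (s + n - 1) n = (ascPochhammer ℝ n).eval s / (n.factorial : ℝ) := by
  have h : Ring.choose (s + n - 1) n = Ring.multichoose s n := by
    rw [Ring.choose]
    congr 1
    ring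
  have h2 := Ring.factorial_nsmul_multichoose_eq_ascPochhammer s n
  rw [nsmul_eq_mul, Polynomial.ascPochhammer_smeval_eq_eval] at h2
  rw [h, eq_div_iff (by positivity), mul_comm, h2]

theorem hasSum_Gamma_binomial {s x : ℝ} (hs : ∀ n : ℕ, s + n ≠ 0) (hx : |x| < 1) :
    HasSum (fun n : ℕ => Real.Gamma (s + n) / (n.factorial : ℝ) * x ^ n)
      (Real.Gamma s * (1 - x) ^ (-s)) := by
  have h := (Real.one_div_one_sub_rpow_hasFPowerSeriesOnBall_zero s).hasSum (y := x) (by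
    rw [Metric.mem_eball, edist_zero_right, enorm_eq_nnnorm]
    exact_mod_cast hx)
  have hx1 : 0 ≤ 1 - x := by linarith [(abs_lt.1 hx).2]
  refine hasSum_of_eq (h.mul_left (Real.Gamma s)) (fun n => ?_) ?_
  · rw [FormalMultilinearSeries.ofScalars_apply_eq, ring_choose_eq_ascPochhammer,
      ← Gamma_mul_ascPochhammer hs, smul_eq_mul]
    ring
  · rw [zero_add, Real.rpow_neg hx1, one_div]

/-- The coefficients of `₂F₁(1, 1-ν; 3/2; x)`. -/
def hyperCoeff (ν : ℝ) (n : ℕ) : ℝ :=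
  (ascPochhammer ℝ n).eval (1 - ν) / (ascPochhammer ℝ n).eval (3 / 2)

theorem hyperCoeff_eq (ν : ℝ) (n : ℕ) : ((n.factorial : ℝ))⁻¹ * (ascPochhammer ℝ n).eval 1 *
    (ascPochhammer ℝ n).eval (1 - ν) * ((ascPochhammer ℝ n).eval (3 / 2))⁻¹ = hyperCoeff ν n := by
  rw [ascPochhammer_eval_one, hyperCoeff]
  have : (n.factorial : ℝ) ≠ 0 := by positivity
  field_simp

theorem ordinaryHypergeometric_eq (ν x : ℝ) :
    ordinaryHypergeometric (1 : ℝ) (1 - ν) (3 / 2) x = ∑' n : ℕ, hyperCoeff ν n * x ^ n := by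
  rw [ordinaryHypergeometric_eq_tsum]
  exact tsum_congr fun n => by rw [hyperCoeff_eq, smul_eq_mul]

theorem summable_hyperCoeff {ν x : ℝ} (hint : ∀ j : ℤ, ν ≠ j) (hx : |x| < 1) :
    Summable fun n : ℕ => hyperCoeff ν n * x ^ n := by
  have hr := ordinaryHypergeometricSeries_radius_eq_one ℝ (1 : ℝ) (1 - ν) (3 / 2) (fun n => by
    have hn : (0 : ℝ) ≤ n := Nat.cast_nonneg n
    refine ⟨?_, ?_, ?_⟩
    · linarith
    · intro h
      exact hint (n + 1) (by push_cast; linarith)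
    · linarith)
  have h := (ordinaryHypergeometricSeries ℝ (1 : ℝ) (1 - ν) (3 / 2)).hasSum (x := x) (by
    rw [hr, Metric.mem_eball, edist_zero_right, enorm_eq_nnnorm]
    exact_mod_cast hx)
  refine h.summable.congr fun n => ?_
  rw [ordinaryHypergeometricSeries_apply_eq, hyperCoeff_eq, smul_eq_mul]

/-- For even order the duplication formula cancels the factorial (2j)! and leaves the binomial
series of exponent ν - 1/2. -/
theorem hasSum_mellinTerm_even {ν a b : ℝ} (hν2 : ∀ j : ℤ, 2 * ν ≠ j) (hb : 0 < b)
    (hx : |a ^ 2 / b ^ 2| < 1) :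
    HasSum (fun j : ℕ => (-a) ^ (2 * j) / ((2 * j).factorial : ℝ) * mellinTerm ν b (2 * j))
    (√Real.pi / (2 * b) * Real.Gamma (1 / 2 - ν) * (1 - a ^ 2 / b ^ 2) ^ (ν - 1 / 2)) := by
  have h := (hasSum_Gamma_binomial (s := 1 / 2 - ν) (fun n hn => hν2 (2 * n + 1) (by
    push_cast; linarith)) hx).mul_left (√Real.pi / (2 * b))
  rw [neg_sub, ← mul_assoc] at h
  refine hasSum_of_eq h (fun j => ?_) rfl
  have h1 := Gamma_mul_Gamma_half ((2 * j : ℕ) : ℝ)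
  have e1 : ((2 * j : ℕ) : ℝ) / 2 + 1 / 2 = (((2 * j : ℕ) : ℝ) + 1) / 2 := by ring
  have e2 : ((2 * j : ℕ) : ℝ) / 2 + 1 = j + 1 := by push_cast; ring
  have e3 : (((2 * j : ℕ) : ℝ) + 1) / 2 - ν = 1 / 2 - ν + j := by push_cast; ring
  rw [e1, e2, Real.Gamma_nat_eq_factorial, Real.Gamma_nat_eq_factorial] at h1
  have h2 : Real.Gamma ((((2 * j : ℕ) : ℝ) + 1) / 2) =
      ((2 * j).factorial : ℝ) * 2 ^ (-((2 * j : ℕ) : ℝ)) * √Real.pi / (j.factorial : ℝ) := by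
    rw [eq_div_iff (by positivity), h1]
  have e4 : (2 : ℝ) ^ (((2 * j : ℕ) : ℝ) - 1) * 2 ^ (-((2 * j : ℕ) : ℝ)) = 1 / 2 := by
    rw [← Real.rpow_add two_pos]
    have : ((2 * j : ℕ) : ℝ) - 1 + -((2 * j : ℕ) : ℝ) = -1 := by ring
    rw [this, Real.rpow_neg_one]
    norm_num
  rw [mellinTerm, h2, e3, (even_two_mul j).neg_pow, div_pow, ← pow_mul, ← pow_mul]
  calc _ = ((2 : ℝ) ^ (((2 * j : ℕ) : ℝ) - 1) * 2 ^ (-((2 * j : ℕ) : ℝ))) *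
        (((2 * j).factorial : ℝ) * (((2 * j).factorial : ℝ))⁻¹) *
        (a ^ (2 * j) * (b ^ (2 * j + 1))⁻¹ * √Real.pi / (j.factorial : ℝ) *
          Real.Gamma (1 / 2 - ν + j)) := by ring
    _ = _ := by
      rw [e4, mul_inv_cancel₀ (by positivity), pow_succ]
      field_simp

/-- For odd order the factor Γ(j+1) = j! over (2j+1)! is 4^(-j)/(3/2)_j, which is the hypergeometric
denominator. -/
theorem hasSum_mellinTerm_odd {ν a b : ℝ} (hν2 : ∀ j : ℤ, 2 * ν ≠ j) (hb : 0 < b)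
    (hx : |a ^ 2 / b ^ 2| < 1) :
    HasSum (fun j : ℕ => (-a) ^ (2 * j + 1) / ((2 * j + 1).factorial : ℝ) *
    mellinTerm ν b (2 * j + 1))
    (-(a / b ^ 2 * Real.Gamma (1 - ν) *
      ordinaryHypergeometric (1 : ℝ) (1 - ν) (3 / 2) (a ^ 2 / b ^ 2))) := by
  have hint : ∀ j : ℤ, ν ≠ j := fun j hj => hν2 (2 * j) (by push_cast; rw [hj])
  have h := ((summable_hyperCoeff hint hx).hasSum.mul_left
    (a / b ^ 2 * Real.Gamma (1 - ν))).neg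
  rw [ordinaryHypergeometric_eq]
  refine hasSum_of_eq h (fun j => ?_) rfl
  have hG := Gamma_mul_ascPochhammer (s := 1 - ν) (fun n hn => hint (n + 1) (by
    push_cast; linarith)) j
  have e2 : (((2 * j + 1 : ℕ) : ℝ) + 1) / 2 = j + 1 := by push_cast; ring
  have e3 : (j : ℝ) + 1 - ν = 1 - ν + j := by ring
  have e4 : (2 : ℝ) ^ (((2 * j + 1 : ℕ) : ℝ) - 1) = 4 ^ j := by
    have : ((2 * j + 1 : ℕ) : ℝ) - 1 = ((2 * j : ℕ) : ℝ) := by push_cast; ring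
    rw [this, Real.rpow_natCast, pow_mul]
    norm_num
  rw [mellinTerm, e2, e3, Real.Gamma_nat_eq_factorial, ← hG, e4, hyperCoeff,
    ascPochhammer_three_halves, Odd.neg_pow ⟨j, rfl⟩, div_pow, ← pow_mul, ← pow_mul,
    pow_succ a, pow_succ b, pow_succ b]
  have : (j.factorial : ℝ) ≠ 0 := by positivity
  have : ((2 * j + 1).factorial : ℝ) ≠ 0 := by positivity
  field_simp

theorem hasSum_mellinTerm {ν a b : ℝ} (hν2 : ∀ j : ℤ, 2 * ν ≠ j) (hb : 0 < b) (ha : 0 ≤ a)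
    (hab : a < b) :
    HasSum (fun m : ℕ => (-a) ^ m / (m.factorial : ℝ) * mellinTerm ν b m) (leadingPair ν a b) := by
  have hx0 : 0 ≤ a ^ 2 / b ^ 2 := by positivity
  have hx : |a ^ 2 / b ^ 2| < 1 := by
    rw [abs_of_nonneg hx0, div_lt_one (by positivity)]
    gcongr
  rw [leadingPair, sub_eq_add_neg]
  exact HasSum.even_add_odd (f := fun m : ℕ => (-a) ^ m / (m.factorial : ℝ) * mellinTerm ν b m)
    (hasSum_mellinTerm_even hν2 hb hx) (hasSum_mellinTerm_odd hν2 hb hx)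

/-! ### The expansion for a < b. -/

theorem sumK_eq (ν a : ℝ) {b : ℝ} (hb : 0 < b) :
    (fun n : ℕ => summandK ν a b (n + 1)) =
      fun n : ℕ => Real.exp (-a * ((n : ℝ) + 1)) * besselF ν (b * (n + 1)) := by
  ext n
  rw [summandK_eq ν a hb n.succ_pos]
  push_cast
  rfl

theorem summable_exp_mul_besselF {ν a b : ℝ} (hν : 0 < ν) (hint : ∀ j : ℤ, ν ≠ j) (hb : 0 < b)
    (hab : a < b) :
    Summable fun n : ℕ => Real.exp (a * ((n : ℝ) + 1)) * besselF ν (b * (n + 1)) := by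
  -- The choice εb ≤ (b - a)/2 keeps the decay rate (1 - ε)b above a.
  obtain ⟨ε, hε0, hε1, hε⟩ : ∃ ε : ℝ, 0 < ε ∧ ε < 1 ∧ a < (1 - ε) * b := by
    refine ⟨min (1 / 2) ((b - a) / (2 * b)), lt_min (by norm_num) (by
      have : 0 < b - a := by linarith
      positivity), (min_le_left _ _).trans_lt (by norm_num), ?_⟩
    have h1 := min_le_right (1 / 2) ((b - a) / (2 * b))
    have h2 : min (1 / 2) ((b - a) / (2 * b)) * b ≤ (b - a) / (2 * b) * b := by gcongr
    have h3 : (b - a) / (2 * b) * b = (b - a) / 2 := by field_simp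
    nlinarith
  set C := 1 / 2 * (ε / 4) ^ (-ν) * Real.Gamma ν * b ^ (-(2 * ν)) with hC
  have hG := Real.Gamma_pos_of_pos hν
  have hgeo : Summable fun n : ℕ => C * Real.exp (a - (1 - ε) * b) ^ (n + 1) := by
    refine Summable.mul_left _ ((summable_nat_add_iff 1).2 (summable_geometric_of_lt_one
      (Real.exp_pos _).le (by
        have h0 := Real.exp_lt_exp.2 (show a - (1 - ε) * b < 0 by linarith)
        rwa [Real.exp_zero] at h0)))
  refine Summable.of_nonneg_of_le (fun n => ?_) (fun n => ?_) hgeo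
  · have := besselF_nonneg hν hint (x := b * (n + 1)) (by positivity)
    positivity
  · have hn : (1 : ℝ) ≤ (n : ℝ) + 1 := by linarith [(Nat.cast_nonneg n : (0 : ℝ) ≤ n)]
    have hn0 : (0 : ℝ) < (n : ℝ) + 1 := by linarith
    have h := besselF_le hν hint (x := b * (n + 1)) (by positivity) hε0 hε1
    have h1 : (b * ((n : ℝ) + 1)) ^ (-(2 * ν)) ≤ b ^ (-(2 * ν)) :=
      Real.rpow_le_rpow_of_nonpos hb (by nlinarith) (by linarith)
    calc _ ≤ Real.exp (a * ((n : ℝ) + 1)) * (1 / 2 * (ε / 4) ^ (-ν) * Real.Gamma ν *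
          b ^ (-(2 * ν)) * Real.exp (-((1 - ε) * (b * (n + 1))))) := by
          refine mul_le_mul_of_nonneg_left (h.trans ?_) (Real.exp_pos _).le
          gcongr
      _ = C * (Real.exp (a * ((n : ℝ) + 1)) * Real.exp (-((1 - ε) * (b * (n + 1))))) := by
          rw [hC]; ring
      _ = _ := by
          rw [← Real.exp_add, ← Real.exp_nat_mul]
          push_cast
          ring_nf

/-- The double series over N and m is absolutely summable because ∑ e^{aN} F(bN) is finite. This is
where a < b is essential. -/
theorem hasSum_sumK_moments {ν a b : ℝ} (hν : 0 < ν) (hint : ∀ j : ℤ, ν ≠ j) (hb : 0 < b)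
    (ha : 0 ≤ a) (hab : a < b) :
    HasSum (fun m : ℕ => (-a) ^ m / (m.factorial : ℝ) *
      ∑' N : ℕ, ((N : ℝ) + 1) ^ m * besselF ν (b * (N + 1))) (sumK ν a b) := by
  set F : ℕ → ℝ := fun N => besselF ν (b * (N + 1)) with hF
  have hF0 : ∀ N, 0 ≤ F N := fun N => besselF_nonneg hν hint (by positivity)
  set T : ℕ × ℕ → ℝ := fun p => (-a * ((p.1 : ℝ) + 1)) ^ p.2 / (p.2.factorial : ℝ) * F p.1 with hT
  have hTs : Summable T := by
    refine Summable.of_norm ?_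
    have hn : ∀ p, ‖T p‖ = (a * ((p.1 : ℝ) + 1)) ^ p.2 / (p.2.factorial : ℝ) * F p.1 := by
      intro p
      have h1 : |(p.1 : ℝ) + 1| = p.1 + 1 := abs_of_pos (by positivity)
      rw [hT]
      simp only [norm_mul, norm_div, norm_pow, norm_neg, Real.norm_eq_abs, abs_of_nonneg ha,
        Nat.abs_cast, abs_of_nonneg (hF0 _), h1]
    rw [summable_prod_of_nonneg fun p => norm_nonneg _]
    have hr : ∀ N : ℕ, HasSum (fun m => ‖T (N, m)‖) (Real.exp (a * ((N : ℝ) + 1)) * F N) :=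
      fun N => hasSum_of_eq ((hasSum_real_exp (a * ((N : ℝ) + 1))).mul_right (F N))
        (fun m => hn (N, m)) rfl
    exact ⟨fun N => (hr N).summable,
      (summable_exp_mul_besselF hν hint hb hab).congr fun N => (hr N).tsum_eq.symm⟩
  have h1 : ∑' p, T p = sumK ν a b := by
    rw [hTs.tsum_prod, sumK, sumK_eq ν a hb]
    refine tsum_congr fun N => ?_
    exact ((hasSum_real_exp (-a * ((N : ℝ) + 1))).mul_right (F N)).tsum_eq
  have h2 : HasSum (T ∘ Prod.swap) (sumK ν a b) := by
    rw [← h1]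
    exact (Equiv.prodComm ℕ ℕ).hasSum_iff.2 hTs.hasSum
  refine h2.prod_fiberwise fun m => ?_
  refine hasSum_of_eq ((h2.summable.prod_factor m).hasSum) (fun N => rfl) ?_
  rw [← tsum_mul_left]
  refine tsum_congr fun N => ?_
  simp only [Function.comp, Prod.swap, hT, mul_pow]
  ring

theorem realZeta_neg_two_mul_succ (n : ℕ) : realZeta (-(2 * ((n + 1 : ℕ) : ℝ))) = 0 := by
  have h := riemannZeta_neg_two_mul_nat_add_one n
  rw [realZeta]
  push_cast
  rw [neg_mul] at h
  rw [h, Complex.zero_re]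

/-- At even exponents all zeta values sit at trivial zeros, except ζ(0) = -1/2 when j = n = 0. This
is the origin of the cosecant term, and the reason why C enters D only at odd index. -/
theorem zetaSeries_even {ν b : ℝ} (hint : ∀ j : ℤ, ν ≠ j) (hb : 0 < b) (hb2 : b < 2 * Real.pi)
    (j : ℕ) : (zetaSeries ν b (((2 * j : ℕ) : ℝ) : ℂ)).re =
      if j = 0 then -(1 / (2 * Real.Gamma (1 + ν))) else 0 := by
  rw [← (hasSum_zetaTerm (add_ne_zero_of_int hint) hb hb2 _).tsum_eq]
  have hz : ∀ n, 0 < j + n → zetaTerm ν b ((2 * j : ℕ) : ℝ) n = 0 := by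
    intro n hn
    obtain ⟨k, hk⟩ := Nat.exists_eq_succ_of_ne_zero hn.ne'
    have e : -((2 * j : ℕ) : ℝ) - 2 * n = -(2 * ((k + 1 : ℕ) : ℝ)) := by
      have : ((j + n : ℕ) : ℝ) = ((k + 1 : ℕ) : ℝ) := by rw [hk]
      push_cast at this ⊢
      linarith
    rw [zetaTerm, e, realZeta_neg_two_mul_succ, mul_zero]
  split_ifs with hj
  · subst hj
    rw [tsum_eq_single 0 fun n hn => hz n (by omega), zetaTerm, besselCoeff]
    simp only [mul_zero, Nat.cast_zero, neg_zero, sub_zero, pow_zero, Nat.factorial_zero,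
      Nat.cast_one, one_mul, zero_add, mul_one, realZeta, Complex.ofReal_zero, riemannZeta_zero]
    norm_num
  · rw [tsum_congr fun n => hz n (by omega), tsum_zero]

theorem coeffC'_eq {ν b : ℝ} (hν2 : ∀ j : ℤ, 2 * ν ≠ j) (hb : 0 < b) (hb2 : b < 2 * Real.pi)
    (k : ℕ) : Summable (termC' ν b k) ∧ coeffC' ν b k =
      (-(2 * Real.pi) ^ (k + 1) / (2 * (k.factorial : ℝ)) * (b / 2) ^ (-(2 * ν))) *
        (zetaSeries (-ν) b ((k - 2 * ν : ℝ) : ℂ)).re := by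
  have hint : ∀ j : ℤ, ν ≠ j := fun j hj => hν2 (2 * j) (by push_cast; rw [hj])
  have h := hasSum_of_eq ((hasSum_zetaTerm (add_neg_ne_zero hint) hb hb2 (k - 2 * ν)).mul_left
    (-(2 * Real.pi) ^ (k + 1) / (2 * (k.factorial : ℝ)) * (b / 2) ^ (-(2 * ν))))
    (fun n => termC'_eq hν2 hb k n) rfl
  exact ⟨h.summable, h.tsum_eq⟩

theorem coeffC_eq {ν b : ℝ} (hint : ∀ j : ℤ, ν ≠ j) (hb : 0 < b) (hb2 : b < 2 * Real.pi)
    (k : ℕ) : Summable (termC ν b k) ∧ coeffC ν b k =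
      ((-1) ^ (k + 1) * (2 * Real.pi) ^ (2 * k + 2) / (2 * ((2 * k + 1).factorial : ℝ))) *
        (zetaSeries ν b (((2 * k + 1 : ℕ) : ℝ) : ℂ)).re := by
  have h := hasSum_of_eq ((hasSum_zetaTerm (add_ne_zero_of_int hint) hb hb2
    ((2 * k + 1 : ℕ) : ℝ)).mul_left
    ((-1) ^ (k + 1) * (2 * Real.pi) ^ (2 * k + 2) / (2 * ((2 * k + 1).factorial : ℝ))))
    (fun n => termC_eq hb k n) rfl
  exact ⟨h.summable, h.tsum_eq⟩

theorem zeta_part_eq {ν a b : ℝ} (hν2 : ∀ j : ℤ, 2 * ν ≠ j) (hb : 0 < b)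
    (hb2 : b < 2 * Real.pi) (k : ℕ) :
    (-a) ^ k / (k.factorial : ℝ) * (Real.pi / (2 * Real.sin (Real.pi * ν)) *
        ((b / 2) ^ (-(2 * ν)) * (zetaSeries (-ν) b ((k - 2 * ν : ℝ) : ℂ)).re -
          (zetaSeries ν b ((k : ℝ) : ℂ)).re)) =
      -(1 / (2 * Real.sin (Real.pi * ν))) * ((-1) ^ k * coeffD ν b k * (a / (2 * Real.pi)) ^ k) +
        if k = 0 then Real.pi * (1 / Real.sin (Real.pi * ν)) / (4 * Real.Gamma (1 + ν)) else 0 := by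
  have hint : ∀ j : ℤ, ν ≠ j := fun j hj => hν2 (2 * j) (by push_cast; rw [hj])
  have hpi := Real.pi_pos
  have hs := sin_pi_mul_ne_zero hint
  have hk : (k.factorial : ℝ) ≠ 0 := by positivity
  rcases Nat.even_or_odd' k with ⟨j, rfl | rfl⟩
  · rw [zetaSeries_even hint hb hb2, coeffD, if_pos (even_two_mul j), (coeffC'_eq hν2 hb hb2 _).2,
      neg_pow a]
    rcases Nat.eq_zero_or_pos j with h0 | h0
    · subst h0
      simp only [mul_zero, if_true, pow_zero, Nat.factorial_zero, Nat.cast_one, zero_add, pow_one]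
      field_simp
      ring
    · rw [if_neg (by omega), if_neg (by omega), sub_zero, add_zero, div_pow, pow_succ]
      field_simp
  · have h1 : ¬ Even (2 * j + 1) := by simp
    have h2 : (2 * j + 1) / 2 = j := by omega
    rw [coeffD, if_neg h1, h2, (coeffC'_eq hν2 hb hb2 _).2, (coeffC_eq hint hb hb2 _).2, neg_pow a,
      if_neg (by omega), add_zero, div_pow]
    have h3 : ((-1 : ℝ) ^ (j + 1)) * (-1) ^ (j + 1) = 1 := by rw [← mul_pow]; norm_num
    have h4 : (2 * Real.pi) ^ (2 * j + 1 + 1) = (2 * Real.pi) ^ (2 * j + 2) := rfl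
    rw [h4]
    set Z1 := (zetaSeries (-ν) b (((2 * j + 1 : ℕ) - 2 * ν : ℝ) : ℂ)).re
    set Z2 := (zetaSeries ν b (((2 * j + 1 : ℕ) : ℝ) : ℂ)).re
    have e : (-1 : ℝ) ^ (j + 1) * ((-1) ^ (j + 1) * (2 * Real.pi) ^ (2 * j + 2) /
        (2 * ((2 * j + 1).factorial : ℝ)) * Z2) =
        (2 * Real.pi) ^ (2 * j + 2) / (2 * ((2 * j + 1).factorial : ℝ)) * Z2 := by
      calc _ = ((-1 : ℝ) ^ (j + 1) * (-1) ^ (j + 1)) * ((2 * Real.pi) ^ (2 * j + 2) /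
        (2 * ((2 * j + 1).factorial : ℝ)) * Z2) := by ring
        _ = _ := by rw [h3, one_mul]
    rw [e, pow_succ (2 * Real.pi) (2 * j + 1)]
    field_simp
    ring

/-- Each moment is a Mellin term plus a zeta part, so the D-series is a difference of convergent
series; its convergence needs no separate argument here. -/
theorem hasSum_coeffD_of_lt {ν a b : ℝ} (hν : 0 < ν) (hν2 : ∀ j : ℤ, 2 * ν ≠ j) (ha : 0 ≤ a)
    (hab : a < b) (hb2 : b < 2 * Real.pi) :
    HasSum (fun k : ℕ => (-1) ^ k * coeffD ν b k * (a / (2 * Real.pi)) ^ k)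
      (2 * Real.sin (Real.pi * ν) * (leadingPair ν a b +
        Real.pi * (1 / Real.sin (Real.pi * ν)) / (4 * Real.Gamma (1 + ν)) - sumK ν a b)) := by
  have hint : ∀ j : ℤ, ν ≠ j := fun j hj => hν2 (2 * j) (by push_cast; rw [hj])
  have hb : 0 < b := ha.trans_lt hab
  have hs := sin_pi_mul_ne_zero hint
  have h1 := hasSum_sumK_moments hν hint hb ha hab
  have h2 := hasSum_mellinTerm hν2 hb ha hab
  have h3 := hasSum_ite_eq 0 (Real.pi * (1 / Real.sin (Real.pi * ν)) / (4 * Real.Gamma (1 + ν)))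
  refine hasSum_of_eq (((h2.add h3).sub h1).mul_left (2 * Real.sin (Real.pi * ν))) (fun k => ?_) rfl
  have h4 := zeta_part_eq (a := a) hν2 hb hb2 k
  rw [tsum_pow_mul_besselF hν hν2 hb hb2, mul_add ((-a) ^ k / (k.factorial : ℝ)), h4]
  field_simp
  ring

/-! ### Polynomial growth of the oscillating Bessel series. -/

/-- `∑ₙ (-1)ⁿ x^(2n) / (4ⁿ n! Γ(n+1+μ)) = (x/2)^(-μ) J_μ(x)`. -/
def besselH (μ x : ℝ) : ℝ := ∑' n : ℕ, (-1) ^ n * besselCoeff μ n * x ^ (2 * n)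

theorem summable_besselH {μ : ℝ} (hμ : ∀ n : ℕ, (n : ℝ) + 1 + μ ≠ 0) (x : ℝ) :
    Summable fun n : ℕ => (-1) ^ n * besselCoeff μ n * x ^ (2 * n) := by
  refine Summable.of_norm ((summable_besselE hμ x).norm.congr fun n => ?_)
  rw [norm_mul, norm_mul, norm_mul, norm_pow (-1 : ℝ), norm_neg, norm_one, one_pow, one_mul]

theorem add_one_ne_zero_of_order {μ : ℝ} (hμ : ∀ n : ℕ, (n : ℝ) + 1 + μ ≠ 0) (n : ℕ) :
    (n : ℝ) + 1 + (μ + 1) ≠ 0 := by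
  have := hμ (n + 1)
  push_cast at this
  rwa [← add_assoc, add_right_comm]

theorem mul_besselCoeff_succ (μ : ℝ) (n : ℕ) :
    2 * ((n + 1 : ℕ) : ℝ) * besselCoeff μ (n + 1) = 1 / 2 * besselCoeff (μ + 1) n := by
  have h : ((n + 1 : ℕ) : ℝ) + 1 + μ = n + 1 + (μ + 1) := by push_cast; ring
  rw [besselCoeff, besselCoeff, h, Nat.factorial_succ, pow_succ]
  have : (((n + 1 : ℕ) : ℝ)) ≠ 0 := by positivity
  push_cast at this ⊢
  rw [show (4 : ℝ) ^ n * 4 * (((n : ℝ) + 1) * (n.factorial : ℝ)) * Real.Gamma (n + 1 + (μ + 1)) =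
    (4 * ((n : ℝ) + 1)) * (4 ^ n * (n.factorial : ℝ) * Real.Gamma (n + 1 + (μ + 1))) by ring,
    ← div_div 1 (4 * ((n : ℝ) + 1))]
  field_simp
  norm_num

theorem mul_besselCoeff_add_one {μ : ℝ} (hμ : ∀ n : ℕ, (n : ℝ) + 1 + μ ≠ 0) (n : ℕ) :
    (n + 1 + μ) * besselCoeff (μ + 1) n = besselCoeff μ n := by
  have h : (n : ℝ) + 1 + (μ + 1) = (n + 1 + μ) + 1 := by ring
  rw [besselCoeff, besselCoeff, h, Real.Gamma_add_one (hμ n)]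
  have := hμ n
  rw [show (4 : ℝ) ^ n * (n.factorial : ℝ) * ((n + 1 + μ) * Real.Gamma (n + 1 + μ)) =
    (n + 1 + μ) * (4 ^ n * (n.factorial : ℝ) * Real.Gamma (n + 1 + μ)) by ring, ← div_div]
  field_simp

theorem hasDerivAt_besselH {μ : ℝ} (hμ : ∀ n : ℕ, (n : ℝ) + 1 + μ ≠ 0) (x : ℝ) :
    HasDerivAt (besselH μ) (-(x / 2) * besselH (μ + 1) x) x := by
  have hμ1 := add_one_ne_zero_of_order hμ
  set R : ℝ := |x| + 1 with hR
  have hR0 : 0 < R := by positivity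
  -- At n = 0 the truncated exponent 2n - 1 is 0, but the factor 2n kills the term.
  set u : ℕ → ℝ := fun n => 2 * (n : ℝ) * |besselCoeff μ n| * R ^ (2 * n - 1) with hu
  have hus : Summable u := by
    rw [← summable_nat_add_iff 1]
    obtain ⟨C, -, h⟩ := exists_summable_abs_besselCoeff_le hμ1 one_lt_two
    refine ((h R hR0.le).1.mul_left (R / 2)).congr fun n => ?_
    have h1 := congrArg abs (mul_besselCoeff_succ μ n)
    rw [abs_mul, abs_mul (1 / 2), abs_of_nonneg (by positivity : (0 : ℝ) ≤ 2 * ((n + 1 : ℕ) : ℝ)),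
      abs_of_pos (by norm_num : (0 : ℝ) < 1 / 2)] at h1
    have e : 2 * (n + 1) - 1 = 2 * n + 1 := by omega
    simp only [hu]
    rw [h1, e, pow_succ]
    ring
  have hder : ∀ (n : ℕ) (y : ℝ), HasDerivAt (fun z : ℝ => (-1) ^ n * besselCoeff μ n * z ^ (2 * n))
      ((-1) ^ n * besselCoeff μ n * (((2 * n : ℕ) : ℝ) * y ^ (2 * n - 1))) y := fun n y =>
    (hasDerivAt_pow (2 * n) y).const_mul _
  have hx : x ∈ Ioo (-R) R := by
    rw [mem_Ioo]
    have h1 := neg_abs_le x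
    have h2 := le_abs_self x
    constructor <;> linarith
  have hbd : ∀ (n : ℕ) (y : ℝ), y ∈ Ioo (-R) R →
      ‖(-1) ^ n * besselCoeff μ n * (((2 * n : ℕ) : ℝ) * y ^ (2 * n - 1))‖ ≤ u n := by
    intro n y hy
    rw [norm_mul, norm_mul, norm_mul, norm_pow, norm_neg, norm_one, one_pow, one_mul, norm_pow,
      Real.norm_eq_abs, Real.norm_eq_abs, Real.norm_eq_abs, Nat.abs_cast]
    have h1 : |y| ≤ R := (abs_lt.2 hy).le
    calc _ ≤ |besselCoeff μ n| * (((2 * n : ℕ) : ℝ) * R ^ (2 * n - 1)) := by gcongr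
      _ = _ := by simp only [hu]; push_cast; ring
  have h := hasDerivAt_tsum_of_isPreconnected hus isOpen_Ioo isPreconnected_Ioo
    (fun n y _ => hder n y) hbd hx (summable_besselH hμ x) hx
  have hs : Summable fun n : ℕ =>
      (-1) ^ n * besselCoeff μ n * (((2 * n : ℕ) : ℝ) * x ^ (2 * n - 1)) :=
    Summable.of_norm_bounded hus fun n => hbd n x hx
  have e : ∑' n : ℕ, (-1) ^ n * besselCoeff μ n * (((2 * n : ℕ) : ℝ) * x ^ (2 * n - 1)) =
      -(x / 2) * besselH (μ + 1) x := by
    rw [hs.tsum_eq_zero_add, besselH, ← tsum_mul_left]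
    simp only [mul_zero, Nat.cast_zero, zero_mul, zero_add]
    refine tsum_congr fun n => ?_
    have h1 := mul_besselCoeff_succ μ n
    have e2 : 2 * (n + 1) - 1 = 2 * n + 1 := by omega
    rw [e2]
    calc _ = (-1) ^ (n + 1) * (2 * ((n + 1 : ℕ) : ℝ) * besselCoeff μ (n + 1)) * x ^ (2 * n + 1) := by
          push_cast; ring
      _ = _ := by rw [h1]; ring
  rw [e] at h
  exact h

theorem besselH_recurrence {μ : ℝ} (hμ : ∀ n : ℕ, (n : ℝ) + 1 + μ ≠ 0) (x : ℝ) :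
    x ^ 2 / 2 * besselH (μ + 1 + 1) x = (2 * μ + 2) * besselH (μ + 1) x - 2 * besselH μ x := by
  have hμ1 := add_one_ne_zero_of_order hμ
  have h0 := (summable_besselH hμ x).hasSum
  have h1 := (summable_besselH hμ1 x).hasSum
  have h := (h1.mul_left (2 * μ + 2)).sub (h0.mul_left 2)
  have h2 := h.summable.tsum_eq_zero_add
  rw [h.tsum_eq] at h2
  rw [besselH, besselH, besselH, h2, ← tsum_mul_left]
  have e0 := mul_besselCoeff_add_one hμ 0
  have e1 : (2 * μ + 2) * ((-1) ^ 0 * besselCoeff (μ + 1) 0 * x ^ (2 * 0)) -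
      2 * ((-1) ^ 0 * besselCoeff μ 0 * x ^ (2 * 0)) = 0 := by
    rw [← e0]
    push_cast
    ring
  rw [e1, zero_add]
  refine tsum_congr fun n => ?_
  have e2 := mul_besselCoeff_succ (μ + 1) n
  rw [← mul_besselCoeff_add_one hμ (n + 1)]
  push_cast at e2 ⊢
  calc _ = (-1) ^ n * x ^ (2 * n + 2) * (1 / 2 * besselCoeff (μ + 1 + 1) n) := by ring
    _ = _ := by rw [← e2]; ring

/-- The energy is H² + (H')². By the three-term recurrence the cross terms cancel, and the
derivative is at most 2|2μ+1|/x times the energy. -/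
theorem hasDerivAt_besselH_energy {μ : ℝ} (hμ : ∀ n : ℕ, (n : ℝ) + 1 + μ ≠ 0) (x : ℝ) :
    HasDerivAt (fun x => besselH μ x ^ 2 + (x / 2) ^ 2 * besselH (μ + 1) x ^ 2)
      (-(x / 2) * (2 * μ + 1) * besselH (μ + 1) x ^ 2) x := by
  have hμ1 := add_one_ne_zero_of_order hμ
  have h := ((hasDerivAt_besselH hμ x).pow 2).add
    ((((hasDerivAt_id x).div_const 2).pow 2).mul ((hasDerivAt_besselH hμ1 x).pow 2))
  refine HasDerivAt.congr_deriv h ?_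
  have hr := besselH_recurrence hμ x
  simp only [id, Nat.cast_ofNat, Nat.add_one_sub_one, pow_one, Pi.pow_apply]
  linear_combination (-(x / 2) * besselH (μ + 1) x) * hr

/-- A Gronwall argument: the energy divided by x^(2M) decreases on [1, ∞) once M ≥ |2μ+1|. The
alternating signs are essential here, since the absolute values of the terms add up to exponential
growth. -/
theorem exists_abs_besselH_le {μ : ℝ} (hμ : ∀ n : ℕ, (n : ℝ) + 1 + μ ≠ 0) :
    ∃ (C : ℝ) (M : ℕ), 0 < C ∧ ∀ x : ℝ, 1 ≤ x → |besselH μ x| ≤ C * x ^ M := by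
  set E : ℝ → ℝ := fun x => besselH μ x ^ 2 + (x / 2) ^ 2 * besselH (μ + 1) x ^ 2 with hE
  have hE0 : ∀ x, 0 ≤ E x := fun x => by positivity
  -- The extra 1 makes M positive, so that 2M - 1 is a true predecessor.
  set M : ℕ := ⌈|2 * μ + 1|⌉₊ + 1 with hM
  have hMl : |2 * μ + 1| ≤ M := by
    rw [hM]
    push_cast
    linarith [Nat.le_ceil |2 * μ + 1|]
  have hder : ∀ x : ℝ, 1 ≤ x → HasDerivAt (fun x => E x / x ^ (2 * M))
      (((-(x / 2) * (2 * μ + 1) * besselH (μ + 1) x ^ 2) * x ^ (2 * M) -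
        E x * (((2 * M : ℕ) : ℝ) * x ^ (2 * M - 1))) / (x ^ (2 * M)) ^ 2) x := fun x hx =>
    (hasDerivAt_besselH_energy hμ x).div (hasDerivAt_pow (2 * M) x) (by positivity)
  have hanti : AntitoneOn (fun x => E x / x ^ (2 * M)) (Ici 1) := by
    refine antitoneOn_of_deriv_nonpos (convex_Ici 1)
      (fun x hx => (hder x hx).continuousAt.continuousWithinAt)
      (fun x hx => (hder x (interior_subset hx)).differentiableAt.differentiableWithinAt)
      fun x hx => ?_
    have hx1 : (1 : ℝ) ≤ x := interior_subset hx
    rw [(hder x hx1).deriv]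
    refine div_nonpos_of_nonpos_of_nonneg ?_ (by positivity)
    have e : x ^ (2 * M) = x ^ (2 * M - 1) * x := by
      rw [← pow_succ]
      congr 1
    have h1 : -(2 * μ + 1) * ((x / 2) ^ 2 * besselH (μ + 1) x ^ 2) ≤ M * E x := by
      have h2 : -(2 * μ + 1) ≤ M := (neg_le_abs _).trans hMl
      have h3 : (x / 2) ^ 2 * besselH (μ + 1) x ^ 2 ≤ E x := by
        simp only [hE]
        linarith [sq_nonneg (besselH μ x)]
      have h4 : (0 : ℝ) ≤ (x / 2) ^ 2 * besselH (μ + 1) x ^ 2 := by positivity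
      calc _ ≤ (M : ℝ) * ((x / 2) ^ 2 * besselH (μ + 1) x ^ 2) := by gcongr
        _ ≤ _ := by gcongr
    have h5 : (0 : ℝ) < x ^ (2 * M - 1) := by positivity
    rw [e]
    push_cast
    nlinarith
  -- Any positive constant at least the square root of `E 1` serves; `E 1 + 1` avoids the root.
  refine ⟨E 1 + 1, M, by linarith [hE0 1], fun x hx => ?_⟩
  have h := hanti self_mem_Ici (mem_Ici.2 hx) hx
  simp only [one_pow, div_one] at h
  rw [div_le_iff₀ (by positivity)] at h
  have h1 : besselH μ x ^ 2 ≤ E x := by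
    simp only [hE]
    linarith [mul_nonneg (sq_nonneg (x / 2)) (sq_nonneg (besselH (μ + 1) x))]
  refine abs_le_of_sq_le_sq (h1.trans (h.trans ?_)) (by have := hE0 1; positivity)
  rw [mul_pow, ← pow_mul, mul_comm M 2]
  have := hE0 1
  gcongr
  nlinarith

/-- The terms of index at least `k` of the series of `x^(-2k)` times `besselH`. -/
def besselTail (μ : ℝ) (k n : ℕ) (x : ℝ) : ℝ :=
  if n < k then 0 else (-1) ^ n * besselCoeff μ n * x ^ (2 * (n - k))

theorem continuous_besselTail (μ : ℝ) (k n : ℕ) : Continuous (besselTail μ k n) := by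
  unfold besselTail
  split_ifs <;> fun_prop

theorem abs_besselTail_le (μ : ℝ) (k n : ℕ) {x : ℝ} (hx : 0 ≤ x) :
    |besselTail μ k n x| ≤ |besselCoeff μ n| * (1 + x) ^ (2 * n) := by
  rw [besselTail]
  split_ifs with h
  · rw [abs_zero]; positivity
  · rw [abs_mul, abs_mul, abs_pow, abs_neg, abs_one, one_pow, one_mul, abs_pow, abs_of_nonneg hx]
    gcongr
    calc x ^ (2 * (n - k)) ≤ (1 + x) ^ (2 * (n - k)) := by gcongr; linarith
      _ ≤ _ := pow_le_pow_right₀ (by linarith) (by omega)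

theorem exists_tsum_abs_besselTail_le {μ c : ℝ} (hμ : ∀ n : ℕ, (n : ℝ) + 1 + μ ≠ 0) (hc : 1 < c)
    (k : ℕ) : ∃ C : ℝ, 0 < C ∧ ∀ x : ℝ, 0 < x → (Summable fun n : ℕ => |besselTail μ k n x|) ∧
      ∑' n : ℕ, |besselTail μ k n x| ≤ C * Real.exp (c * x) := by
  obtain ⟨C, hC, h⟩ := exists_summable_abs_besselCoeff_le hμ hc
  refine ⟨C * c ^ (2 * k), by positivity, fun x hx => ?_⟩
  obtain ⟨hs, hb⟩ := h x hx.le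
  have hshift : ∀ n : ℕ, |besselTail μ k (n + k) x| =
      (x ^ (2 * k))⁻¹ * (|besselCoeff μ (n + k)| * x ^ (2 * (n + k))) := by
    intro n
    rw [besselTail, if_neg (by omega), abs_mul, abs_mul, abs_pow, abs_neg, abs_one, one_pow,
      one_mul, abs_pow, abs_of_pos hx, Nat.add_sub_cancel, mul_add 2, pow_add]
    field_simp
  have hs1 : Summable fun n : ℕ => |besselTail μ k (n + k) x| :=
    ((((summable_nat_add_iff k).2 hs).mul_left _)).congr fun n => (hshift n).symm
  have hs2 : Summable fun n : ℕ => |besselTail μ k n x| := (summable_nat_add_iff k).1 hs1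
  refine ⟨hs2, ?_⟩
  have h0 : ∑ i ∈ Finset.range k, |besselTail μ k i x| = 0 := Finset.sum_eq_zero fun i hi => by
    rw [besselTail, if_pos (Finset.mem_range.1 hi), abs_zero]
  rw [← hs2.sum_add_tsum_nat_add k, h0, zero_add, tsum_congr hshift, tsum_mul_left]
  calc _ ≤ (x ^ (2 * k))⁻¹ * (C * (c * x) ^ (2 * k) * Real.exp (c * x)) := by
        gcongr
        exact hb k
    _ = _ := by
        rw [mul_pow]
        field_simp

/-- For x ≥ 1 subtract the first k terms, a polynomial, from the polynomially bounded full series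
and divide by x^(2k) ≥ 1. For x ≤ 1 the bound on the absolute sum is a constant. -/
theorem exists_abs_tsum_besselTail_le {μ : ℝ} (hμ : ∀ n : ℕ, (n : ℝ) + 1 + μ ≠ 0) (k : ℕ) :
    ∃ (C : ℝ) (M : ℕ), 0 < C ∧ ∀ x : ℝ, 0 < x →
      |∑' n : ℕ, besselTail μ k n x| ≤ C * (1 + x) ^ M := by
  obtain ⟨C, hC, h⟩ := exists_tsum_abs_besselTail_le hμ one_lt_two k
  obtain ⟨C1, M, hC1, h1⟩ := exists_abs_besselH_le hμ
  set D : ℝ := ∑ n ∈ Finset.range k, |besselCoeff μ n| with hD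
  have hD0 : 0 ≤ D := Finset.sum_nonneg fun _ _ => abs_nonneg _
  refine ⟨C * Real.exp 2 + (C1 + D), M + 2 * k, by positivity, fun x hx => ?_⟩
  have hp : (1 : ℝ) ≤ (1 + x) ^ (M + 2 * k) := one_le_pow₀ (by linarith)
  rcases le_total x 1 with hx1 | hx1
  · have h2 : |∑' n : ℕ, besselTail μ k n x| ≤ ∑' n : ℕ, |besselTail μ k n x| := by
      have := norm_tsum_le_tsum_norm (f := fun n => besselTail μ k n x) (h x hx).1
      simpa only [Real.norm_eq_abs] using this
    have h3 : Real.exp (2 * x) ≤ Real.exp 2 := Real.exp_le_exp.2 (by linarith)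
    calc _ ≤ C * Real.exp (2 * x) := h2.trans (h x hx).2
      _ ≤ C * Real.exp 2 := by gcongr
      _ ≤ (C * Real.exp 2 + (C1 + D)) * 1 := by linarith
      _ ≤ _ := by gcongr
  · have hs := (h x hx).1.of_abs
    have e : x ^ (2 * k) * ∑' n : ℕ, besselTail μ k n x =
        besselH μ x - ∑ n ∈ Finset.range k, (-1) ^ n * besselCoeff μ n * x ^ (2 * n) := by
      rw [besselH, ← (summable_besselH hμ x).sum_add_tsum_nat_add k, add_sub_cancel_left,
        ← hs.sum_add_tsum_nat_add k, Finset.sum_eq_zero fun i hi => by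
          rw [besselTail, if_pos (Finset.mem_range.1 hi)], zero_add, ← tsum_mul_left]
      refine tsum_congr fun n => ?_
      rw [besselTail, if_neg (by omega), Nat.add_sub_cancel, mul_add 2 n k, pow_add]
      ring
    have h2 : |∑ n ∈ Finset.range k, (-1) ^ n * besselCoeff μ n * x ^ (2 * n)| ≤
        D * x ^ (2 * k) := by
      rw [hD, Finset.sum_mul]
      refine (Finset.abs_sum_le_sum_abs _ _).trans (Finset.sum_le_sum fun n hn => ?_)
      rw [abs_mul, abs_mul, abs_pow, abs_neg, abs_one, one_pow, one_mul, abs_pow, abs_of_pos hx]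
      have := Finset.mem_range.1 hn
      gcongr
    have h3 : |x ^ (2 * k) * ∑' n : ℕ, besselTail μ k n x| ≤ C1 * x ^ M + D * x ^ (2 * k) := by
      rw [e]
      exact (abs_sub _ _).trans (add_le_add (h1 x hx1) h2)
    have hxk : (1 : ℝ) ≤ x ^ (2 * k) := one_le_pow₀ hx1
    have hxM : x ^ M ≤ (1 + x) ^ (M + 2 * k) := by
      calc x ^ M ≤ (1 + x) ^ M := by gcongr; linarith
        _ ≤ _ := pow_le_pow_right₀ (by linarith) (by omega)
    have hxk2 : x ^ (2 * k) ≤ (1 + x) ^ (M + 2 * k) := by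
      calc x ^ (2 * k) ≤ (1 + x) ^ (2 * k) := by gcongr; linarith
        _ ≤ _ := pow_le_pow_right₀ (by linarith) (by omega)
    rw [abs_mul, abs_of_pos (by positivity)] at h3
    calc _ ≤ x ^ (2 * k) * |∑' n : ℕ, besselTail μ k n x| := le_mul_of_one_le_left (abs_nonneg _) hxk
      _ ≤ C1 * x ^ M + D * x ^ (2 * k) := h3
      _ ≤ C1 * (1 + x) ^ (M + 2 * k) + D * (1 + x) ^ (M + 2 * k) := by gcongr
      _ ≤ _ := by
        have : 0 ≤ C * Real.exp 2 * (1 + x) ^ (M + 2 * k) := by positivity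
        linarith

/-! ### Termwise integration against the Bose-Einstein weight. -/

/-- The Bose-Einstein weight `1 / (e^x - 1)`. -/
def bose (x : ℝ) : ℝ := (Real.exp x - 1)⁻¹

theorem bose_pos {x : ℝ} (hx : 0 < x) : 0 < bose x :=
  inv_pos.2 (sub_pos.2 (Real.one_lt_exp_iff.2 hx))

theorem measurable_bose : Measurable bose := by
  unfold bose
  fun_prop

/-- Equivalent to 1 + x ≤ e^x. The bound separates the simple pole at 0 from the decay e^{-x}. -/
theorem bose_le {x : ℝ} (hx : 0 < x) : bose x ≤ x⁻¹ * (1 + x) * Real.exp (-x) := by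
  rw [bose, Real.exp_neg, ← div_eq_mul_inv, ← div_eq_inv_mul, div_div,
    inv_eq_one_div, div_le_div_iff₀ (sub_pos.2 (Real.one_lt_exp_iff.2 hx)) (by positivity)]
  nlinarith [Real.add_one_le_exp x]

theorem hasSum_exp_neg_bose {x : ℝ} (hx : 0 < x) :
    HasSum (fun n : ℕ => Real.exp (-(((n : ℝ) + 1) * x))) (bose x) := by
  have h := (hasSum_geometric_of_lt_one (Real.exp_pos (-x)).le (by
    have h0 := Real.exp_lt_exp.2 (neg_lt_zero.2 hx)
    rwa [Real.exp_zero] at h0)).mul_left (Real.exp (-x))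
  refine hasSum_of_eq h (fun n => ?_) ?_
  · rw [← Real.exp_nat_mul, ← Real.exp_add]
    congr 1
    ring
  · rw [bose, Real.exp_neg]
    have h1 : Real.exp x ≠ 0 := (Real.exp_pos x).ne'
    have h2 : Real.exp x - 1 ≠ 0 := (sub_pos.2 (Real.one_lt_exp_iff.2 hx)).ne'
    have h3 : 1 - (Real.exp x)⁻¹ ≠ 0 := by
      rw [sub_ne_zero]
      intro h4
      apply h2
      rw [eq_comm, inv_eq_one] at h4
      rw [h4, sub_self]
    field_simp

theorem integrableOn_rpow_mul_pow_mul_exp {τ δ : ℝ} (hτ : 0 < τ) (hδ : 0 < δ) (L : ℕ) :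
    IntegrableOn (fun x : ℝ => x ^ (τ - 1) * (1 + x) ^ L * Real.exp (-(δ * x))) (Ioi 0) := by
  induction L generalizing τ with
  | zero =>
    refine (integrableOn_exp_mul_rpow_Ioi_zero hτ hδ).congr (Eventually.of_forall fun x => ?_)
    simp only [pow_zero, mul_one]
    ring
  | succ L ih =>
    refine ((ih hτ).add (ih (τ := τ + 1) (by linarith))).congr ?_
    refine (ae_restrict_mem measurableSet_Ioi).mono fun x hx => ?_
    have hx0 : (0 : ℝ) < x := hx
    have e : x ^ (τ + 1 - 1) = x ^ (τ - 1) * x := by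
      rw [add_sub_cancel_right, ← Real.rpow_add_one hx0.ne']
      congr 1
      ring
    simp only [Pi.add_apply]
    rw [e, pow_succ]
    ring

/-- Dominated convergence for the net of finite partial sums. The growth e^{κx} with κ < 1 is beaten
by the weight, and x^τ with τ > 0 makes its pole integrable. -/
theorem hasSum_integral_mul_bose {ι : Type*} [Countable ι] {F : ι → ℝ → ℝ} {f : ℝ → ℝ}
    {K κ τ : ℝ} {L : ℕ} (hτ : 0 < τ) (hκ : κ < 1)
    (hF : ∀ i, AEStronglyMeasurable (F i) (volume.restrict (Ioi 0)))
    (hb : ∀ x : ℝ, 0 < x → ∀ s : Finset ι,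
      |∑ i ∈ s, F i x| ≤ K * (1 + x) ^ L * Real.exp (κ * x) * x ^ τ)
    (hf : ∀ x : ℝ, 0 < x → HasSum (fun i => F i x) (f x)) :
    HasSum (fun i => ∫ x in Ioi 0, F i x * bose x) (∫ x in Ioi 0, f x * bose x) := by
  have hbound : ∀ s : Finset ι, ∀ x : ℝ, 0 < x → ‖∑ i ∈ s, F i x * bose x‖ ≤
      K * (x ^ (τ - 1) * (1 + x) ^ (L + 1) * Real.exp (-((1 - κ) * x))) := by
    intro s x hx
    have hB := bose_pos hx
    have hK : 0 ≤ K * (1 + x) ^ L * Real.exp (κ * x) * x ^ τ := (abs_nonneg _).trans (hb x hx ∅)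
    rw [← Finset.sum_mul, norm_mul, Real.norm_eq_abs, Real.norm_eq_abs, abs_of_pos hB]
    calc _ ≤ (K * (1 + x) ^ L * Real.exp (κ * x) * x ^ τ) * (x⁻¹ * (1 + x) * Real.exp (-x)) :=
          mul_le_mul (hb x hx s) (bose_le hx) hB.le hK
      _ = _ := by
          have e1 : -((1 - κ) * x) = κ * x + -x := by ring
          rw [e1, Real.exp_add, Real.rpow_sub_one hx.ne', pow_succ]
          ring
  have hG : IntegrableOn (fun x : ℝ => K * (x ^ (τ - 1) * (1 + x) ^ (L + 1) *
      Real.exp (-((1 - κ) * x)))) (Ioi 0) :=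
    (integrableOn_rpow_mul_pow_mul_exp hτ (by linarith) (L + 1)).const_mul K
  have hFm : ∀ i, AEStronglyMeasurable (fun x => F i x * bose x) (volume.restrict (Ioi 0)) :=
    fun i => (hF i).mul measurable_bose.aestronglyMeasurable
  have hFi : ∀ i, Integrable (fun x => F i x * bose x) (volume.restrict (Ioi 0)) := by
    intro i
    refine Integrable.mono' hG (hFm i) ((ae_restrict_mem measurableSet_Ioi).mono fun x hx => ?_)
    simpa only [Finset.sum_singleton] using hbound {i} x hx
  -- The index type is countable, so the filter of finite sets is countably generated, as dominated
  -- convergence requires.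
  have h := tendsto_integral_filter_of_dominated_convergence
    (μ := volume.restrict (Ioi (0 : ℝ))) (l := (atTop : Filter (Finset ι)))
    (F := fun s x => ∑ i ∈ s, F i x * bose x) (f := fun x => f x * bose x)
    (fun x : ℝ => K * (x ^ (τ - 1) * (1 + x) ^ (L + 1) * Real.exp (-((1 - κ) * x))))
    (Eventually.of_forall fun s => by
      have := Finset.aestronglyMeasurable_fun_sum s fun i _ => hFm i
      exact this)
    (Eventually.of_forall fun s =>
      (ae_restrict_mem measurableSet_Ioi).mono fun x hx => hbound s x hx) hG
    ((ae_restrict_mem measurableSet_Ioi).mono fun x hx => (hf x hx).mul_right (bose x))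
  refine Tendsto.congr (fun s => ?_) h
  exact integral_finsetSum s fun i _ => hFi i

theorem Gamma_mul_realZeta {w : ℝ} (hw : 1 < w) :
    Real.Gamma w * realZeta w = ∫ x in Ioi 0, x ^ (w - 1) * bose x := by
  have hz : HasSum (fun n : ℕ => (1 / ((n : ℝ) + 1)) ^ w) (realZeta w) := by
    have hs := (Real.summable_one_div_nat_add_rpow 1 w).2 hw
    have h1 : Summable fun n : ℕ => (1 / ((n : ℝ) + 1)) ^ w := hs.congr fun n => by
      have : (0 : ℝ) < (n : ℝ) + 1 := by positivity
      rw [abs_of_pos this, Real.div_rpow zero_le_one this.le, Real.one_rpow]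
    have h2 : ((∑' n : ℕ, (1 / ((n : ℝ) + 1)) ^ w : ℝ) : ℂ) = riemannZeta (w : ℂ) := by
      rw [zeta_eq_tsum_one_div_nat_add_one_cpow (by simpa using hw), Complex.ofReal_tsum]
      refine tsum_congr fun n => ?_
      have : (0 : ℝ) < (n : ℝ) + 1 := by positivity
      rw [Real.div_rpow zero_le_one this.le, Real.one_rpow, Complex.ofReal_div,
        Complex.ofReal_cpow this.le]
      push_cast
      rfl
    rw [realZeta, ← h2, Complex.ofReal_re]
    exact h1.hasSum
  have hint : ∀ n : ℕ, ∫ x in Ioi 0, x ^ (w - 1) * Real.exp (-(((n : ℝ) + 1) * x)) =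
      (1 / ((n : ℝ) + 1)) ^ w * Real.Gamma w := fun n =>
    Real.integral_rpow_mul_exp_neg_mul_Ioi (by linarith) (by positivity)
  have hsum := hasSum_integral_of_summable_integral_norm
    (μ := volume.restrict (Ioi (0 : ℝ)))
    (F := fun (n : ℕ) (x : ℝ) => x ^ (w - 1) * Real.exp (-(((n : ℝ) + 1) * x))) (fun n => by
      refine (integrableOn_exp_mul_rpow_Ioi_zero (ν := w) (y := (n : ℝ) + 1) (by linarith)
        (by positivity)).congr (Eventually.of_forall fun x => ?_)
      simp only [mul_comm]) (by
      refine (hz.summable.mul_right (Real.Gamma w)).congr fun n => ?_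
      rw [← hint n]
      refine setIntegral_congr_fun measurableSet_Ioi fun x hx => ?_
      have hx0 : (0 : ℝ) < x := hx
      exact (abs_of_nonneg (by positivity)).symm)
  rw [mul_comm, ← (hz.mul_right (Real.Gamma w)).tsum_eq, ← tsum_congr hint, hsum.tsum_eq]
  refine setIntegral_congr_fun measurableSet_Ioi fun x hx => ?_
  have h := (hasSum_exp_neg_bose hx).mul_left (x ^ (w - 1))
  exact h.tsum_eq

/-! ### The double series in both orders of summation. -/

/-- The array `T` is summable to `R` as an iterated series in either order, and, if `p` holds,
as a double series. -/
structure HasIteratedSum (p : Prop) (T : ℕ → ℕ → ℝ) (R : ℝ) : Prop where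
  row : ∀ m, Summable fun n => T m n
  sum_row : HasSum (fun m => ∑' n, T m n) R
  col : ∀ n, Summable fun m => T m n
  sum_col : HasSum (fun n => ∑' m, T m n) R
  double : p → HasSum (fun q : ℕ × ℕ => T q.1 q.2) R

theorem HasIteratedSum.add {p : Prop} {T U : ℕ → ℕ → ℝ} {R S : ℝ} (hT : HasIteratedSum p T R)
    (hU : HasIteratedSum p U S) : HasIteratedSum p (fun m n => T m n + U m n) (R + S) where
  row m := (hT.row m).add (hU.row m)
  sum_row := hasSum_of_eq (hT.sum_row.add hU.sum_row)
    (fun m => (hT.row m).tsum_add (hU.row m)) rfl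
  col n := (hT.col n).add (hU.col n)
  sum_col := hasSum_of_eq (hT.sum_col.add hU.sum_col)
    (fun n => (hT.col n).tsum_add (hU.col n)) rfl
  double h := (hT.double h).add (hU.double h)

theorem hasIteratedSum_single {p : Prop} {t : ℕ → ℝ} (ht : Summable t) (k : ℕ) :
    HasIteratedSum p (fun m n => if n = k then t m else 0) (∑' m, t m) where
  row m := (hasSum_ite_eq k (t m)).summable
  sum_row := hasSum_of_eq ht.hasSum (fun m => (hasSum_ite_eq k (t m)).tsum_eq) rfl
  col n := by
    split_ifs
    · exact ht
    · exact summable_zero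
  sum_col := by
    refine hasSum_of_eq (hasSum_ite_eq k (∑' m, t m)) (fun n => ?_) rfl
    split_ifs
    · rfl
    · exact tsum_zero
  double _ := by
    have hinj : Function.Injective fun m : ℕ => (m, k) := fun a b h => (Prod.ext_iff.1 h).1
    refine (hinj.hasSum_iff fun q hq => ?_).1 ?_
    · rw [if_neg]
      rintro rfl
      exact hq ⟨q.1, rfl⟩
    · refine hasSum_of_eq ht.hasSum (fun m => ?_) rfl
      simp

theorem exists_hasIteratedSum_lt (p : Prop) {T : ℕ → ℕ → ℝ} (hT : ∀ n, Summable fun m => T m n)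
    (k : ℕ) : ∃ R, HasIteratedSum p (fun m n => if n < k then T m n else 0) R := by
  induction k with
  | zero =>
    refine ⟨0, fun m => ?_, ?_, fun n => ?_, ?_, fun _ => ?_⟩ <;>
      simp [summable_zero, hasSum_zero]
  | succ k ih =>
    obtain ⟨R, hR⟩ := ih
    refine ⟨R + ∑' m, T m k, ?_⟩
    have e : (fun m n => if n < k + 1 then T m n else 0) =
        fun m n => (if n < k then T m n else 0) + if n = k then T m k else 0 := ?_
    · rw [e]
      exact hR.add (hasIteratedSum_single (p := p) (hT k) k)
    ext m n
    rcases lt_trichotomy n k with h | rfl | h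
    · rw [if_pos h, if_neg h.ne, if_pos (by omega), add_zero]
    · rw [if_neg (lt_irrefl _), if_pos rfl, if_pos (by omega), zero_add]
    · rw [if_neg (by omega), if_neg (by omega), if_neg (by omega), add_zero]

theorem abs_sum_le_tsum_abs {ι : Type*} {f : ι → ℝ} (hf : Summable fun i => |f i|) (s : Finset ι) :
    |∑ i ∈ s, f i| ≤ ∑' i, |f i| :=
  (Finset.abs_sum_le_sum_abs _ _).trans (hf.sum_le_tsum s fun _ _ => abs_nonneg _)

theorem summable_abs_mul_prod {f g : ℕ → ℝ} (hf : Summable fun n => |f n|)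
    (hg : Summable fun n => |g n|) : (Summable fun p : ℕ × ℕ => |f p.1 * g p.2|) ∧
      ∑' p : ℕ × ℕ, |f p.1 * g p.2| = (∑' n, |f n|) * ∑' n, |g n| := by
  have h : Summable fun p : ℕ × ℕ => |f p.1| * |g p.2| :=
    hf.mul_of_nonneg hg (Pi.le_def.2 fun n => abs_nonneg (f n))
      (Pi.le_def.2 fun n => abs_nonneg (g n))
  simp only [abs_mul]
  exact ⟨h, (hf.tsum_mul_tsum hg h).symm⟩

theorem aestronglyMeasurable_tsum_Ioi {f : ℕ → ℝ → ℝ} (hf : ∀ n, Continuous (f n))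
    (hs : ∀ x : ℝ, 0 < x → Summable fun n => f n x) :
    AEStronglyMeasurable (fun x => ∑' n, f n x) (volume.restrict (Ioi 0)) :=
  aestronglyMeasurable_of_tendsto_ae atTop
    (f := fun (N : ℕ) (x : ℝ) => ∑ n ∈ Finset.range N, f n x)
    (fun _ => (continuous_finsetSum _ fun n _ => hf n).aestronglyMeasurable)
    ((ae_restrict_mem measurableSet_Ioi).mono fun x hx => (hs x hx).hasSum.tendsto_sum_nat)

/-- Let P and Q be the sums of the Bessel factors and of the `q m`. For fixed m, summing over n
costs e^{ρx} with y < ρ < 1; summing over m afterwards costs only e^{zx}, since P is polynomially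
bounded. In the other order, the sum over m costs e^{zx} and the later sum over n costs e^{ρx},
since |Q| ≤ 1. Both orders end at the integral of x^τ P Q `bose`. Only joint summation meets both
exponentials, with combined rate below 1 when y + z < 1. -/
theorem exists_hasIteratedSum_integral {μ τ y z : ℝ} {q : ℕ → ℝ → ℝ}
    (hμ : ∀ n : ℕ, (n : ℝ) + 1 + μ ≠ 0) (k : ℕ) (hτ : 0 < τ) (hy : 0 < y) (hy1 : y < 1)
    (hz1 : z < 1) (hq : ∀ m, Continuous (q m))
    (hqs : ∀ x : ℝ, 0 < x → (Summable fun m => |q m x|) ∧ ∑' m, |q m x| ≤ Real.exp (z * x))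
    (hqm : ∀ m : ℕ, ∀ x : ℝ, 0 < x → |q m x| ≤ (1 + x) ^ (2 * m))
    (hQ : ∀ x : ℝ, 0 < x → |∑' m, q m x| ≤ 1) :
    ∃ R, HasIteratedSum (y + z < 1)
      (fun m n => ∫ x in Ioi 0, x ^ τ * besselTail μ k n (y * x) * q m x * bose x) R := by
  set r : ℕ → ℝ → ℝ := fun n x => besselTail μ k n (y * x) with hr
  have hrc : ∀ n, Continuous (r n) := fun n =>
    (continuous_besselTail μ k n).comp (continuous_const.mul continuous_id)
  have hrs : ∀ x : ℝ, 0 < x → Summable fun n => |r n x| := by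
    obtain ⟨C, -, h⟩ := exists_tsum_abs_besselTail_le hμ one_lt_two k
    exact fun x hx => (h (y * x) (by positivity)).1
  have hrb : ∀ ρ : ℝ, y < ρ → ∃ C : ℝ, 0 < C ∧ ∀ x : ℝ, 0 < x →
      ∑' n, |r n x| ≤ C * Real.exp (ρ * x) := by
    intro ρ hρ
    obtain ⟨C, hC, h⟩ := exists_tsum_abs_besselTail_le hμ ((one_lt_div hy).2 hρ) k
    refine ⟨C, hC, fun x hx => ?_⟩
    have := (h (y * x) (by positivity)).2
    rwa [← mul_assoc, div_mul_cancel₀ _ hy.ne'] at this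
  obtain ⟨ρ, hyρ, hρ1⟩ := exists_between hy1
  obtain ⟨C, hC, hCb⟩ := hrb ρ hyρ
  obtain ⟨C1, M, hC1, hPb⟩ := exists_abs_tsum_besselTail_le hμ k
  have hP : ∀ x : ℝ, 0 < x → |∑' n, r n x| ≤ C1 * (1 + x) ^ M := by
    intro x hx
    have hyx : y * x ≤ x := by nlinarith
    refine (hPb (y * x) (by positivity)).trans ?_
    gcongr
  have hrn : ∀ n : ℕ, ∀ x : ℝ, 0 < x → |r n x| ≤ |besselCoeff μ n| * (1 + x) ^ (2 * n) := by
    intro n x hx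
    have hyx : y * x ≤ x := by nlinarith
    refine (abs_besselTail_le μ k n (by positivity)).trans ?_
    gcongr
  have hPm := aestronglyMeasurable_tsum_Ioi hrc fun x hx => (hrs x hx).of_abs
  have hQm := aestronglyMeasurable_tsum_Ioi hq fun x hx => (hqs x hx).1.of_abs
  have hτm : AEStronglyMeasurable (fun x : ℝ => x ^ τ) (volume.restrict (Ioi 0)) :=
    (by fun_prop : Measurable fun x : ℝ => x ^ τ).aestronglyMeasurable
  have hrm : ∀ n, AEStronglyMeasurable (r n) (volume.restrict (Ioi 0)) :=
    fun n => (hrc n).aestronglyMeasurable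
  have hqm' : ∀ m, AEStronglyMeasurable (q m) (volume.restrict (Ioi 0)) :=
    fun m => (hq m).aestronglyMeasurable
  have hrow : ∀ m, HasSum (fun n => ∫ x in Ioi 0, x ^ τ * r n x * q m x * bose x)
      (∫ x in Ioi 0, x ^ τ * (∑' n, r n x) * q m x * bose x) := by
    intro m
    refine hasSum_integral_mul_bose (K := C) (κ := ρ) (τ := τ) (L := 2 * m) hτ hρ1
      (fun n => (hτm.mul (hrm n)).mul (hqm' m)) (fun x hx s => ?_)
      fun x hx => ((hrs x hx).of_abs.hasSum.mul_left _).mul_right _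
    rw [← Finset.sum_mul, ← Finset.mul_sum, abs_mul, abs_mul, abs_of_pos (by positivity)]
    calc _ ≤ x ^ τ * (C * Real.exp (ρ * x)) * (1 + x) ^ (2 * m) := by
          gcongr
          · exact (abs_sum_le_tsum_abs (hrs x hx) s).trans (hCb x hx)
          · exact hqm m x hx
      _ = _ := by ring
  have hcol : ∀ n, HasSum (fun m => ∫ x in Ioi 0, x ^ τ * r n x * q m x * bose x)
      (∫ x in Ioi 0, x ^ τ * r n x * (∑' m, q m x) * bose x) := by
    intro n
    refine hasSum_integral_mul_bose (K := |besselCoeff μ n|) (κ := z) (τ := τ) (L := 2 * n) hτ hz1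
      (fun m => (hτm.mul (hrm n)).mul (hqm' m)) (fun x hx s => ?_)
      fun x hx => (hqs x hx).1.of_abs.hasSum.mul_left _
    rw [← Finset.mul_sum, abs_mul, abs_mul, abs_of_pos (by positivity)]
    calc _ ≤ x ^ τ * (|besselCoeff μ n| * (1 + x) ^ (2 * n)) * Real.exp (z * x) := by
          gcongr
          · exact hrn n x hx
          · exact (abs_sum_le_tsum_abs (hqs x hx).1 s).trans (hqs x hx).2
      _ = _ := by ring
  refine ⟨∫ x in Ioi 0, x ^ τ * (∑' n, r n x) * (∑' m, q m x) * bose x,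
    fun m => (hrow m).summable, ?_, fun n => (hcol n).summable, ?_, fun hyz => ?_⟩
  · refine hasSum_of_eq (g := fun m => ∫ x in Ioi 0, x ^ τ * (∑' n, r n x) * q m x * bose x) ?_
      (fun m => (hrow m).tsum_eq) rfl
    refine hasSum_integral_mul_bose (K := C1) (κ := z) (τ := τ) (L := M) hτ hz1
      (fun m => (hτm.mul hPm).mul (hqm' m)) (fun x hx s => ?_)
      fun x hx => (hqs x hx).1.of_abs.hasSum.mul_left _
    rw [← Finset.mul_sum, abs_mul, abs_mul, abs_of_pos (by positivity)]
    calc _ ≤ x ^ τ * (C1 * (1 + x) ^ M) * Real.exp (z * x) := by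
          gcongr
          · exact hP x hx
          · exact (abs_sum_le_tsum_abs (hqs x hx).1 s).trans (hqs x hx).2
      _ = _ := by ring
  · refine hasSum_of_eq (g := fun n => ∫ x in Ioi 0, x ^ τ * r n x * (∑' m, q m x) * bose x) ?_
      (fun n => (hcol n).tsum_eq) rfl
    refine hasSum_integral_mul_bose (K := C) (κ := ρ) (τ := τ) (L := 0) hτ hρ1
      (fun n => (hτm.mul (hrm n)).mul hQm) (fun x hx s => ?_)
      fun x hx => ((hrs x hx).of_abs.hasSum.mul_left _).mul_right _
    rw [← Finset.sum_mul, ← Finset.mul_sum, abs_mul, abs_mul, abs_of_pos (by positivity)]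
    calc _ ≤ x ^ τ * (C * Real.exp (ρ * x)) * 1 := by
          gcongr
          · exact (abs_sum_le_tsum_abs (hrs x hx) s).trans (hCb x hx)
          · exact hQ x hx
      _ = _ := by ring
  · obtain ⟨σ, hyσ, hσ⟩ := exists_between (show y < 1 - z by linarith)
    obtain ⟨D, hD, hDb⟩ := hrb σ hyσ
    have hpair := fun (x : ℝ) (hx : 0 < x) =>
      summable_abs_mul_prod (f := fun m => q m x) (g := fun n => r n x) (hqs x hx).1 (hrs x hx)
    have hpair_le : ∀ x : ℝ, 0 < x → ∑' p : ℕ × ℕ, |q p.1 x * r p.2 x| ≤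
        Real.exp (z * x) * (D * Real.exp (σ * x)) := fun x hx => by
      rw [(hpair x hx).2]
      exact mul_le_mul (hqs x hx).2 (hDb x hx) (tsum_nonneg fun _ => abs_nonneg _)
        (Real.exp_pos _).le
    have hmeas : ∀ p : ℕ × ℕ, AEStronglyMeasurable (fun x => x ^ τ * r p.2 x * q p.1 x)
        (volume.restrict (Ioi 0)) := fun p => (hτm.mul (hrm p.2)).mul (hqm' p.1)
    have hbound : ∀ x : ℝ, 0 < x → ∀ s : Finset (ℕ × ℕ),
        |∑ p ∈ s, x ^ τ * r p.2 x * q p.1 x| ≤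
          D * (1 + x) ^ 0 * Real.exp ((z + σ) * x) * x ^ τ := by
      intro x hx s
      have e : ∀ p : ℕ × ℕ, x ^ τ * r p.2 x * q p.1 x = x ^ τ * (q p.1 x * r p.2 x) :=
        fun p => by ring
      rw [Finset.sum_congr rfl fun p _ => e p, ← Finset.mul_sum, abs_mul,
        abs_of_pos (by positivity)]
      calc _ ≤ x ^ τ * (Real.exp (z * x) * (D * Real.exp (σ * x))) := by
            gcongr
            exact (abs_sum_le_tsum_abs (hpair x hx).1 s).trans (hpair_le x hx)
        _ = _ := by rw [add_mul, Real.exp_add]; ring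
    have hlim : ∀ x : ℝ, 0 < x → HasSum (fun p : ℕ × ℕ => x ^ τ * r p.2 x * q p.1 x)
        (x ^ τ * (∑' n, r n x) * (∑' m, q m x)) := fun x hx =>
      hasSum_of_eq ((HasSum.mul (hqs x hx).1.of_abs.hasSum (hrs x hx).of_abs.hasSum
        (hpair x hx).1.of_abs).mul_left (x ^ τ)) (fun p => by ring) (by ring)
    exact hasSum_integral_mul_bose hτ (by linarith) hmeas hbound hlim

theorem HasIteratedSum.mul_left {p : Prop} {T : ℕ → ℕ → ℝ} {R : ℝ} (c : ℝ)
    (hT : HasIteratedSum p T R) : HasIteratedSum p (fun m n => c * T m n) (c * R) where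
  row m := (hT.row m).mul_left c
  sum_row := hasSum_of_eq (hT.sum_row.mul_left c) (fun _ => tsum_mul_left) rfl
  col n := (hT.col n).mul_left c
  sum_col := hasSum_of_eq (hT.sum_col.mul_left c) (fun _ => tsum_mul_left) rfl
  double h := (hT.double h).mul_left c

/-- The part of the double series with the coefficients `A_{m,n}`. -/
def termA (ν y z : ℝ) (m n : ℕ) : ℝ :=
  (-1) ^ (m + n) * (coeffA ν m n * z ^ (2 * m + 1) * y ^ (2 * n))

/-- The part of the double series with the coefficients `B_{m,n}`. -/
def termB (ν y z : ℝ) (m n : ℕ) : ℝ :=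
  (-1) ^ (m + n) * (coeffB ν m n * z ^ m * y ^ (2 * (n : ℝ) - 2 * ν))

/-- The terms of the series of `sin (z x) / x`. -/
def sincTerm (z : ℝ) (m : ℕ) (x : ℝ) : ℝ :=
  (-1) ^ m * z ^ (2 * m + 1) * x ^ (2 * m) / ((2 * m + 1).factorial : ℝ)

theorem abs_sincTerm_le {z x : ℝ} (hz : 0 < z) (hz1 : z < 1) (hx : 0 < x) (m : ℕ) :
    |sincTerm z m x| ≤ (z * x) ^ (2 * m) / ((2 * m).factorial : ℝ) := by
  rw [sincTerm, abs_div, abs_mul, abs_mul, abs_pow, abs_neg, abs_one, one_pow, one_mul,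
    abs_of_pos (by positivity), abs_of_pos (by positivity), abs_of_pos (by positivity), mul_pow]
  have h1 : z ^ (2 * m + 1) ≤ z ^ (2 * m) := pow_le_pow_of_le_one hz.le hz1.le (by omega)
  gcongr
  omega

theorem termA_eq (ν y z : ℝ) (m n : ℕ) : termA ν y z m n =
    ∫ x in Ioi 0, x ^ (1 : ℝ) * besselTail ν 0 n (y * x) * sincTerm z m x * bose x := by
  have hw : (1 : ℝ) < 2 * m + 2 * n + 2 := by
    have : (0 : ℝ) ≤ 2 * m + 2 * n := by positivity
    linarith
  have h := Gamma_mul_realZeta hw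
  have e : ∀ x ∈ Ioi (0 : ℝ),
      x ^ (1 : ℝ) * besselTail ν 0 n (y * x) * sincTerm z m x * bose x =
      ((-1) ^ (m + n) * besselCoeff ν n * y ^ (2 * n) * z ^ (2 * m + 1) /
        ((2 * m + 1).factorial : ℝ)) * (x ^ ((2 * m + 2 * n + 2 : ℝ) - 1) * bose x) := by
    intro x hx
    have e1 : (2 * m + 2 * n + 2 : ℝ) - 1 = ((2 * m + 2 * n + 1 : ℕ) : ℝ) := by push_cast; ring
    rw [e1, Real.rpow_natCast, Real.rpow_one, besselTail, if_neg (by omega), sincTerm,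
      Nat.sub_zero, mul_pow, pow_add (-1 : ℝ), pow_add x, pow_add x]
    ring
  rw [setIntegral_congr_fun measurableSet_Ioi e, integral_const_mul, ← h, termA, coeffA_eq]
  ring

/-- The integral lemma with Q(x) = sin(zx)/x and no Bessel terms removed; the absolute sum over m is
at most cosh(zx). -/
theorem exists_hasIteratedSum_termA {ν y z : ℝ} (hint : ∀ j : ℤ, ν ≠ j) (hy : 0 < y) (hy1 : y < 1)
    (hz : 0 < z) (hz1 : z < 1) : ∃ R, HasIteratedSum (y + z < 1) (termA ν y z) R := by
  have e : termA ν y z = fun m n =>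
      ∫ x in Ioi 0, x ^ (1 : ℝ) * besselTail ν 0 n (y * x) * sincTerm z m x * bose x :=
    funext fun m => funext fun n => termA_eq ν y z m n
  rw [e]
  refine exists_hasIteratedSum_integral (add_ne_zero_of_int hint) 0 one_pos hy hy1 hz1
    (fun m => by unfold sincTerm; fun_prop) (fun x hx => ?_) (fun m x hx => ?_) fun x hx => ?_
  · have hc := Real.hasSum_cosh (z * x)
    have hs : Summable fun m => |sincTerm z m x| :=
      Summable.of_nonneg_of_le (fun _ => abs_nonneg _) (abs_sincTerm_le hz hz1 hx) hc.summable
    refine ⟨hs, (hs.tsum_le_tsum (abs_sincTerm_le hz hz1 hx) hc.summable).trans ?_⟩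
    rw [hc.tsum_eq, Real.cosh_eq]
    have : Real.exp (-(z * x)) ≤ Real.exp (z * x) := Real.exp_le_exp.2 (by
      have : 0 < z * x := by positivity
      linarith)
    linarith
  · refine (abs_sincTerm_le hz hz1 hx m).trans ((div_le_self (by positivity) ?_).trans ?_)
    · exact_mod_cast Nat.one_le_iff_ne_zero.2 (Nat.factorial_ne_zero _)
    · have : z * x ≤ 1 + x := by nlinarith
      gcongr
  · have h := (Real.hasSum_sin (z * x)).mul_left x⁻¹
    have h1 : HasSum (fun m => sincTerm z m x) (x⁻¹ * Real.sin (z * x)) := by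
      refine hasSum_of_eq h (fun m => ?_) rfl
      rw [sincTerm, mul_pow, pow_succ x]
      field_simp
    rw [h1.tsum_eq, abs_mul, abs_inv, abs_of_pos hx, inv_mul_le_iff₀ hx, mul_one]
    calc |Real.sin (z * x)| ≤ |z * x| := Real.abs_sin_le_abs
      _ = z * x := abs_of_pos (by positivity)
      _ ≤ x := by nlinarith

/-- The terms of the series of `-sin (z x + π ν)`. -/
def phaseTerm (ν z : ℝ) (m : ℕ) (x : ℝ) : ℝ :=
  (-(z * x)) ^ m / (m.factorial : ℝ) * Real.sin (Real.pi * (m / 2 - ν))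

theorem abs_phaseTerm_le (ν : ℝ) {z x : ℝ} (hz : 0 < z) (hx : 0 < x) (m : ℕ) :
    |phaseTerm ν z m x| ≤ (z * x) ^ m / (m.factorial : ℝ) := by
  rw [phaseTerm, abs_mul, abs_div, abs_pow, abs_neg, abs_of_pos (by positivity : 0 < z * x),
    Nat.abs_cast]
  exact mul_le_of_le_one_right (by positivity) (Real.abs_sin_le_one _)

/-- As i^m = e^{iπm/2}, the sum is the imaginary part of e^{-izx} e^{-iπν}. -/
theorem abs_tsum_phaseTerm_le (ν z x : ℝ) : |∑' m, phaseTerm ν z m x| ≤ 1 := by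
  have h := (NormedSpace.expSeries_div_hasSum_exp (𝔸 := ℂ)
    (-((z * x : ℝ) : ℂ) * Complex.I)).mul_right (Complex.exp (((-(Real.pi * ν) : ℝ) : ℂ) * Complex.I))
  rw [← Complex.exp_eq_exp_ℂ] at h
  have h1 : HasSum (fun m => phaseTerm ν z m x) (Complex.exp (-((z * x : ℝ) : ℂ) * Complex.I) *
      Complex.exp (((-(Real.pi * ν) : ℝ) : ℂ) * Complex.I)).im := by
    refine hasSum_of_eq (Complex.hasSum_im h) (fun m => ?_) rfl
    have e1 : (-((z * x : ℝ) : ℂ) * Complex.I) ^ m / (m.factorial : ℂ) *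
        Complex.exp (((-(Real.pi * ν) : ℝ) : ℂ) * Complex.I) =
        (((-(z * x)) ^ m / (m.factorial : ℝ) : ℝ) : ℂ) *
          Complex.exp (((Real.pi * (m / 2 - ν) : ℝ) : ℂ) * Complex.I) := by
      have e2 : Complex.I ^ m = Complex.exp (((Real.pi * (m / 2) : ℝ) : ℂ) * Complex.I) := by
        conv_lhs => rw [← Complex.exp_pi_div_two_mul_I]
        rw [← Complex.exp_nat_mul]
        congr 1
        push_cast
        ring
      have e3 : ((Real.pi * (m / 2 - ν) : ℝ) : ℂ) * Complex.I =
          ((Real.pi * (m / 2) : ℝ) : ℂ) * Complex.I + ((-(Real.pi * ν) : ℝ) : ℂ) * Complex.I := by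
        push_cast
        ring
      rw [e3, Complex.exp_add, ← e2, mul_pow]
      push_cast
      ring
    rw [e1, Complex.im_ofReal_mul, Complex.exp_ofReal_mul_I_im, phaseTerm]
  rw [h1.tsum_eq]
  refine (Complex.abs_im_le_norm _).trans ?_
  rw [norm_mul, ← Complex.ofReal_neg, Complex.norm_exp_ofReal_mul_I,
    Complex.norm_exp_ofReal_mul_I, mul_one]

/-- The integral for Γ(w)ζ(w) needs w = m + 2n + 1 - 2ν > 1, which n ≥ k > ν guarantees. The columns
n < k are dropped here and added back in `exists_hasIteratedSum_termB`. -/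
theorem termB_eq {ν y z : ℝ} (hy : 0 < y) {k : ℕ} (hk : ν < k) (m n : ℕ) :
    (if n < k then 0 else termB ν y z m n) = 4 ^ ν * y ^ (2 * (k : ℝ) - 2 * ν) *
      ∫ x in Ioi 0, x ^ (2 * (k : ℝ) - 2 * ν) * besselTail (-ν) k n (y * x) *
        phaseTerm ν z m x * bose x := by
  by_cases hn : n < k
  · simp [besselTail, hn]
  have hkn : k ≤ n := not_lt.1 hn
  have hkn' : (k : ℝ) ≤ n := by exact_mod_cast hkn
  have hw : (1 : ℝ) < m + 2 * n + 1 - 2 * ν := by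
    have : (0 : ℝ) ≤ m := by positivity
    linarith
  have h := Gamma_mul_realZeta hw
  have e : ∀ x ∈ Ioi (0 : ℝ), x ^ (2 * (k : ℝ) - 2 * ν) * besselTail (-ν) k n (y * x) *
        phaseTerm ν z m x * bose x =
      ((-1) ^ (m + n) * besselCoeff (-ν) n * y ^ (2 * (n - k)) * z ^ m / (m.factorial : ℝ) *
        Real.sin (Real.pi * (m / 2 - ν))) * (x ^ ((m + 2 * n + 1 - 2 * ν : ℝ) - 1) * bose x) := by
    intro x hx
    have hx0 : (0 : ℝ) < x := hx
    have e1 : (m + 2 * n + 1 - 2 * ν : ℝ) - 1 =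
        (2 * (k : ℝ) - 2 * ν) + ((2 * (n - k) + m : ℕ) : ℝ) := by
      push_cast [Nat.cast_sub hkn]
      ring
    rw [e1, Real.rpow_add hx0, Real.rpow_natCast, besselTail, if_neg hn, phaseTerm,
      mul_pow, neg_pow (z * x), mul_pow, pow_add (-1 : ℝ), pow_add x]
    ring
  have e2 : y ^ (2 * (n : ℝ) - 2 * ν) = y ^ (2 * (k : ℝ) - 2 * ν) * y ^ (2 * (n - k)) := by
    rw [← Real.rpow_natCast, ← Real.rpow_add hy]
    congr 1
    push_cast [Nat.cast_sub hkn]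
    ring
  rw [if_neg hn, setIntegral_congr_fun measurableSet_Ioi e, integral_const_mul, ← h, termB,
    coeffB_eq, e2]
  ring

/-- Used for the finitely many columns without an integral representation: with n fixed, the terms
are eventually dominated by a binomial series in z. -/
theorem summable_termB {ν y z : ℝ} (hν2 : ∀ j : ℤ, 2 * ν ≠ j) (hz : 0 < z) (hz1 : z < 1)
    (n : ℕ) : Summable fun m => termB ν y z m n := by
  obtain ⟨C, hC, hζ⟩ := exists_norm_riemannZeta_le
  have hs := (hasSum_Gamma_binomial (s := 2 * n + 1 - 2 * ν) (x := z) (fun m hm =>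
    hν2 (m + 2 * n + 1) (by push_cast; linarith)) (by rwa [abs_of_pos hz])).summable.norm
  refine Summable.of_norm_bounded_eventually_nat
    (hs.mul_left (|4 ^ ν * besselCoeff (-ν) n * y ^ (2 * (n : ℝ) - 2 * ν)| * C)) ?_
  -- From this index on the zeta argument is at least 2, where the uniform bound C applies.
  obtain ⟨N, hN⟩ := exists_nat_ge (2 * ν + 1)
  filter_upwards [eventually_ge_atTop N] with m hm
  have hm' : (N : ℝ) ≤ m := by exact_mod_cast hm
  have hn : (0 : ℝ) ≤ n := Nat.cast_nonneg n
  have h1 : |realZeta (m + 2 * n + 1 - 2 * ν)| ≤ C :=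
    (Complex.abs_re_le_norm _).trans (hζ _ (by rw [Complex.ofReal_re]; linarith))
  have h2 := Real.abs_sin_le_one (Real.pi * (m / 2 - ν))
  have e : (2 * n + 1 - 2 * ν : ℝ) + m = m + 2 * n + 1 - 2 * ν := by ring
  rw [termB, coeffB_eq, e]
  simp only [norm_mul, norm_pow, norm_neg, norm_one, one_pow, one_mul, Real.norm_eq_abs, abs_mul]
  set G := |Real.Gamma (m + 2 * n + 1 - 2 * ν) / (m.factorial : ℝ)|
  set P := |(4 : ℝ) ^ ν| * |besselCoeff (-ν) n|
  set Y := |y ^ (2 * (n : ℝ) - 2 * ν)|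
  calc P * G * (|realZeta (m + 2 * n + 1 - 2 * ν)| * |Real.sin (Real.pi * (m / 2 - ν))|) *
        |z| ^ m * Y ≤ P * G * (C * 1) * |z| ^ m * Y := by gcongr
    _ = _ := by ring

theorem exists_hasIteratedSum_termB {ν y z : ℝ} (hν2 : ∀ j : ℤ, 2 * ν ≠ j) (hy : 0 < y)
    (hy1 : y < 1) (hz : 0 < z) (hz1 : z < 1) :
    ∃ R, HasIteratedSum (y + z < 1) (termB ν y z) R := by
  have hint : ∀ j : ℤ, ν ≠ j := fun j hj => hν2 (2 * j) (by push_cast; rw [hj])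
  obtain ⟨k, hk⟩ := exists_nat_gt ν
  obtain ⟨R1, h1⟩ := exists_hasIteratedSum_lt (y + z < 1) (T := termB ν y z)
    (fun n => summable_termB hν2 hz hz1 n) k
  obtain ⟨R2, h2⟩ := exists_hasIteratedSum_integral (μ := -ν) (τ := 2 * (k : ℝ) - 2 * ν)
    (q := phaseTerm ν z) (z := z) (add_neg_ne_zero hint) k (by linarith) hy hy1 hz1
    (fun m => by unfold phaseTerm; fun_prop)
    (fun x hx => by
      have hc := hasSum_real_exp (z * x)
      have hs : Summable fun m => |phaseTerm ν z m x| :=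
        Summable.of_nonneg_of_le (fun _ => abs_nonneg _) (abs_phaseTerm_le ν hz hx) hc.summable
      exact ⟨hs, (hs.tsum_le_tsum (abs_phaseTerm_le ν hz hx) hc.summable).trans_eq hc.tsum_eq⟩)
    (fun m x hx => by
      refine (abs_phaseTerm_le ν hz hx m).trans ((div_le_self (by positivity) ?_).trans ?_)
      · exact_mod_cast Nat.one_le_iff_ne_zero.2 (Nat.factorial_ne_zero _)
      · have : z * x ≤ 1 + x := by nlinarith
        calc (z * x) ^ m ≤ (1 + x) ^ m := by gcongr
          _ ≤ _ := pow_le_pow_right₀ (by linarith) (by omega))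
    (fun x _ => abs_tsum_phaseTerm_le ν z x)
  have h3 := h1.add (h2.mul_left (4 ^ ν * y ^ (2 * (k : ℝ) - 2 * ν)))
  have e : (fun m n => (if n < k then termB ν y z m n else 0) + 4 ^ ν *
      y ^ (2 * (k : ℝ) - 2 * ν) * ∫ x in Ioi 0, x ^ (2 * (k : ℝ) - 2 * ν) *
        besselTail (-ν) k n (y * x) * phaseTerm ν z m x * bose x) = termB ν y z := by
    ext m n
    rw [← termB_eq hy hk]
    split_ifs <;> simp
  exact ⟨_, e ▸ h3⟩

theorem exists_hasIteratedSum_doubleTerm {ν a b : ℝ} (hν2 : ∀ j : ℤ, 2 * ν ≠ j) (ha : 0 < a)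
    (ha2 : a < 2 * Real.pi) (hb : 0 < b) (hb2 : b < 2 * Real.pi) :
    ∃ R, HasIteratedSum (a + b < 2 * Real.pi) (doubleTerm ν a b) R ∧
      HasSum (fun k : ℕ => (-1) ^ k * coeffD ν b k * (a / (2 * Real.pi)) ^ k) R := by
  have hint : ∀ j : ℤ, ν ≠ j := fun j hj => hν2 (2 * j) (by push_cast; rw [hj])
  have hp : 0 < 2 * Real.pi := Real.two_pi_pos
  have hz : 0 < a / (2 * Real.pi) := by positivity
  have hy : 0 < b / (2 * Real.pi) := by positivity
  have hz1 : a / (2 * Real.pi) < 1 := (div_lt_one hp).2 ha2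
  have hy1 : b / (2 * Real.pi) < 1 := (div_lt_one hp).2 hb2
  obtain ⟨RA, hA⟩ := exists_hasIteratedSum_termA hint hy hy1 hz hz1
  obtain ⟨RB, hB⟩ := exists_hasIteratedSum_termB hν2 hy hy1 hz hz1
  have hyz : b / (2 * Real.pi) + a / (2 * Real.pi) < 1 ↔ a + b < 2 * Real.pi := by
    rw [← add_div, div_lt_one hp, add_comm]
  have e : doubleTerm ν a b = fun m n => termA ν (b / (2 * Real.pi)) (a / (2 * Real.pi)) m n +
      termB ν (b / (2 * Real.pi)) (a / (2 * Real.pi)) m n := by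
    ext m n
    rw [doubleTerm, termA, termB, mul_add]
  refine ⟨RA + RB, ?_, ?_⟩
  · rw [e, ← propext hyz]
    exact hA.add hB
  · have h1 : HasSum (fun m : ℕ => (-1) ^ m * coeffC ν b m * (a / (2 * Real.pi)) ^ (2 * m + 1))
        RA := by
      refine hasSum_of_eq hA.sum_row (fun m => ?_) rfl
      rw [coeffC, ← tsum_mul_left, ← tsum_mul_right]
      refine tsum_congr fun n => ?_
      rw [termC, termA, pow_add]
      ring
    have h2 : HasSum (fun m : ℕ => (-1) ^ m * coeffC' ν b m * (a / (2 * Real.pi)) ^ m) RB := by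
      refine hasSum_of_eq hB.sum_row (fun m => ?_) rfl
      rw [coeffC', ← tsum_mul_left, ← tsum_mul_right]
      refine tsum_congr fun n => ?_
      rw [termC', termB, pow_add]
      ring
    -- Row m of the A-part carries the power 2m + 1 of a, so its row sums are spread over the odd
    -- indices before the B-part is added.
    have h3 := HasSum.even_add_odd (f := fun k : ℕ => if Even k then 0 else
      (-1) ^ (k / 2) * coeffC ν b (k / 2) * (a / (2 * Real.pi)) ^ k) (m := 0) (m' := RA)
      (hasSum_of_eq hasSum_zero (fun j => if_pos (even_two_mul j)) rfl)
      (hasSum_of_eq h1 (fun j => by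
        have e1 : (2 * j + 1) / 2 = j := by omega
        rw [if_neg (by simp), e1]) rfl)
    rw [zero_add] at h3
    refine hasSum_of_eq (h3.add h2) (fun k => ?_) rfl
    rw [coeffD]
    split_ifs with hk
    · ring
    · rw [(Nat.not_even_iff_odd.1 hk).neg_one_pow, pow_succ (-1 : ℝ)]
      ring

/-! ### The endpoint a = b and the asymptotic expansion. -/

theorem two_mul_ne_int {ν : ℝ} (hν : 0 < ν) (hν2 : ∀ j : ℕ, ν ≠ (j : ℝ) / 2) (j : ℤ) :
    2 * ν ≠ j := by
  intro h
  have hj : (0 : ℝ) < j := by linarith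
  obtain ⟨n, rfl⟩ := Int.eq_ofNat_of_zero_le (Int.cast_pos.1 hj).le
  refine hν2 n ?_
  rw [Int.cast_natCast] at h
  linarith

theorem summable_besselF_nat {ν b : ℝ} (hν : 0 < ν) (hint : ∀ j : ℤ, ν ≠ j) (hb : 0 < b) :
    Summable fun n : ℕ => besselF ν (b * (n + 1)) := by
  refine (summable_exp_mul_besselF hν hint hb hb).congr fun n => ?_
  rw [zero_mul, Real.exp_zero, one_mul]

theorem norm_exp_mul_besselF_le {ν b x : ℝ} (hν : 0 < ν) (hint : ∀ j : ℤ, ν ≠ j) (hb : 0 < b)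
    (hx : 0 ≤ x) (n : ℕ) :
    ‖Real.exp (-x * ((n : ℝ) + 1)) * besselF ν (b * (n + 1))‖ ≤ besselF ν (b * (n + 1)) := by
  have h0 := besselF_nonneg hν hint (x := b * (n + 1)) (by positivity)
  rw [norm_mul, Real.norm_eq_abs, Real.norm_eq_abs, abs_of_nonneg h0, Real.abs_exp]
  refine mul_le_of_le_one_left h0 (Real.exp_le_one_iff.2 ?_)
  have : 0 ≤ x * ((n : ℝ) + 1) := by positivity
  linarith

theorem summable_summandK {ν a b : ℝ} (hν : 0 < ν) (hint : ∀ j : ℤ, ν ≠ j) (hb : 0 < b)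
    (ha : 0 ≤ a) : Summable fun n : ℕ => summandK ν a b (n + 1) := by
  rw [sumK_eq ν a hb]
  exact Summable.of_norm_bounded (summable_besselF_nat hν hint hb)
    (norm_exp_mul_besselF_le hν hint hb ha)

theorem continuousOn_sumK {ν b : ℝ} (hν : 0 < ν) (hint : ∀ j : ℤ, ν ≠ j) (hb : 0 < b) :
    ContinuousOn (fun x => sumK ν x b) (Ici 0) := by
  have e : (fun x => sumK ν x b) = fun x =>
      ∑' n : ℕ, Real.exp (-x * ((n : ℝ) + 1)) * besselF ν (b * (n + 1)) := by
    ext x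
    rw [sumK, sumK_eq ν x hb]
  rw [e]
  exact continuousOn_tsum (fun n => by fun_prop) (summable_besselF_nat hν hint hb)
    fun n x hx => norm_exp_mul_besselF_le hν hint hb hx n

/-- Summability at the right endpoint is absolute, hence gives uniform convergence on the whole
interval. -/
theorem continuousOn_tsum_mul_pow {c : ℕ → ℝ} {r p : ℝ} (hp : 0 < p)
    (hs : Summable fun k => c k * (r / p) ^ k) :
    ContinuousOn (fun x : ℝ => ∑' k, c k * (x / p) ^ k) (Icc 0 r) := by
  refine continuousOn_tsum (fun k => by fun_prop) hs.norm fun k x hx => ?_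
  have hx0 := hx.1
  have hr : 0 ≤ r := hx.1.trans hx.2
  rw [norm_mul, norm_mul, Real.norm_of_nonneg (by positivity : 0 ≤ (x / p) ^ k),
    Real.norm_of_nonneg (by positivity : 0 ≤ (r / p) ^ k)]
  have := hx.2
  gcongr

theorem hyperCoeff_succ (ν : ℝ) (n : ℕ) :
    (n + 3 / 2) * hyperCoeff ν (n + 1) = (n + 1 - ν) * hyperCoeff ν n := by
  have h1 : (0 : ℝ) < (ascPochhammer ℝ n).eval (3 / 2) := ascPochhammer_pos n _ (by norm_num)
  have h2 : (3 / 2 + n : ℝ) ≠ 0 := by positivity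
  rw [hyperCoeff, hyperCoeff, ascPochhammer_succ_eval, ascPochhammer_succ_eval]
  field_simp
  ring

/-- A telescoping form of Raabe's test: once n + 1 > ν, the recurrence makes (ν - 1/2)|c_n| equal to
(n + 1/2)|c_n| - (n + 3/2)|c_{n+1}|. -/
theorem summable_abs_hyperCoeff {ν : ℝ} (hν : 1 / 2 < ν) : Summable fun n => |hyperCoeff ν n| := by
  obtain ⟨k, hk⟩ := exists_nat_gt ν
  rw [← summable_nat_add_iff k]
  set w : ℕ → ℝ := fun n => (((n + k : ℕ) : ℝ) + 1 / 2) * |hyperCoeff ν (n + k)| with hw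
  have hstep : ∀ n, |hyperCoeff ν (n + k)| = (w n - w (n + 1)) / (ν - 1 / 2) := by
    intro n
    have h := congrArg abs (hyperCoeff_succ ν (n + k))
    have hn : (0 : ℝ) ≤ n := Nat.cast_nonneg n
    have hpos : (0 : ℝ) < ((n + k : ℕ) : ℝ) + 1 - ν := by push_cast; linarith
    rw [abs_mul, abs_mul, abs_of_pos hpos, abs_of_pos (by positivity)] at h
    have e : n + 1 + k = n + k + 1 := by omega
    have e2 : (((n + k + 1 : ℕ) : ℝ) + 1 / 2) = ((n + k : ℕ) : ℝ) + 3 / 2 := by push_cast; ring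
    rw [eq_div_iff (by linarith)]
    simp only [hw]
    rw [e, e2, h]
    ring
  refine summable_of_sum_range_le (c := w 0 / (ν - 1 / 2)) (fun n => abs_nonneg _) fun N => ?_
  rw [Finset.sum_congr rfl fun n _ => hstep n, ← Finset.sum_div, Finset.sum_range_sub']
  have h0 : 0 ≤ w N := by positivity
  have h1 : 0 < ν - 1 / 2 := by linarith
  gcongr
  linarith

theorem continuousOn_leadingPair {ν b : ℝ} (hν : 1 / 2 < ν) (hb : 0 < b) :
    ContinuousOn (fun x => leadingPair ν x b) (Icc 0 b) := by
  have hg : ContinuousOn (fun u : ℝ => ∑' n : ℕ, hyperCoeff ν n * u ^ n) (Icc 0 1) := by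
    refine continuousOn_tsum (fun n => by fun_prop) (summable_abs_hyperCoeff hν) fun n u hu => ?_
    rw [norm_mul, norm_pow, Real.norm_eq_abs, Real.norm_of_nonneg hu.1]
    exact mul_le_of_le_one_right (abs_nonneg _) (pow_le_one₀ hu.1 hu.2)
  have hmaps : MapsTo (fun x : ℝ => x ^ 2 / b ^ 2) (Icc 0 b) (Icc 0 1) := fun x hx => by
    have := hx.1
    refine ⟨by positivity, (div_le_one (by positivity)).2 ?_⟩
    have := hx.2
    gcongr
  have hh : ContinuousOn (fun x : ℝ => ∑' n : ℕ, hyperCoeff ν n * (x ^ 2 / b ^ 2) ^ n)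
      (Icc 0 b) := hg.comp (by fun_prop) hmaps
  unfold leadingPair
  simp only [ordinaryHypergeometric_eq]
  have hr : ContinuousOn (fun x : ℝ => (1 - x ^ 2 / b ^ 2) ^ (ν - 1 / 2)) (Icc 0 b) :=
    ContinuousOn.rpow_const (by fun_prop) fun x _ => Or.inr (by linarith)
  exact (continuousOn_const.mul hr).sub
    (((continuousOn_id.div_const _).mul continuousOn_const).mul hh)

/-- The error is a multiple of the tail of the D-series, which converges absolutely at b/2. For 0 <
x < b/2 each tail term is at most (x/(b/2))^N times its value there. -/
theorem isBigO_expansion {ν b : ℝ} (hν : 0 < ν) (hν2 : ∀ j : ℤ, 2 * ν ≠ j) (hb : 0 < b)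
    (hb2 : b < 2 * Real.pi) (N : ℕ) :
    (fun x : ℝ => sumK ν x b -
      (leadingPair ν x b + Real.pi * (1 / Real.sin (Real.pi * ν)) / (4 * Real.Gamma (1 + ν))
        - 1 / (2 * Real.sin (Real.pi * ν)) *
          ∑ k ∈ Finset.range N, (-1) ^ k * coeffD ν b k * (x / (2 * Real.pi)) ^ k))
      =O[𝓝[>] (0 : ℝ)] (fun x : ℝ => x ^ N) := by
  have hint : ∀ j : ℤ, ν ≠ j := fun j hj => hν2 (2 * j) (by push_cast; rw [hj])
  have hs := sin_pi_mul_ne_zero hint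
  have hp := Real.two_pi_pos
  have hr : 0 < b / 2 := by positivity
  have hsum := (hasSum_coeffD_of_lt hν hν2 hr.le (half_lt_self hb) hb2).summable.norm
  set c : ℕ → ℝ := fun k => ‖(-1) ^ k * coeffD ν b k * (b / 2 / (2 * Real.pi)) ^ k‖ with hc
  have hsN : Summable fun k => c (k + N) := (summable_nat_add_iff N).2 hsum
  refine IsBigO.of_bound (|1 / (2 * Real.sin (Real.pi * ν))| * ((∑' k, c (k + N)) / (b / 2) ^ N)) ?_
  filter_upwards [Ioo_mem_nhdsGT hr] with x hx
  have hx0 : 0 < x := hx.1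
  have hR := hasSum_coeffD_of_lt hν hν2 hx0.le (hx.2.trans (half_lt_self hb)) hb2
  have hsplit := hR.summable.sum_add_tsum_nat_add N
  rw [hR.tsum_eq] at hsplit
  have e : sumK ν x b - (leadingPair ν x b +
      Real.pi * (1 / Real.sin (Real.pi * ν)) / (4 * Real.Gamma (1 + ν)) -
        1 / (2 * Real.sin (Real.pi * ν)) *
          ∑ k ∈ Finset.range N, (-1) ^ k * coeffD ν b k * (x / (2 * Real.pi)) ^ k) =
      -(1 / (2 * Real.sin (Real.pi * ν)) *
        ∑' k, (-1) ^ (k + N) * coeffD ν b (k + N) * (x / (2 * Real.pi)) ^ (k + N)) := by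
    rw [eq_sub_of_add_eq' hsplit]
    field_simp
    ring
  have hterm : ∀ k, ‖(-1) ^ (k + N) * coeffD ν b (k + N) * (x / (2 * Real.pi)) ^ (k + N)‖ ≤
      c (k + N) * (x / (b / 2)) ^ N := by
    intro k
    have h1 : x / (b / 2) ≤ 1 := (div_le_one hr).2 hx.2.le
    have h2 : x / (2 * Real.pi) = b / 2 / (2 * Real.pi) * (x / (b / 2)) := by field_simp
    simp only [hc]
    rw [h2, mul_pow, ← mul_assoc, norm_mul _ ((x / (b / 2)) ^ (k + N)),
      Real.norm_of_nonneg (by positivity : 0 ≤ (x / (b / 2)) ^ (k + N))]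
    exact mul_le_mul_of_nonneg_left (pow_le_pow_of_le_one (by positivity) h1 (by omega))
      (norm_nonneg _)
  have htail := tsum_of_norm_bounded (hsN.mul_right ((x / (b / 2)) ^ N)).hasSum hterm
  rw [e, norm_neg, norm_mul, Real.norm_eq_abs (1 / (2 * Real.sin (Real.pi * ν))),
    Real.norm_of_nonneg (by positivity : 0 ≤ x ^ N)]
  rw [tsum_mul_right, div_pow] at htail
  calc _ ≤ |1 / (2 * Real.sin (Real.pi * ν))| *
        ((∑' k, c (k + N)) * (x ^ N / (b / 2) ^ N)) := by gcongr
    _ = _ := by ring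

/-- Take for T the value that the expansion itself forces. It is the value at a of a function `f`,
continuous on [0, a] and equal to the leading pair on [0, b), so the limit exists even at a = b. For
a = b and ν > 1/2 the leading pair is itself continuous there, and T agrees with it. For a = b and ν
< 1/2 its literal value at the endpoint comes from conventions for a negative power of zero and for
a divergent sum, so only the limit has meaning. -/
theorem exists_leadingPair_limit {ν a b R : ℝ} (hν : 0 < ν) (hν2 : ∀ j : ℤ, 2 * ν ≠ j)
    (ha : 0 < a) (hab : a ≤ b) (hb2 : b < 2 * Real.pi)
    (hR : HasSum (fun k : ℕ => (-1) ^ k * coeffD ν b k * (a / (2 * Real.pi)) ^ k) R) :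
    ∃ T : ℝ, (a < b ∨ 1 / 2 < ν → T = leadingPair ν a b) ∧
      Tendsto (fun x : ℝ => leadingPair ν x b) (𝓝[<] a) (𝓝 T) ∧
      sumK ν a b = T + Real.pi * (1 / Real.sin (Real.pi * ν)) / (4 * Real.Gamma (1 + ν))
        - 1 / (2 * Real.sin (Real.pi * ν)) * R := by
  have hint : ∀ j : ℤ, ν ≠ j := fun j hj => hν2 (2 * j) (by push_cast; rw [hj])
  have hb : 0 < b := ha.trans_le hab
  have hs := sin_pi_mul_ne_zero hint
  set κ := Real.pi * (1 / Real.sin (Real.pi * ν)) / (4 * Real.Gamma (1 + ν)) with hκ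
  set f : ℝ → ℝ := fun x => sumK ν x b - κ + 1 / (2 * Real.sin (Real.pi * ν)) *
    ∑' k : ℕ, (-1) ^ k * coeffD ν b k * (x / (2 * Real.pi)) ^ k with hf
  have hfeq : ∀ x : ℝ, 0 ≤ x → x < b → leadingPair ν x b = f x := by
    intro x hx hxb
    simp only [hf]
    rw [(hasSum_coeffD_of_lt hν hν2 hx hxb hb2).tsum_eq, ← hκ]
    field_simp
    ring
  have hcont : ContinuousOn f (Icc 0 a) :=
    (((continuousOn_sumK hν hint hb).mono Icc_subset_Ici_self).sub continuousOn_const).add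
      (continuousOn_const.mul (continuousOn_tsum_mul_pow Real.two_pi_pos hR.summable))
  have hle : 𝓝[<] a ≤ 𝓝[Icc 0 a] a :=
    le_inf nhdsWithin_le_nhds
      (le_principal_iff.2 (mem_of_superset (Ico_mem_nhdsLT ha) Ico_subset_Icc_self))
  have hlim : Tendsto (fun x : ℝ => leadingPair ν x b) (𝓝[<] a) (𝓝 (f a)) := by
    refine ((hcont a ⟨ha.le, le_rfl⟩).mono_left hle).congr' ?_
    filter_upwards [Ico_mem_nhdsLT ha] with x hx
    exact (hfeq x hx.1 (hx.2.trans_le hab)).symm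
  refine ⟨f a, fun h => ?_, hlim, ?_⟩
  · rcases hab.lt_or_eq with hlt | rfl
    · exact (hfeq a ha.le hlt).symm
    · have h' : 1 / 2 < ν := h.resolve_left (lt_irrefl a)
      exact tendsto_nhds_unique hlim
        ((continuousOn_leadingPair h' hb a ⟨ha.le, le_rfl⟩).mono_left hle)
  · simp only [hf]
    rw [hR.tsum_eq]
    ring

end BesselSum

end

theorem theorem3 (ν a b : ℝ) (hν : 0 < ν) (hν2 : ∀ j : ℕ, ν ≠ (j : ℝ) / 2)
    (ha : 0 < a) (hab : a ≤ b) (ha2 : a < 2 * Real.pi) (hb2 : b < 2 * Real.pi) :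
    -- the sum defining `S` converges
    Summable (fun n : ℕ => summandK ν a b (n + 1)) ∧
    (∃ T R : ℝ,
      -- `T` is the first plus the third term, read as a limit where these are singular
      (a < b ∨ 1 / 2 < ν → T = leadingPair ν a b) ∧
      Tendsto (fun x : ℝ => leadingPair ν x b) (𝓝[<] a) (𝓝 T) ∧
      -- the expansion
      sumK ν a b = T + Real.pi * (1 / Real.sin (Real.pi * ν)) / (4 * Real.Gamma (1 + ν))
        - 1 / (2 * Real.sin (Real.pi * ν)) * R ∧
      -- `R` is the value of the double series, summed in either order
      (∀ m : ℕ, Summable (fun n : ℕ => doubleTerm ν a b m n)) ∧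
      HasSum (fun m : ℕ => ∑' n : ℕ, doubleTerm ν a b m n) R ∧
      (∀ n : ℕ, Summable (fun m : ℕ => doubleTerm ν a b m n)) ∧
      HasSum (fun n : ℕ => ∑' m : ℕ, doubleTerm ν a b m n) R ∧
      -- and absolutely as a double series for `a + b < 2π`
      (a + b < 2 * Real.pi → HasSum (fun p : ℕ × ℕ => doubleTerm ν a b p.1 p.2) R) ∧
      -- and of the rearranged series in powers of `a`
      HasSum (fun k : ℕ => (-1) ^ k * coeffD ν b k * (a / (2 * Real.pi)) ^ k) R) ∧
    -- the series defining the coefficients converge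
    (∀ k : ℕ, Summable (termC ν b k) ∧ Summable (termC' ν b k)) ∧
    -- the rearranged series is an asymptotic series as `a → 0` with `b` fixed
    (∀ N : ℕ,
      (fun x : ℝ => sumK ν x b -
        (leadingPair ν x b + Real.pi * (1 / Real.sin (Real.pi * ν)) / (4 * Real.Gamma (1 + ν))
          - 1 / (2 * Real.sin (Real.pi * ν)) *
            ∑ k ∈ Finset.range N, (-1) ^ k * coeffD ν b k * (x / (2 * Real.pi)) ^ k))
      =O[𝓝[>] (0 : ℝ)] (fun x : ℝ => x ^ N)) := by
  have hν' := two_mul_ne_int hν hν2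
  have hint : ∀ j : ℤ, ν ≠ j := fun j hj => hν' (2 * j) (by push_cast; rw [hj])
  have hb : 0 < b := ha.trans_le hab
  obtain ⟨R, hR, hk⟩ := exists_hasIteratedSum_doubleTerm hν' ha ha2 hb hb2
  obtain ⟨T, hT1, hT2, hT3⟩ := exists_leadingPair_limit hν hν' ha hab hb2 hk
  exact ⟨summable_summandK hν hint hb ha.le,
    ⟨T, R, hT1, hT2, hT3, hR.row, hR.sum_row, hR.col, hR.sum_col, hR.double, hk⟩,
    fun k => ⟨(coeffC_eq hint hb hb2 k).1, (coeffC'_eq hν' hb hb2 k).1⟩,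
    isBigO_expansion hν hν' hb hb2⟩
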